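/- **Theorem 1.3.** Let $\Omega\subset\mathbb R^3$ be a domain and $S_0\subset\Omega$ a bounded domain. For $x\in\mathbb R^3$ write $x'=(x_1,x_2)$. *Definitions.* For $\alpha\in(0,1]$, a domain $D\subset\mathbb R^3$ is *uniformly $C^{1,\alpha}$* with constants $k,\sigma_0>0$ if for every $x_0\in\partial D$ there is an isometry $\mathcal R$ of $\mathbb R^3$ with $\mathcal R(0)=x_0$ such that $\mathcal R(\{|x'|<\sigma_0,\ k|x'|^{1+\alpha}<x_3<k\sigma_0^{1+\alpha}\})\subset D$ and $\mathcal R(\{|x'|<\sigma_0,\ k|x'|^{1+\alpha}<-x_3<k\sigma_0^{1+\alpha}\})\cap D=\emptyset$. It is *uniformly $C^3$* with constants $K,\sigma_0>0$ if for every $x_0\in\partial D$ there are an isometry $\mathcal R$ with $\mathcal R(0)=x_0$ and a $C^3$ function $g$ on $\{|x'|<\sigma_0\}$ with $g(0)=0$, $\nabla g(0)=0$, $|\nabla^2g|\le K$, $|\nabla^3g|\le K$, such that for $|x'|<\sigma_0$, $|x_3|<K\sigma_0^2$ one has $\mathcal R(x)\in D$ if and only if $x_3>g(x')$. $\Omega$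 satisfies the *inner sphere condition* if there is $r>0$ such that every $Q\in\partial\Omega$ lies on the boundary of a ball of radius $r$ contained in $\Omega$. *Motion of the body.* Let $T>0$ and $u_*,\omega\in L^\infty(0,T;\mathbb R^3)$. For $t\in[0,T)$ the body occupies the set $S(t)\subset\Omega$ of the points $x(t)$, where $x(\cdot)$ is absolutely continuous and solves $$\frac{dx}{dt}=u_*(t)+\omega(t)\times(x(t)-x_*(t))\ \text{ for a.e. }t,\qquad x(0)=x_0\in S_0,$$ and $x_*(t)\in\overline{S(t)}$ is a reference point that depends continuously on $t$. Put $F(t)=\Omega\setminus\overline{S(t)}$ and $h(t)=\mathrm{dist}(S(t),\partial\Omega)$. For $p\in[1,\infty)$ let $L^1(0,T;W^{1,p}_0(S(t),\Omega))$ be the space of those $u\in L^1(0,T;W^{1,p}_0(\Omega;\mathbb R^3))$ with $u(x,t)=u_*(t)+\omega(t)\times(x-x_*(t))$ for a.e. $t\in(0,T)$ and a.e. $x\in S(t)$, and consider $$u\in L^\infty(0,T;L^2(\Omega))\cap L^1(0,T;W^{1,p}_0(S(t),\Omega)),\qquad \operatorname{div}u=0.\tag{1}$$ *Region in the gap.*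 At time $t$ let $P\in\partial S(t)$, $Q\in\partial\Omega$ be any pair with $|PQ|=h(t)$, and take any Cartesian coordinates with origin $Q$ in which $P=(0,0,h(t))$. With $h=h(t)$ put, in these coordinates, $\mathcal C_{\sigma}=\{|x'|<\sigma,\ -k\sigma^{1+\alpha}<x_3<h+2k\sigma^{1+\alpha}\}$ in part (i), and $\mathcal C_{\sigma}=\{|x'|<\sigma,\ -K\sigma^{2}<x_3<h+2K\sigma^{2}\}$ in part (ii). **(i)** Let $\alpha\in(0,1]$, $p\in[1,\infty)$, let $\Omega$ and $S_0$ be uniformly $C^{1,\alpha}$ with constants $k,\sigma_0$, and let $\Omega$ satisfy the inner sphere condition. Then there are constants $H_0,C_w,c_0>0$ depending only on $\Omega,S_0,\alpha,p,k,\sigma_0$ such that for every $T$, every motion of the body as above and every $u$ as in (1): $h$ is Lipschitz continuous on $\{t\in[0,T):h(t)<H_0\}$, and for a.e. $t\in(0,T)$ with $h(t)<H_0$ the function $h$ is differentiable at $t$ and, with $\sigma_h=c_0h^{\frac1{1+\alpha}}$, $$\left|\frac{dh}{dt}\right|\le C_w\,h^{\frac{1+2\alpha}{p(1+\alpha)}\left(p-\frac{3+\alpha}{1+2\alpha}\right)}\,\|\nabla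 u(t)\|_{L^p(\mathcal C_{\sigma_h}\cap F(t))}$$ for every choice of $P$, $Q$ and of the coordinates. **(ii)** Let $\Omega$ and $S_0$ be uniformly $C^3$ with constants $K,\sigma_0$. Then there are constants $H_0,C_s,c_0>0$ depending only on $\Omega,S_0,K,\sigma_0$ such that for every $T$, every motion of the body as above and every $u$ as in (1) with $p=2$ and with $|\nabla^2u(t)|\in L^2(F(t))$ for a.e. $t\in(0,T)$: $h$ is Lipschitz continuous on $\{t\in[0,T):h(t)<H_0\}$, and for a.e. $t\in(0,T)$ with $h(t)<H_0$ the function $h$ is differentiable at $t$ and, with $\sigma_h=c_0h^{\frac12}$, $$\left|\frac{dh}{dt}\right|\le C_s\left(h^{\frac32}\,\|\nabla^2u(t)\|_{L^2(\mathcal C_{\sigma_h}\cap F(t))}+h\,\|\nabla u(t)\|_{L^2(\mathcal C_{\sigma_h}\cap F(t))}\right)$$ for every choice of $P$, $Q$ and of the coordinates. (At times with $h(t)=0$ the two inequalities are understood to say that $dh/dt=0$.) -/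

import Mathlib

open MeasureTheory Set Filter Topology
open scoped ENNReal NNReal ContDiff

noncomputable section

/-- Three-dimensional Euclidean space. -/
abbrev E3 : Type := EuclideanSpace ℝ (Fin 3)

/-- The plane of the first two coordinates. -/
abbrev E2 : Type := EuclideanSpace ℝ (Fin 2)

/-- The vector product in `ℝ³`. -/
def cross3 (a b : E3) : E3 := WithLp.toLp 2 (crossProduct (WithLp.ofLp a) (WithLp.ofLp b))

/-- The first two coordinates `x' = (x₁, x₂)` of `x = (x₁, x₂, x₃)`. -/
def horiz (x : E3) : E2 := !₂[x 0, x 1]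

/-- A domain: a nonempty connected open set. -/
def IsDomain3 (D : Set E3) : Prop := IsOpen D ∧ IsConnected D

/-- `D` is uniformly `C^{1,α}` with constants `k, σ₀`: in suitable Cartesian coordinates centred at
any boundary point, the part `k|x'|^{1+α} < x₃ < k σ₀^{1+α}` of the cylinder `|x'| < σ₀` lies in `D`
and the reflected part `k|x'|^{1+α} < -x₃ < k σ₀^{1+α}` lies outside `D`. (Both parts are open, so
neither of them meets the boundary of `D`.) -/
def UniformlyC1 (α k σ₀ : ℝ) (D : Set E3) : Prop :=
  0 < k ∧ 0 < σ₀ ∧ ∀ x₀ ∈ frontier D, ∃ R : E3 ≃ᵃⁱ[ℝ] E3, R 0 = x₀ ∧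
    ∀ x : E3, ‖horiz x‖ < σ₀ →
      (k * ‖horiz x‖ ^ (1 + α) < x 2 → x 2 < k * σ₀ ^ (1 + α) → R x ∈ D) ∧
      (k * ‖horiz x‖ ^ (1 + α) < -x 2 → -x 2 < k * σ₀ ^ (1 + α) → R x ∉ D)

/-- `D` is uniformly `C³` with constants `K, σ₀`: in suitable Cartesian coordinates centred at any
boundary point, inside the cylinder `|x'| < σ₀`, `|x₃| < K σ₀²` the set `D` is the region above the
graph of a `C³` function `g` with `g(0) = 0`, `∇g(0) = 0`, `|∇²g| ≤ K`, `|∇³g| ≤ K`. -/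
def UniformlyC3 (K σ₀ : ℝ) (D : Set E3) : Prop :=
  0 < K ∧ 0 < σ₀ ∧ ∀ x₀ ∈ frontier D, ∃ R : E3 ≃ᵃⁱ[ℝ] E3, R 0 = x₀ ∧
    ∃ g : E2 → ℝ, ContDiffOn ℝ 3 g (Metric.ball 0 σ₀) ∧ g 0 = 0 ∧ fderiv ℝ g 0 = 0 ∧
      (∀ y ∈ Metric.ball (0 : E2) σ₀,
        ‖iteratedFDeriv ℝ 2 g y‖ ≤ K ∧ ‖iteratedFDeriv ℝ 3 g y‖ ≤ K) ∧
      ∀ x : E3, ‖horiz x‖ < σ₀ → |x 2| < K * σ₀ ^ 2 → (R x ∈ D ↔ g (horiz x) < x 2)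

/-- The (uniform) inner sphere condition. -/
def InnerSphere (D : Set E3) : Prop :=
  ∃ r : ℝ, 0 < r ∧ ∀ Q ∈ frontier D, ∃ c : E3, dist c Q = r ∧ Metric.ball c r ⊆ D

/-- Distance between two sets. -/
def setDist (A B : Set E3) : ℝ := sInf (image2 dist A B)

/-- `v ∈ W₀^{1,p}(Ω; ℝ³)` with gradient `G`: the pair `(v, G)` is the limit in `L^p(Ω)` of
`(φₙ, Dφₙ)` for smooth `φₙ` with compact support in `Ω`. (In particular `G` is the weak gradient
of `v` in `Ω`.) -/
def MemW10 (Ω : Set E3) (p : ℝ≥0∞) (v : E3 → E3) (G : E3 → E3 →L[ℝ] E3) : Prop :=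
  MemLp v p (volume.restrict Ω) ∧ MemLp G p (volume.restrict Ω) ∧
  ∃ φ : ℕ → E3 → E3,
    (∀ n, ContDiff ℝ ∞ (φ n) ∧ HasCompactSupport (φ n) ∧ tsupport (φ n) ⊆ Ω) ∧
    Tendsto (fun n => eLpNorm (φ n - v) p (volume.restrict Ω)) atTop (𝓝 0) ∧
    Tendsto (fun n => eLpNorm (fderiv ℝ (φ n) - G) p (volume.restrict Ω)) atTop (𝓝 0)

/-- `G` is the weak derivative of `f` in the open set `U`: `G x w` is the weak derivative of `f`
at `x` in the direction `w`. -/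
def HasWeakDeriv {V : Type*} [NormedAddCommGroup V] [NormedSpace ℝ V]
    (U : Set E3) (f : E3 → V) (G : E3 → E3 →L[ℝ] V) : Prop :=
  LocallyIntegrableOn f U ∧ LocallyIntegrableOn G U ∧
  ∀ φ : E3 → ℝ, ContDiff ℝ ∞ φ → HasCompactSupport φ → tsupport φ ⊆ U → ∀ w : E3,
    ∫ x in U, (fderiv ℝ φ x w) • f x = -∫ x in U, φ x • G x w

/-- The rigid velocity field `x ↦ a + b × (x - c)`. -/
def rigidVel (a b c x : E3) : E3 := a + cross3 b (x - c)

/-- Motion of a rigid body in `Ω` on `[0, T)` with initial position `S₀`: the velocities `us`, `om`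
are in `L^∞(0,T)`, the point of the body that starts at `x₀ ∈ S₀` is at `X t x₀` at time `t` and
follows `dx/dt = us + om × (x - xs)` (integrated form), the position of the body at time `t` is
`S(t) = X t '' S₀`, it stays in `Ω`, and `xs t` is a point of its closure. -/
structure IsRigidMotion (Ω S₀ : Set E3) (T : ℝ) (us om xs : ℝ → E3) (X : ℝ → E3 → E3) : Prop where
  us_mem : MemLp us ⊤ (volume.restrict (Ioo 0 T))
  om_mem : MemLp om ⊤ (volume.restrict (Ioo 0 T))
  xs_cont : ContinuousOn xs (Ico 0 T)
  xs_mem : ∀ t ∈ Ico 0 T, xs t ∈ closure (X t '' S₀)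
  traj_cont : ∀ x₀ ∈ S₀, ContinuousOn (fun t => X t x₀) (Ico 0 T)
  traj_eq : ∀ x₀ ∈ S₀, ∀ t ∈ Ico 0 T,
    X t x₀ = x₀ + ∫ s in (0 : ℝ)..t, rigidVel (us s) (om s) (xs s) (X s x₀)
  inside : ∀ t ∈ Ico 0 T, X t '' S₀ ⊆ Ω

/-- `u ∈ L^∞(0,T; L²(Ω)) ∩ L¹(0,T; W₀^{1,p}(S(t), Ω))` with `div u = 0`, where `Du t` is the spatial
gradient of `u t` and the body moves with the velocity `us + om × (x - xs)`. For `p < ∞` a function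
is (strongly) measurable from `(0,T)` to `L^p(Ω)` iff it has a jointly measurable representative. -/
structure InBodySpace (Ω : Set E3) (S : ℝ → Set E3) (T : ℝ) (p : ℝ≥0∞) (us om xs : ℝ → E3)
    (u : ℝ → E3 → E3) (Du : ℝ → E3 → E3 →L[ℝ] E3) : Prop where
  u_meas : AEStronglyMeasurable (Function.uncurry u)
    ((volume.restrict (Ioo 0 T)).prod (volume.restrict Ω))
  Du_meas : AEStronglyMeasurable (Function.uncurry Du)
    ((volume.restrict (Ioo 0 T)).prod (volume.restrict Ω))
  bound_L2 : ∃ M : ℝ≥0, ∀ᵐ t ∂(volume.restrict (Ioo 0 T)),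
    eLpNorm (u t) 2 (volume.restrict Ω) ≤ M
  mem_W10 : ∀ᵐ t ∂(volume.restrict (Ioo 0 T)), MemW10 Ω p (u t) (Du t)
  integrable_W10 : ∫⁻ t in Ioo 0 T,
    (eLpNorm (u t) p (volume.restrict Ω) + eLpNorm (Du t) p (volume.restrict Ω)) < ⊤
  rigid : ∀ᵐ t ∂(volume.restrict (Ioo 0 T)), ∀ᵐ x ∂(volume.restrict (S t)),
    u t x = rigidVel (us t) (om t) (xs t) x
  div_free : ∀ᵐ t ∂(volume.restrict (Ioo 0 T)), ∀ᵐ x ∂(volume.restrict Ω),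
    LinearMap.trace ℝ E3 (Du t x : E3 →ₗ[ℝ] E3) = 0

/-- The cylinder `|x'| < σ`, `-k σ^{1+α} < x₃ < h + 2 k σ^{1+α}`. -/
def cyl (k α h σ : ℝ) : Set E3 :=
  {x | ‖horiz x‖ < σ ∧ -(k * σ ^ (1 + α)) < x 2 ∧ x 2 < h + 2 * (k * σ ^ (1 + α))}

/-- `R` is a Cartesian coordinate system adapted to a closest pair of points `P ∈ ∂S`, `Q ∈ ∂Ω`,
whose distance is `h`: the origin is `Q`, and `P` has the coordinates `(0, 0, h)`. -/
def IsGapFrame (Ω S : Set E3) (h : ℝ) (R : E3 ≃ᵃⁱ[ℝ] E3) : Prop :=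
  R 0 ∈ frontier Ω ∧ R !₂[0, 0, h] ∈ frontier S

end

open MeasureTheory Set Filter Topology
open scoped ENNReal NNReal ContDiff

/-! ### Vector product and trajectories of a rigid motion -/

noncomputable section

/-! The proof has a kinematic half and an analytic half. Kinematics: rigid velocities preserve
distances, so the body at time `t` is an isometric image of `S₀`, and for a.e. `t` these isometries
are differentiable at all points simultaneously. The gap `h` is Lipschitz because the trajectories
are uniformly Lipschitz. At a time of differentiability with `h > 0`, following the touching point
`P` and keeping `Q` fixed gives an upper bound for `h` with equality at `t`; comparing derivatives
shows that `h'` is the component of the velocity of `P` along `PQ` (`deriv_gap_eq_inner`). If `h =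
0`, then `h` is minimal and `h' = 0`.

Geometry: no point of the body is closer than `h` to `Q`, and the ball of radius `h` about `P` lies
in `Ω`. This forces the normals of both boundaries to be parallel to `PQ`, so the local descriptions
at `P` and at `Q` hold in the given coordinates up to a rotation about the `x₃` axis. Over a disc of
radius `σ` with `σ ^ (1 + α) = h` both boundaries deviate from planes by at most `d = k h`: below
height `-d` one is outside `Ω`, above `h + d` inside the body.

Analysis (`GapFlow`): extended by zero, `u` is weakly differentiable in the whole space, vanishes
below the gap and equals `V + M (x - h e₃)` with `M` skew above it. Let `ζ` be a radial horizontal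
cutoff, `χ` a vertical one and `Θ` the primitive of `-χ` that vanishes above. Testing `div u = 0`
with `ζ χ` and integrating by parts twice gives the flux identity `V₃ ∫ ζ = ∑ⱼ ∫ ∂ⱼζ Θ ∂₃uⱼ`
(`GapFlow.flux_eq`). The fluid part of the right side is bounded by the gradient in the gap. On the
body `∂₃uⱼ` is an entry of `M` which, by skewness, is controlled through `∂₃u₃`, tested with `xⱼ ζ
χ` (`GapFlow.rotation_bound`). Hölder's inequality on a cylinder of volume of order `σ² h` gives the
exponent in (i).

For (ii), `α = 1` and the fluid occupies `β(x') < x₃ < h + μ(x')`. Subtracting from `Θ` a multiple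
of `χ` that depends on `x'` only, one makes the weight in the fluid equal to the vertical derivative
of `(x₃ - β)(h + μ - x₃) / 2`. This profile vanishes on both walls, so a vertical integration by
parts produces the second derivative of `u` without boundary terms. The remaining terms are
velocities of the body times integrals of `∂ⱼζ` against functions of `β` and `μ`. As `∂ⱼζ` is odd,
only the odd parts of `β` and `μ` count, and these are of third order by the `C³` bounds; rotation
about the vertical axis cancels because `ζ` is radial (`GapChannel.flux_decomposition`,
`GapChannel.speed_bound`). -/

theorem cross3_apply (a b : E3) : cross3 a b =
    !₂[a 1 * b 2 - a 2 * b 1, a 2 * b 0 - a 0 * b 2, a 0 * b 1 - a 1 * b 0] := by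
  ext i
  fin_cases i <;> simp [cross3, crossProduct]

/-- The infinitesimal rotation `x ↦ b × x`. -/
def rot (b : E3) : E3 →L[ℝ] E3 :=
  LinearMap.toContinuousLinearMap
    { toFun := cross3 b
      map_add' := fun x y => by simp [cross3]
      map_smul' := fun c x => by simp [cross3] }

@[simp] theorem rot_apply (b x : E3) : rot b x = cross3 b x := rfl

theorem inner_E3 (x y : E3) : inner ℝ x y = x 0 * y 0 + x 1 * y 1 + x 2 * y 2 := by
  simp [PiLp.inner_apply, Fin.sum_univ_three]; ring

theorem norm_sq_E3 (x : E3) : ‖x‖ ^ 2 = x 0 ^ 2 + x 1 ^ 2 + x 2 ^ 2 := by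
  simp [EuclideanSpace.norm_sq_eq, Fin.sum_univ_three]

theorem inner_cross3_self (b x : E3) : inner ℝ x (cross3 b x) = 0 := by
  rw [inner_E3, cross3_apply]; simp; ring

theorem norm_cross3_le (b x : E3) : ‖cross3 b x‖ ≤ ‖b‖ * ‖x‖ := by
  refine abs_le_of_sq_le_sq' ?_ (by positivity) |>.2
  rw [mul_pow, norm_sq_E3, norm_sq_E3, norm_sq_E3, cross3_apply]
  simp
  nlinarith [sq_nonneg (b 0 * x 0 + b 1 * x 1 + b 2 * x 2)]

theorem continuous_cross3 : Continuous fun p : E3 × E3 => cross3 p.1 p.2 := by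
  simp only [cross3_apply]
  fun_prop

theorem rigidVel_sub (a b c x y : E3) :
    rigidVel a b c x - rigidVel a b c y = cross3 b (x - y) := by
  have := (rot b).map_sub (x - c) (y - c)
  simp only [rot_apply, sub_sub_sub_cancel_right] at this
  simp [rigidVel, this]

namespace IsRigidMotion

variable {Ω S₀ : Set E3} {T : ℝ} {us om xs : ℝ → E3} {X : ℝ → E3 → E3}

theorem exists_bound (hX : IsRigidMotion Ω S₀ T us om xs X) :
    ∃ C : ℝ, 0 ≤ C ∧ ∀ᵐ s ∂(volume.restrict (Ioo 0 T)), ‖us s‖ ≤ C ∧ ‖om s‖ ≤ C := by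
  have key : ∀ f : ℝ → E3, MemLp f ⊤ (volume.restrict (Ioo 0 T)) →
      ∀ᵐ s ∂(volume.restrict (Ioo 0 T)),
        ‖f s‖ ≤ (eLpNorm f ⊤ (volume.restrict (Ioo 0 T))).toReal := by
    intro f hf
    have := enorm_ae_le_eLpNormEssSup f (volume.restrict (Ioo 0 T))
    filter_upwards [this] with s hs
    rw [← eLpNorm_exponent_top] at hs
    have := ENNReal.toReal_mono hf.2.ne hs
    simpa using this
  refine ⟨max (eLpNorm us ⊤ (volume.restrict (Ioo 0 T))).toReal
    (eLpNorm om ⊤ (volume.restrict (Ioo 0 T))).toReal, by positivity, ?_⟩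
  filter_upwards [key us hX.us_mem, key om hX.om_mem] with s h1 h2
  exact ⟨h1.trans (le_max_left _ _), h2.trans (le_max_right _ _)⟩

theorem norm_rigidVel_le (a b c x : E3) :
    ‖rigidVel a b c x‖ ≤ ‖a‖ + ‖b‖ * ‖x - c‖ :=
  (norm_add_le _ _).trans (by gcongr; exact norm_cross3_le _ _)

/-- Compactness of `[0, t]` bounds the continuous function `X - xs`. The bound depends on `t` and on
the trajectory; a uniform one needs the preservation of distances and comes in `exists_lipschitz`.
-/
theorem vel_bound (hX : IsRigidMotion Ω S₀ T us om xs X) {x : E3} (hx : x ∈ S₀) {t : ℝ}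
    (ht : t ∈ Ico 0 T) :
    ∃ M : ℝ, 0 ≤ M ∧ ∀ᵐ s, s ∈ Ioo 0 t → ‖rigidVel (us s) (om s) (xs s) (X s x)‖ ≤ M := by
  obtain ⟨C, hC0, hC⟩ := hX.exists_bound
  have hsub : Icc 0 t ⊆ Ico 0 T := fun s hs => ⟨hs.1, hs.2.trans_lt ht.2⟩
  obtain ⟨B, hB⟩ := isCompact_Icc.exists_bound_of_continuousOn
    (((hX.traj_cont x hx).sub hX.xs_cont).mono hsub)
  refine ⟨C + C * max B 0, by positivity, ?_⟩
  rw [ae_restrict_iff' measurableSet_Ioo] at hC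
  filter_upwards [hC] with s hs hst
  have h1 := hs ⟨hst.1, hst.2.trans ht.2⟩
  have h2 := hB s ⟨hst.1.le, hst.2.le⟩
  refine (norm_rigidVel_le _ _ _ _).trans ?_
  gcongr
  · exact h1.1
  · exact h1.2
  · exact h2.trans (le_max_left _ _)

theorem vel_intervalIntegrable (hX : IsRigidMotion Ω S₀ T us om xs X) {x : E3} (hx : x ∈ S₀)
    {t : ℝ} (ht : t ∈ Ico 0 T) :
    IntervalIntegrable (fun s => rigidVel (us s) (om s) (xs s) (X s x)) volume 0 t := by
  obtain ⟨M, hM0, hM⟩ := hX.vel_bound hx ht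
  rw [intervalIntegrable_iff_integrableOn_Ioo_of_le ht.1]
  have hsub : Ioo 0 t ⊆ Ioo 0 T := Ioo_subset_Ioo_right ht.2.le
  have hsub' : Ioo 0 t ⊆ Ico 0 T := hsub.trans Ioo_subset_Ico_self
  have : IsFiniteMeasure (volume.restrict (Ioo 0 t)) := ⟨by simp⟩
  refine Integrable.of_bound (C := M) ?_ ?_
  · have h1 := hX.us_mem.1.mono_measure (Measure.restrict_mono hsub le_rfl)
    have h2 := hX.om_mem.1.mono_measure (Measure.restrict_mono hsub le_rfl)
    have h3 := (((hX.traj_cont x hx).sub hX.xs_cont).mono hsub').aestronglyMeasurable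
      (μ := volume) measurableSet_Ioo
    exact h1.add (continuous_cross3.comp_aestronglyMeasurable (h2.prodMk h3))
  · rwa [ae_restrict_iff' measurableSet_Ioo]

theorem traj_sub (hX : IsRigidMotion Ω S₀ T us om xs X) {x : E3} (hx : x ∈ S₀)
    {s t : ℝ} (hs : s ∈ Ico 0 T) (ht : t ∈ Ico 0 T) :
    X t x - X s x = ∫ r in s..t, rigidVel (us r) (om r) (xs r) (X r x) := by
  rw [hX.traj_eq x hx t ht, hX.traj_eq x hx s hs, add_sub_add_left_eq_sub,
    intervalIntegral.integral_interval_sub_left (hX.vel_intervalIntegrable hx ht)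
      (hX.vel_intervalIntegrable hx hs)]

theorem traj_dist_le (hX : IsRigidMotion Ω S₀ T us om xs X) {x : E3} (hx : x ∈ S₀) {t₀ M : ℝ}
    (hM : ∀ᵐ s, s ∈ Ioo 0 t₀ → ‖rigidVel (us s) (om s) (xs s) (X s x)‖ ≤ M)
    {s t : ℝ} (hs : s ∈ Icc 0 t₀) (ht : t ∈ Icc 0 t₀) (hsT : s < T) (htT : t < T) :
    ‖X t x - X s x‖ ≤ M * |t - s| := by
  rw [hX.traj_sub hx ⟨hs.1, hsT⟩ ⟨ht.1, htT⟩]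
  refine intervalIntegral.norm_integral_le_of_norm_le_const_ae ?_
  have hne : ∀ᵐ r : ℝ, r ≠ t₀ := by simp [ae_iff, measure_singleton]
  filter_upwards [hM, hne] with r hr hr0 hrm
  have := uIoc_subset_uIcc hrm
  rw [uIoc, mem_Ioc] at hrm
  refine hr ⟨(le_min hs.1 ht.1).trans_lt hrm.1, lt_of_le_of_ne (hrm.2.trans (max_le hs.2 ht.2)) hr0⟩

theorem ae_hasDerivAt (hX : IsRigidMotion Ω S₀ T us om xs X) {x : E3} (hx : x ∈ S₀) :
    ∀ᵐ t ∂(volume.restrict (Ioo 0 T)),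
      HasDerivAt (fun s => X s x) (rigidVel (us t) (om t) (xs t) (X t x)) t := by
  rw [ae_restrict_iff' measurableSet_Ioo]
  rcases le_or_gt T 0 with hT | hT
  · filter_upwards with t ht
    exact absurd (ht.1.trans ht.2) (not_lt.2 hT)
  -- Integrability of the velocity is available on `[0, t₀]` with `t₀ < T` only, so `(0, T)` is
  -- exhausted by countably many such intervals.
  have key : ∀ n : ℕ, ∀ᵐ t, t ∈ Ioo 0 (T * (1 - 1 / ((n : ℝ) + 1))) →
      HasDerivAt (fun s => X s x) (rigidVel (us t) (om t) (xs t) (X t x)) t := by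
    intro n
    set t₀ := T * (1 - 1 / ((n : ℝ) + 1))
    have hn : (0 : ℝ) < 1 / ((n : ℝ) + 1) := by positivity
    have hn1 : 1 / ((n : ℝ) + 1) ≤ 1 := by
      rw [div_le_one (by positivity)]; linarith [(Nat.cast_nonneg n : (0 : ℝ) ≤ n)]
    have h0 : t₀ ∈ Ico 0 T := ⟨mul_nonneg hT.le (by linarith), by simp only [t₀]; nlinarith⟩
    filter_upwards [(hX.vel_intervalIntegrable hx h0).ae_hasDerivAt_integral] with t ht htm
    have hmem : t ∈ uIcc 0 t₀ := by rw [uIcc_of_le h0.1]; exact ⟨htm.1.le, htm.2.le⟩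
    refine ((ht hmem 0 left_mem_uIcc).const_add x).congr_of_eventuallyEq ?_
    filter_upwards [Ioo_mem_nhds htm.1 htm.2] with s hs
    exact hX.traj_eq x hx s ⟨hs.1.le, hs.2.trans h0.2⟩
  filter_upwards [ae_all_iff.2 key] with t ht htm
  obtain ⟨n, hn⟩ := exists_nat_one_div_lt (show 0 < 1 - t / T by
    rw [sub_pos, div_lt_one hT]; exact htm.2)
  refine ht n ⟨htm.1, ?_⟩
  have : t / T < 1 - 1 / ((n : ℝ) + 1) := by linarith
  rw [div_lt_iff₀ hT] at this
  linarith

/-- The difference of two trajectories has velocity `om ×` itself, which is orthogonal to it. So the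
squared distance has derivative zero a.e.; it is absolutely continuous as the square of a Lipschitz
function, hence constant. -/
theorem dist_traj (hX : IsRigidMotion Ω S₀ T us om xs X) {x y : E3} (hx : x ∈ S₀) (hy : y ∈ S₀)
    {t : ℝ} (ht : t ∈ Ico 0 T) : ‖X t x - X t y‖ = ‖x - y‖ := by
  obtain ⟨M, hM0, hM⟩ := hX.vel_bound hx ht
  obtain ⟨N, hN0, hN⟩ := hX.vel_bound hy ht
  have hlip : LipschitzOnWith (M + N).toNNReal (fun s => ‖X s x - X s y‖) (uIcc 0 t) := by
    rw [uIcc_of_le ht.1]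
    refine LipschitzOnWith.of_dist_le_mul fun s hs r hr => ?_
    rw [Real.coe_toNNReal _ (by positivity), Real.dist_eq, Real.dist_eq]
    refine (abs_norm_sub_norm_le _ _).trans ?_
    have h1 := hX.traj_dist_le hx hM hr hs (hr.2.trans_lt ht.2) (hs.2.trans_lt ht.2)
    have h2 := hX.traj_dist_le hy hN hr hs (hr.2.trans_lt ht.2) (hs.2.trans_lt ht.2)
    calc ‖X s x - X s y - (X r x - X r y)‖ = ‖(X s x - X r x) - (X s y - X r y)‖ := by
          congr 1; abel
      _ ≤ _ := (norm_sub_le _ _).trans (by linarith)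
  have hac := hlip.absolutelyContinuousOnInterval
  have hac2 := hac.mul hac
  obtain ⟨C, hC⟩ := hac2.const_of_ae_hasDerivAt_zero (by
    have h1 := hX.ae_hasDerivAt hx
    have h2 := hX.ae_hasDerivAt hy
    rw [ae_restrict_iff' measurableSet_Ioo] at h1 h2
    have hne : ∀ᵐ r : ℝ, r ≠ 0 := by simp [ae_iff, measure_singleton]
    filter_upwards [h1, h2, hne] with s h1 h2 h0 hs
    rw [uIcc_of_le ht.1] at hs
    have hs' : s ∈ Ioo 0 T := ⟨lt_of_le_of_ne hs.1 h0.symm, hs.2.trans_lt ht.2⟩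
    have h3 := ((h1 hs').sub (h2 hs')).norm_sq
    rw [rigidVel_sub] at h3
    have h4 : inner ℝ (X s x - X s y) (cross3 (om s) (X s x - X s y)) = 0 :=
      inner_cross3_self _ _
    simp only [Pi.sub_apply] at h3
    rw [h4, mul_zero] at h3
    refine h3.congr_of_eventuallyEq (Eventually.of_forall fun r => ?_)
    simp [sq])
  have e0 := hC 0 left_mem_uIcc
  have et := hC t right_mem_uIcc
  have hT : (0 : ℝ) ∈ Ico 0 T := ⟨le_rfl, ht.1.trans_lt ht.2⟩
  have x0 : X 0 x = x := by have := hX.traj_eq x hx 0 hT; simpa using this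
  have y0 : X 0 y = y := by have := hX.traj_eq y hy 0 hT; simpa using this
  simp only [Pi.mul_apply] at e0 et
  rw [x0, y0] at e0
  exact (mul_self_inj (norm_nonneg _) (norm_nonneg _)).1 (et.trans e0.symm)

end IsRigidMotion
end

/-! ### The body as an isometric image of its initial position -/

noncomputable section

/-- By polarization `f` preserves inner products of displacements from a point `z`. Openness
provides small displacements along the three axes; their rescaled images `b` form an orthonormal
basis, and in this basis `f x - f z` has the same coordinates as `x - z`. -/
theorem exists_affineIsometryEquiv_eqOn {S₀ : Set E3} (hS : IsOpen S₀) (hne : S₀.Nonempty)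
    {f : E3 → E3} (hf : ∀ x ∈ S₀, ∀ y ∈ S₀, ‖f x - f y‖ = ‖x - y‖) :
    ∃ A : E3 ≃ᵃⁱ[ℝ] E3, ∀ x ∈ S₀, A x = f x := by
  obtain ⟨z, hz⟩ := hne
  obtain ⟨ε, hε, hball⟩ := Metric.isOpen_iff.1 hS z hz
  have hinner : ∀ x ∈ S₀, ∀ y ∈ S₀,
      inner ℝ (f x - f z) (f y - f z) = inner ℝ (x - z) (y - z) := by
    intro x hx y hy
    rw [real_inner_eq_norm_mul_self_add_norm_mul_self_sub_norm_sub_mul_self_div_two,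
      real_inner_eq_norm_mul_self_add_norm_mul_self_sub_norm_sub_mul_self_div_two,
      sub_sub_sub_cancel_right, sub_sub_sub_cancel_right, hf x hx z hz, hf y hy z hz, hf x hx y hy]
  let e : OrthonormalBasis (Fin 3) ℝ E3 := EuclideanSpace.basisFun (Fin 3) ℝ
  have hmem : ∀ i, z + (ε / 2) • e i ∈ S₀ := fun i => hball (by
    rw [Metric.mem_ball, dist_eq_norm, add_sub_cancel_left, norm_smul, e.norm_eq_one,
      Real.norm_of_nonneg (by positivity)]
    linarith)
  let b : Fin 3 → E3 := fun i => (ε / 2)⁻¹ • (f (z + (ε / 2) • e i) - f z)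
  have hb : ∀ i, ∀ x ∈ S₀, inner ℝ (b i) (f x - f z) = inner ℝ (e i) (x - z) := by
    intro i x hx
    simp only [b, real_inner_smul_left]
    rw [hinner _ (hmem i) x hx, add_sub_cancel_left, real_inner_smul_left, ← mul_assoc,
      inv_mul_cancel₀ (by positivity), one_mul]
  have hon : Orthonormal ℝ b := by
    have hbb : ∀ i j, inner ℝ (b i) (b j) = inner ℝ (e i) (e j) := by
      intro i j
      have h1 := hb i _ (hmem j)
      rw [add_sub_cancel_left, real_inner_smul_right] at h1
      simp only [b] at h1 ⊢
      rw [real_inner_smul_right, h1, ← mul_assoc, inv_mul_cancel₀ (by positivity), one_mul]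
    rw [orthonormal_iff_ite]
    intro i j
    rw [hbb]
    exact orthonormal_iff_ite.1 e.orthonormal i j
  have hspan : ⊤ ≤ Submodule.span ℝ (Set.range b) := by
    have := (basisOfOrthonormalOfCardEqFinrank hon (by simp)).span_eq
    rw [coe_basisOfOrthonormalOfCardEqFinrank] at this
    exact this.ge
  let B := OrthonormalBasis.mk hon hspan
  refine ⟨AffineIsometryEquiv.mk' (fun x => B.repr.symm (x - z) + f z) B.repr.symm z
    (fun p => by simp), fun x hx => ?_⟩
  have : B.repr (f x - f z) = x - z := by
    ext i
    rw [OrthonormalBasis.repr_apply_apply, OrthonormalBasis.coe_mk, hb i x hx]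
    have := e.repr_apply_apply (x - z) i
    simp only [e, EuclideanSpace.basisFun_repr] at this
    exact this.symm
  simp only [AffineIsometryEquiv.coe_mk', ← this, LinearIsometryEquiv.symm_apply_apply,
    sub_add_cancel]

theorem rigidVel_lineMap_sum (a b c z : E3) (w : Fin 3 → E3) (r : Fin 3 → ℝ) :
    rigidVel a b c (z + ∑ i, r i • (w i - z)) =
      rigidVel a b c z + ∑ i, r i • (rigidVel a b c (w i) - rigidVel a b c z) := by
  have h1 : ∀ x y, rigidVel a b c x - rigidVel a b c y = rot b (x - y) := rigidVel_sub a b c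
  rw [← sub_eq_iff_eq_add', h1]
  simp only [h1, add_sub_cancel_left, map_sum, map_smul]

namespace IsRigidMotion

variable {Ω S₀ : Set E3} {T : ℝ} {us om xs : ℝ → E3} {X : ℝ → E3 → E3}

/-- The exceptional null set of times in `ae_hasDerivAt` depends on the point. Here it does not: an
affine map is determined by its values at the four points `z` and `w i`, and both `A s x` and the
rigid velocity are the same affine combinations of the values there. -/
theorem exists_isometries (hX : IsRigidMotion Ω S₀ T us om xs X) (hS : IsDomain3 S₀) :
    ∃ A : ℝ → E3 ≃ᵃⁱ[ℝ] E3, (∀ t ∈ Ico 0 T, ∀ x ∈ S₀, A t x = X t x) ∧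
      ∀ᵐ t ∂(volume.restrict (Ioo 0 T)), ∀ x,
        HasDerivAt (fun s => A s x) (rigidVel (us t) (om t) (xs t) (A t x)) t := by
  have h : ∀ t, ∃ A : E3 ≃ᵃⁱ[ℝ] E3, t ∈ Ico 0 T → ∀ x ∈ S₀, A x = X t x := by
    intro t
    by_cases ht : t ∈ Ico 0 T
    · obtain ⟨A, hA⟩ := exists_affineIsometryEquiv_eqOn hS.1 hS.2.nonempty
        (fun x hx y hy => hX.dist_traj hx hy ht)
      exact ⟨A, fun _ => hA⟩
    · exact ⟨AffineIsometryEquiv.refl ℝ E3, fun h => absurd h ht⟩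
  choose A hA using h
  refine ⟨A, hA, ?_⟩
  obtain ⟨z, hz⟩ := hS.2.nonempty
  obtain ⟨ε, hε, hball⟩ := Metric.isOpen_iff.1 hS.1 z hz
  let e : OrthonormalBasis (Fin 3) ℝ E3 := EuclideanSpace.basisFun (Fin 3) ℝ
  let w : Fin 3 → E3 := fun i => z + (ε / 2) • e i
  have hmem : ∀ i, w i ∈ S₀ := fun i => hball (by
    rw [Metric.mem_ball, dist_eq_norm, add_sub_cancel_left, norm_smul, e.norm_eq_one,
      Real.norm_of_nonneg (by positivity)]
    linarith)
  have hdw : ∀ᵐ t ∂(volume.restrict (Ioo 0 T)), ∀ i,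
      HasDerivAt (fun s => X s (w i)) (rigidVel (us t) (om t) (xs t) (X t (w i))) t :=
    ae_all_iff.2 fun i => hX.ae_hasDerivAt (hmem i)
  have hIoo := ae_restrict_mem (μ := (volume : Measure ℝ)) (measurableSet_Ioo (a := 0) (b := T))
  filter_upwards [hX.ae_hasDerivAt hz, hdw, hIoo] with t h1 h2 ht x
  have hx : x = z + ∑ i, ((ε / 2)⁻¹ * (x - z) i) • (w i - z) := by
    have h3 := e.sum_repr (x - z)
    simp only [w, add_sub_cancel_left, smul_smul]
    rw [← sub_eq_iff_eq_add']
    conv_lhs => rw [← h3]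
    refine Finset.sum_congr rfl fun i _ => ?_
    rw [mul_right_comm, inv_mul_cancel₀ (by positivity), one_mul]
    simp [e]
  have hAx : ∀ s, A s x = A s z + ∑ i, ((ε / 2)⁻¹ * (x - z) i) • (A s (w i) - A s z) := by
    intro s
    have h4 : ∀ p, A s p = A s z + (A s).linearIsometryEquiv (p - z) := by
      intro p
      have := (A s).map_vadd z (p - z)
      simp only [vadd_eq_add, sub_add_cancel] at this
      rw [this, add_comm]
    rw [h4 x]
    congr 1
    have h5 : x - z = ∑ i, ((ε / 2)⁻¹ * (x - z) i) • (w i - z) := by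
      rw [sub_eq_iff_eq_add']; exact hx
    conv_lhs => rw [h5]
    rw [map_sum]
    refine Finset.sum_congr rfl fun i _ => ?_
    rw [map_smul, h4 (w i), add_sub_cancel_left (A s z)]
  have hAt : ∀ p ∈ S₀, (fun s => A s p) =ᶠ[𝓝 t] fun s => X s p := fun p hp => by
    filter_upwards [Ioo_mem_nhds ht.1 ht.2] with s hs
    exact hA s ⟨hs.1.le, hs.2⟩ p hp
  have hd : HasDerivAt (fun s => A s z + ∑ i, ((ε / 2)⁻¹ * (x - z) i) • (A s (w i) - A s z))
      (rigidVel (us t) (om t) (xs t) (A t z) + ∑ i, ((ε / 2)⁻¹ * (x - z) i) •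
        (rigidVel (us t) (om t) (xs t) (A t (w i)) - rigidVel (us t) (om t) (xs t) (A t z))) t := by
    have hz' : HasDerivAt (fun s => A s z) (rigidVel (us t) (om t) (xs t) (A t z)) t := by
      rw [(hAt z hz).eq_of_nhds]; exact h1.congr_of_eventuallyEq (hAt z hz)
    have hw' : ∀ i, HasDerivAt (fun s => A s (w i)) (rigidVel (us t) (om t) (xs t) (A t (w i))) t :=
      fun i => by
        rw [(hAt _ (hmem i)).eq_of_nhds]; exact (h2 i).congr_of_eventuallyEq (hAt _ (hmem i))
    refine hz'.add (HasDerivAt.fun_sum fun i _ => ?_)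
    exact ((hw' i).fun_sub hz').fun_const_smul _
  rw [← rigidVel_lineMap_sum, ← hAx] at hd
  exact hd.congr_of_eventuallyEq (Eventually.of_forall hAx)

/-- The trajectories are uniformly Lipschitz. -/
theorem exists_lipschitz (hX : IsRigidMotion Ω S₀ T us om xs X)
    (hb : Bornology.IsBounded S₀) :
    ∃ M : ℝ, 0 ≤ M ∧ ∀ x ∈ S₀, ∀ s ∈ Ico 0 T, ∀ t ∈ Ico 0 T, ‖X t x - X s x‖ ≤ M * |t - s| := by
  obtain ⟨C, hC0, hC⟩ := hX.exists_bound
  obtain ⟨d, hd⟩ := hb.exists_norm_le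
  rw [ae_restrict_iff' measurableSet_Ioo] at hC
  refine ⟨C + C * |2 * d|, by positivity, fun x hx s hs t ht => ?_⟩
  refine hX.traj_dist_le hx ?_ ⟨hs.1, hs.2.le⟩ ⟨ht.1, ht.2.le⟩ hs.2 ht.2
  filter_upwards [hC] with r hr hrT
  obtain ⟨h1, h2⟩ := hr hrT
  have hrT' : r ∈ Ico 0 T := ⟨hrT.1.le, hrT.2⟩
  -- The reference point lies in the closure of the body, whose diameter does not change in time.
  -- This makes the velocity bound uniform up to `T`.
  have h3 : ‖X r x - xs r‖ ≤ |2 * d| := by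
    have hsub : X r '' S₀ ⊆ Metric.closedBall (X r x) |2 * d| := by
      rintro _ ⟨y, hy, rfl⟩
      rw [Metric.mem_closedBall, dist_eq_norm, hX.dist_traj hy hx hrT']
      refine (norm_sub_le _ _).trans (le_trans ?_ (le_abs_self _))
      linarith [hd x hx, hd y hy]
    have := closure_minimal hsub Metric.isClosed_closedBall (hX.xs_mem r hrT')
    rwa [Metric.mem_closedBall, dist_comm, dist_eq_norm] at this
  refine (norm_rigidVel_le _ _ _ _).trans ?_
  gcongr

end IsRigidMotion

/-! ### The gap distance as a function of time -/

theorem setDist_nonneg (A B : Set E3) : 0 ≤ setDist A B :=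
  Real.sInf_nonneg (by rintro _ ⟨a, _, b, _, rfl⟩; exact dist_nonneg)

theorem setDist_le {A B : Set E3} {a b : E3} (ha : a ∈ closure A) (hb : b ∈ B) :
    setDist A B ≤ dist a b := by
  have hcl : IsClosed {x : E3 | setDist A B ≤ dist x b} :=
    isClosed_le continuous_const (continuous_id.dist continuous_const)
  refine closure_minimal (fun x hx => ?_) hcl ha
  have hbdd : BddBelow (image2 dist A B) :=
    ⟨0, by rintro _ ⟨a, _, b, _, rfl⟩; exact dist_nonneg⟩
  exact csInf_le hbdd ⟨x, hx, b, hb, rfl⟩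

theorem setDist_lipschitz {Ω S₀ : Set E3} (hne : S₀.Nonempty) {T M : ℝ} {X : ℝ → E3 → E3}
    (hM : ∀ x ∈ S₀, ∀ s ∈ Ico 0 T, ∀ t ∈ Ico 0 T, ‖X t x - X s x‖ ≤ M * |t - s|) :
    LipschitzOnWith M.toNNReal (fun t => setDist (X t '' S₀) (frontier Ω)) (Ico 0 T) := by
  rcases (frontier Ω).eq_empty_or_nonempty with h0 | h0
  -- If `Ω` has no boundary, the infimum is over the empty set and takes the default value `0`.
  · simp only [setDist, h0, image2_empty_right, Real.sInf_empty]
    exact ((LipschitzWith.const (0 : ℝ)).weaken zero_le).lipschitzOnWith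
  refine LipschitzOnWith.of_le_add_mul' M fun s hs t ht => ?_
  rw [← sub_le_iff_le_add]
  refine le_csInf ((hne.image _).image2 h0) ?_
  rintro _ ⟨_, ⟨x, hx, rfl⟩, q, hq, rfl⟩
  rw [sub_le_iff_le_add]
  refine (setDist_le (subset_closure (mem_image_of_mem (X s) hx)) hq).trans ?_
  refine (dist_triangle _ (X t x) _).trans ?_
  rw [add_comm, dist_eq_norm (X s x), Real.dist_eq]
  gcongr
  exact hM x hx t ht s hs

/-- The third coordinate vector. -/
def e3 : E3 := !₂[0, 0, 1]

theorem gapFrame_sub (R : E3 ≃ᵃⁱ[ℝ] E3) (h : ℝ) :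
    R !₂[0, 0, h] - R 0 = h • R.linearIsometryEquiv e3 := by
  have h1 := R.map_vadd 0 (!₂[0, 0, h] : E3)
  have h2 : (!₂[0, 0, h] : E3) = h • e3 := by
    ext i; fin_cases i <;> simp [e3]
  simp only [vadd_eq_add, add_zero] at h1
  rw [h1, add_sub_cancel_right, h2, map_smul]

theorem norm_e3 : ‖e3‖ = 1 := by
  have : ‖e3‖ ^ 2 = 1 := by rw [norm_sq_E3]; simp [e3]
  exact (pow_eq_one_iff_of_nonneg (norm_nonneg _) two_ne_zero).1 this

/-- Let `p` be the material point that is at `P` at time `t`. For all `s` near `t` the distance of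
`A s p` from the fixed point `Q` is at least `h s`, with equality at `s = t`. Thus `h s ^ 2 - ‖A s p
- Q‖ ^ 2` is maximal at `t`, and its vanishing derivative can be divided by `2 h t`. The squares
avoid differentiating a norm. -/
theorem deriv_gap_eq_inner {Ω S₀ : Set E3} {T : ℝ} {S : ℝ → Set E3} {h : ℝ → ℝ}
    {A : ℝ → E3 ≃ᵃⁱ[ℝ] E3} (hA : ∀ t ∈ Ico 0 T, S t = A t '' S₀)
    (hh : ∀ t, h t = setDist (S t) (frontier Ω)) {t : ℝ} (ht : t ∈ Ioo 0 T)
    (hd : DifferentiableAt ℝ h t) {v : E3 → E3}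
    (hv : ∀ x, HasDerivAt (fun s => A s x) (v (A t x)) t) (hpos : 0 < h t)
    {R : E3 ≃ᵃⁱ[ℝ] E3} (hR : IsGapFrame Ω (S t) (h t) R) :
    deriv h t = inner ℝ (R.linearIsometryEquiv e3) (v (R !₂[0, 0, h t])) := by
  set P := R !₂[0, 0, h t] with hP
  set Q := R 0 with hQ
  have hPQ := gapFrame_sub R (h t)
  rw [← hP, ← hQ] at hPQ
  set p := (A t).symm P
  have hAp : A t p = P := (A t).apply_symm_apply P
  have hcl : ∀ s ∈ Ico 0 T, A s p ∈ closure (S s) := by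
    have hp : p ∈ closure S₀ := by
      have h1 : P ∈ closure (S t) := frontier_subset_closure hR.2
      rw [hA t ⟨ht.1.le, ht.2⟩] at h1
      have h2 := (A t).toHomeomorph.image_closure S₀
      rw [show (A t : E3 → E3) '' S₀ = (A t).toHomeomorph '' S₀ from rfl, ← h2] at h1
      obtain ⟨y, hy, hyP⟩ := h1
      have : y = p := (A t).injective (by rw [hAp]; exact hyP)
      rwa [← this]
    intro s hs
    rw [hA s hs]
    exact image_closure_subset_closure_image (A s).continuous ⟨p, hp, rfl⟩
  have hnorm : ‖P - Q‖ = h t := by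
    rw [hPQ, norm_smul, LinearIsometryEquiv.norm_map, norm_e3, mul_one,
      Real.norm_of_nonneg hpos.le]
  have hmax : IsLocalMax (fun s => h s ^ 2 - ‖A s p - Q‖ ^ 2) t := by
    filter_upwards [Ioo_mem_nhds ht.1 ht.2] with s hs
    rw [hAp, hnorm, sub_self, sub_nonpos]
    have h1 : h s ≤ dist (A s p) Q := by
      rw [hh]; exact setDist_le (hcl s ⟨hs.1.le, hs.2⟩) hR.1
    rw [dist_eq_norm] at h1
    have h2 : 0 ≤ h s := by rw [hh]; exact setDist_nonneg _ _
    gcongr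
  have hder := (hd.hasDerivAt.fun_pow 2).sub ((hv p).sub_const Q).norm_sq
  have h0 := hmax.hasDerivAt_eq_zero hder
  rw [hAp, hPQ, real_inner_smul_left] at h0
  have : h t * (deriv h t - inner ℝ (R.linearIsometryEquiv e3) (v P)) = 0 := by
    simp only [Nat.cast_ofNat, Nat.add_one_sub_one, pow_one] at h0
    linarith
  rcases mul_eq_zero.1 this with h1 | h1
  · exact absurd h1 hpos.ne'
  · linarith

/-- A nonnegative function has a minimum where it vanishes. -/
theorem deriv_gap_eq_zero {Ω : Set E3} {S : ℝ → Set E3} {h : ℝ → ℝ}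
    (hh : ∀ t, h t = setDist (S t) (frontier Ω)) {t : ℝ} (h0 : h t = 0) : deriv h t = 0 := by
  refine IsLocalMin.deriv_eq_zero (Eventually.of_forall fun s => ?_)
  rw [h0, hh]
  exact setDist_nonneg _ _
end

/-! ### Geometry at a pair of closest points -/

noncomputable section

theorem norm_horiz_sq (x : E3) : ‖horiz x‖ ^ 2 = x 0 ^ 2 + x 1 ^ 2 := by
  simp [EuclideanSpace.norm_sq_eq, Fin.sum_univ_two, horiz]

theorem norm_sq_eq_horiz (x : E3) : ‖x‖ ^ 2 = ‖horiz x‖ ^ 2 + x 2 ^ 2 := by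
  rw [norm_horiz_sq, norm_sq_E3]

theorem horiz_add (x y : E3) : horiz (x + y) = horiz x + horiz y := by
  ext i; fin_cases i <;> simp [horiz]

theorem horiz_smul (c : ℝ) (x : E3) : horiz (c • x) = c • horiz x := by
  ext i; fin_cases i <;> simp [horiz]

theorem horiz_e3 : horiz e3 = 0 := by
  ext i; fin_cases i <;> simp [horiz, e3]

theorem inner_e3 (x : E3) : inner ℝ e3 x = x 2 := by
  rw [inner_E3]; simp [e3]

/-- The embedding of the plane as `x₃ = 0`. -/
def embed (y : E2) : E3 := !₂[y 0, y 1, 0]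

theorem horiz_embed (y : E2) : horiz (embed y) = y := by
  ext i; fin_cases i <;> simp [horiz, embed]

theorem embed_horiz_add (x : E3) : embed (horiz x) + x 2 • e3 = x := by
  ext i; fin_cases i <;> simp [horiz, embed, e3]

section Rotation

variable {N : E3 ≃ₗᵢ[ℝ] E3}

theorem apply_two_of_fix (hN : N e3 = e3) (x : E3) : (N x) 2 = x 2 := by
  rw [← inner_e3, ← inner_e3 x]
  conv_lhs => rw [← hN]
  exact N.inner_map_map _ _

theorem norm_horiz_of_fix (hN : N e3 = e3) (x : E3) : ‖horiz (N x)‖ = ‖horiz x‖ := by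
  have h1 := norm_sq_eq_horiz (N x)
  have h2 := norm_sq_eq_horiz x
  rw [N.norm_map, apply_two_of_fix hN] at h1
  exact (pow_left_inj₀ (norm_nonneg _) (norm_nonneg _) two_ne_zero).1 (by linarith)

theorem horiz_of_fix (hN : N e3 = e3) (x : E3) : horiz (N x) = horiz (N (embed (horiz x))) := by
  conv_lhs => rw [← embed_horiz_add x]
  rw [map_add, map_smul, hN, horiz_add, horiz_smul, horiz_e3, smul_zero, add_zero]

end Rotation

/-- Two frames with the same vertical direction differ by a rotation about it. -/
theorem exists_rotation {R R₀ : E3 ≃ᵃⁱ[ℝ] E3} {c : ℝ} (h0 : R₀ 0 = R !₂[0, 0, c])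
    (hlin : R₀.linearIsometryEquiv e3 = R.linearIsometryEquiv e3) :
    ∃ N : E3 ≃ₗᵢ[ℝ] E3, N e3 = e3 ∧ ∀ x, R x = R₀ (N (x - c • e3)) := by
  refine ⟨R.linearIsometryEquiv.trans R₀.linearIsometryEquiv.symm, ?_, fun x => ?_⟩
  · simp [← hlin]
  · have h1 := R.map_vadd (!₂[0, 0, c] : E3) (x - c • e3)
    have h2 := R₀.map_vadd 0
      ((R.linearIsometryEquiv.trans R₀.linearIsometryEquiv.symm) (x - c • e3))
    have h3 : x - c • e3 + !₂[0, 0, c] = x := by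
      ext i; fin_cases i <;> simp [e3]
    simp only [vadd_eq_add, add_zero, h3] at h1 h2
    rw [h1, h2, h0]
    simp

/-- Letting `t → 0`, the unit vector `e` has a nonnegative product with every vector of the open
upper half space. If `e ≠ e3`, the vector `e3 - e` is in that half space and has a negative product
with `e`. -/
theorem eq_e3_of_forall {h : ℝ} (hh : 0 < h) {e : E3} (he : ‖e‖ = 1)
    (H : ∀ d : E3, 0 < d 2 → ∀ᶠ t in 𝓝[>] (0 : ℝ), 0 ≤ 2 * h * inner ℝ e d + t * ‖d‖ ^ 2) :
    e = e3 := by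
  have hd : ∀ d : E3, 0 < d 2 → 0 ≤ inner ℝ e d := by
    intro d hd
    have ht : Tendsto (fun t : ℝ => 2 * h * inner ℝ e d + t * ‖d‖ ^ 2) (𝓝[>] 0)
        (𝓝 (2 * h * inner ℝ e d + 0 * ‖d‖ ^ 2)) :=
      (Continuous.tendsto (by fun_prop) 0).mono_left nhdsWithin_le_nhds
    have := ge_of_tendsto ht (H d hd)
    rw [zero_mul, add_zero] at this
    exact nonneg_of_mul_nonneg_right this (by positivity)
  have hee : inner ℝ e3 e = e 2 := inner_e3 e
  by_contra hne
  have h1 : inner ℝ e3 e < 1 := by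
    have := inner_lt_one_iff_real_of_norm_eq_one norm_e3 he
    exact this.2 (Ne.symm hne)
  have h2 := hd (e3 - e) (by
    have : e3 2 = 1 := by simp [e3]
    simp only [PiLp.sub_apply, this]; linarith)
  rw [inner_sub_right, real_inner_self_eq_norm_sq, he, real_inner_comm] at h2
  linarith

/-- The property of the coordinates in the definition of a uniformly `C^{1,α}` domain. -/
def C1Frame (α k σ₀ : ℝ) (D : Set E3) (R : E3 ≃ᵃⁱ[ℝ] E3) : Prop :=
  ∀ x : E3, ‖horiz x‖ < σ₀ →
      (k * ‖horiz x‖ ^ (1 + α) < x 2 → x 2 < k * σ₀ ^ (1 + α) → R x ∈ D) ∧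
      (k * ‖horiz x‖ ^ (1 + α) < -x 2 → -x 2 < k * σ₀ ^ (1 + α) → R x ∉ D)

/-- Along a ray pointing upwards the height is linear in `t`, whereas `k|x'|^{1+α}` is of higher
order. So the `C^{1,α}` condition determines the tangent half space. -/
theorem eventually_cone {α k σ₀ : ℝ} (hα : 0 < α) (hk : 0 < k) (hσ : 0 < σ₀) {d : E3}
    (hd : 0 < d 2) : ∀ᶠ t in 𝓝[>] (0 : ℝ), 0 < t ∧ ‖horiz (t • d)‖ < σ₀ ∧
      k * ‖horiz (t • d)‖ ^ (1 + α) < (t • d) 2 ∧ (t • d) 2 < k * σ₀ ^ (1 + α) := by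
  have h1 : Tendsto (fun t : ℝ => t * ‖horiz d‖) (𝓝[>] 0) (𝓝 (0 * ‖horiz d‖)) :=
    (Continuous.tendsto (by fun_prop) 0).mono_left nhdsWithin_le_nhds
  have h2 : Tendsto (fun t : ℝ => k * (t ^ α * ‖horiz d‖ ^ (1 + α))) (𝓝[>] 0)
      (𝓝 (k * ((0 : ℝ) ^ α * ‖horiz d‖ ^ (1 + α)))) := by
    have := (Real.continuous_rpow_const hα.le).tendsto 0
    exact ((this.mul_const _).const_mul k).mono_left nhdsWithin_le_nhds
  have h3 : Tendsto (fun t : ℝ => t * d 2) (𝓝[>] 0) (𝓝 (0 * d 2)) :=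
    (Continuous.tendsto (by fun_prop) 0).mono_left nhdsWithin_le_nhds
  rw [zero_mul] at h1 h3
  rw [Real.zero_rpow hα.ne', zero_mul, mul_zero] at h2
  filter_upwards [self_mem_nhdsWithin, h1.eventually_lt_const hσ, h2.eventually_lt_const hd,
    h3.eventually_lt_const (show 0 < k * σ₀ ^ (1 + α) by positivity)] with t ht h4 h5 h6
  have ht' : 0 < t := ht
  have e1 : ‖horiz (t • d)‖ = t * ‖horiz d‖ := by
    rw [horiz_smul, norm_smul, Real.norm_of_nonneg ht'.le]
  refine ⟨ht', by rwa [e1], ?_, by simpa using h6⟩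
  rw [e1, Real.mul_rpow ht'.le (norm_nonneg _), Real.rpow_add ht', Real.rpow_one]
  simp only [PiLp.smul_apply, smul_eq_mul]
  calc k * (t * t ^ α * ‖horiz d‖ ^ (1 + α)) = t * (k * (t ^ α * ‖horiz d‖ ^ (1 + α))) := by ring
    _ < t * d 2 := by gcongr

theorem norm_sq_expand (L : E3 ≃ₗᵢ[ℝ] E3) (e d : E3) (he : ‖e‖ = 1) (h t : ℝ) :
    ‖h • e + t • L d‖ ^ 2 = h ^ 2 + t * (2 * h * inner ℝ (L.symm e) d + t * ‖d‖ ^ 2) := by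
  have : inner ℝ e (L d) = inner ℝ (L.symm e) d := by
    rw [← L.inner_map_map (L.symm e) d, L.apply_symm_apply]
  rw [norm_add_sq_real, norm_smul, norm_smul, he, L.norm_map, real_inner_smul_left,
    real_inner_smul_right, this, mul_pow, mul_pow, Real.norm_eq_abs, Real.norm_eq_abs, sq_abs,
    sq_abs]
  ring

theorem frame_apply (R : E3 ≃ᵃⁱ[ℝ] E3) (x : E3) : R x = R.linearIsometryEquiv x + R 0 := by
  have := R.map_vadd 0 x
  simpa using this

theorem nonneg_of_norm_ge {L : E3 ≃ₗᵢ[ℝ] E3} {e d : E3} (he : ‖e‖ = 1) {h t : ℝ} (hh : 0 < h)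
    (ht : 0 < t) (H : h ≤ ‖h • e + t • L d‖) :
    0 ≤ 2 * h * inner ℝ (L.symm e) d + t * ‖d‖ ^ 2 := by
  have h1 : h ^ 2 ≤ ‖h • e + t • L d‖ ^ 2 := by gcongr
  rw [norm_sq_expand L e d he] at h1
  exact nonneg_of_mul_nonneg_right (by linarith : 0 ≤ t * _) ht

/-- The inner normal at a point of `∂S` points away from a point at minimal distance. -/
theorem C1Frame.normal_eq_of_inner {α k σ₀ h : ℝ} (hα : 0 < α) (hk : 0 < k) (hσ : 0 < σ₀)
    (hh : 0 < h) {D : Set E3} {R : E3 ≃ᵃⁱ[ℝ] E3} (hR : C1Frame α k σ₀ D R) {e Q : E3}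
    (he : ‖e‖ = 1) (hQ : R 0 - Q = h • e) (hD : ∀ x ∈ D, h ≤ dist x Q) :
    R.linearIsometryEquiv e3 = e := by
  have := eq_e3_of_forall hh (e := R.linearIsometryEquiv.symm e) (by simpa using he) (by
    intro d hd
    filter_upwards [eventually_cone hα hk hσ hd] with t ⟨ht, h1, h2, h3⟩
    have h4 := hD _ ((hR (t • d) h1).1 h2 h3)
    rw [dist_eq_norm, frame_apply, add_sub_assoc, hQ, map_smul, add_comm] at h4
    exact nonneg_of_norm_ge he hh ht h4)
  rw [← this, LinearIsometryEquiv.apply_symm_apply]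

/-- The inner normal at a point of `∂Ω` points to the centre of a touching inner ball. -/
theorem C1Frame.normal_eq_of_outer {α k σ₀ h : ℝ} (hα : 0 < α) (hk : 0 < k) (hσ : 0 < σ₀)
    (hh : 0 < h) {D : Set E3} {R : E3 ≃ᵃⁱ[ℝ] E3} (hR : C1Frame α k σ₀ D R) {e P : E3}
    (he : ‖e‖ = 1) (hP : P - R 0 = h • e) (hD : Metric.ball P h ⊆ D) :
    R.linearIsometryEquiv e3 = e := by
  have := eq_e3_of_forall hh (e := R.linearIsometryEquiv.symm e) (by simpa using he) (by
    intro d hd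
    filter_upwards [eventually_cone hα hk hσ hd] with t ⟨ht, h1, h2, h3⟩
    have e1 : ‖horiz (-(t • d))‖ = ‖horiz (t • d)‖ := by
      rw [← neg_one_smul ℝ, horiz_smul, norm_smul]; simp
    have h4 : R (-(t • d)) ∉ Metric.ball P h := fun h5 =>
      (hR (-(t • d)) (by rwa [e1])).2 (by rw [e1]; simpa using h2) (by simpa using h3) (hD h5)
    rw [Metric.mem_ball, not_lt, dist_comm, dist_eq_norm, frame_apply, map_neg, map_smul,
      ← sub_sub, sub_right_comm, hP, sub_neg_eq_add] at h4
    exact nonneg_of_norm_ge he hh ht h4)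
  rw [← this, LinearIsometryEquiv.apply_symm_apply]

/-- Needed since the body at any time is an isometric image of `S₀`: its boundary is uniformly
regular with constants that do not depend on time. -/
theorem UniformlyC1.image {α k σ₀ : ℝ} {D : Set E3} (hD : UniformlyC1 α k σ₀ D)
    (A : E3 ≃ᵃⁱ[ℝ] E3) : UniformlyC1 α k σ₀ (A '' D) := by
  refine ⟨hD.1, hD.2.1, fun x₀ hx₀ => ?_⟩
  have h1 := A.toHomeomorph.image_frontier D
  rw [show (A : E3 → E3) '' D = A.toHomeomorph '' D from rfl, ← h1] at hx₀
  obtain ⟨y, hy, rfl⟩ := hx₀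
  obtain ⟨R, hR0, hR⟩ := hD.2.2 y hy
  refine ⟨R.trans A, by simp [hR0], fun x hx => ⟨fun h2 h3 => ?_, fun h2 h3 => ?_⟩⟩
  · exact ⟨R x, (hR x hx).1 h2 h3, rfl⟩
  · rintro ⟨z, hz, hzx⟩
    have : z = R x := A.injective hzx
    exact (hR x hx).2 h2 h3 (this ▸ hz)

theorem UniformlyC3.image {K σ₀ : ℝ} {D : Set E3} (hD : UniformlyC3 K σ₀ D)
    (A : E3 ≃ᵃⁱ[ℝ] E3) : UniformlyC3 K σ₀ (A '' D) := by
  refine ⟨hD.1, hD.2.1, fun x₀ hx₀ => ?_⟩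
  have h1 := A.toHomeomorph.image_frontier D
  rw [show (A : E3 → E3) '' D = A.toHomeomorph '' D from rfl, ← h1] at hx₀
  obtain ⟨y, hy, rfl⟩ := hx₀
  obtain ⟨R, hR0, g, hg, hg0, hg1, hg2, hR⟩ := hD.2.2 y hy
  refine ⟨R.trans A, by simp [hR0], g, hg, hg0, hg1, hg2, fun x hx h2 => ?_⟩
  rw [← hR x hx h2]
  exact A.injective.mem_set_image

/-- A closest point of the body lies in `Ω`, together with the ball that reaches `∂Ω`. -/
theorem ball_subset_of_gap {Ω S : Set E3} (hΩ : IsOpen Ω) (hS : S ⊆ Ω) {P : E3}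
    (hP : P ∈ closure S) (hpos : 0 < setDist S (frontier Ω)) :
    Metric.ball P (setDist S (frontier Ω)) ⊆ Ω := by
  have hdisj : ∀ q ∈ frontier Ω, q ∉ Metric.ball P (setDist S (frontier Ω)) := by
    intro q hq hqP
    rw [Metric.mem_ball, dist_comm] at hqP
    exact absurd (setDist_le hP hq) (not_le.2 hqP)
  have hPΩ : P ∈ Ω := by
    by_contra hn
    have : P ∈ frontier Ω := by
      rw [frontier, hΩ.interior_eq]; exact ⟨closure_mono hS hP, hn⟩
    exact hdisj P this (Metric.mem_ball_self hpos)
  intro x hx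
  by_contra hn
  have hncl : x ∈ (closure Ω)ᶜ := fun hc => hdisj x ⟨hc, by rwa [hΩ.interior_eq]⟩ hx
  -- The ball misses `∂Ω`, hence is covered by the disjoint open sets `Ω` and `(closure Ω)ᶜ`. Being
  -- connected and containing `P ∈ Ω`, it cannot meet the second one.
  obtain ⟨q, -, hq1, hq2⟩ := (convex_ball P (setDist S (frontier Ω))).isPreconnected Ω
    (closure Ω)ᶜ hΩ isClosed_closure.isOpen_compl (fun q hq => by
      by_cases hqc : q ∈ closure Ω
      · left
        by_contra hqΩ
        exact hdisj q ⟨hqc, by rwa [hΩ.interior_eq]⟩ hq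
      · right; exact hqc)
    ⟨P, Metric.mem_ball_self hpos, hPΩ⟩ ⟨x, hx, hncl⟩
  exact hq2 (subset_closure hq1)

section Gap

variable {Ω S : Set E3} {h : ℝ} {R : E3 ≃ᵃⁱ[ℝ] E3}

theorem IsGapFrame.normal_body (hR : IsGapFrame Ω S h R) (hpos : 0 < h)
    (hh : h = setDist S (frontier Ω)) {α k σ₀ : ℝ} (hα : 0 < α) (hk : 0 < k) (hσ : 0 < σ₀)
    {R₀ : E3 ≃ᵃⁱ[ℝ] E3} (h0 : R₀ 0 = R !₂[0, 0, h]) (hR₀ : C1Frame α k σ₀ S R₀) :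
    R₀.linearIsometryEquiv e3 = R.linearIsometryEquiv e3 := by
  refine hR₀.normal_eq_of_inner hα hk hσ hpos (Q := R 0) ?_ ?_ ?_
  · rw [LinearIsometryEquiv.norm_map, norm_e3]
  · rw [h0, gapFrame_sub]
  · intro x hx
    rw [hh]
    exact setDist_le (subset_closure hx) hR.1

theorem IsGapFrame.normal_domain (hR : IsGapFrame Ω S h R) (hpos : 0 < h)
    (hh : h = setDist S (frontier Ω)) (hΩ : IsOpen Ω) (hS : S ⊆ Ω)
    {α k σ₀ : ℝ} (hα : 0 < α) (hk : 0 < k) (hσ : 0 < σ₀)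
    {R₀ : E3 ≃ᵃⁱ[ℝ] E3} (h0 : R₀ 0 = R 0) (hR₀ : C1Frame α k σ₀ Ω R₀) :
    R₀.linearIsometryEquiv e3 = R.linearIsometryEquiv e3 := by
  refine hR₀.normal_eq_of_outer hα hk hσ hpos (P := R !₂[0, 0, h]) ?_ ?_ ?_
  · rw [LinearIsometryEquiv.norm_map, norm_e3]
  · rw [h0, gapFrame_sub]
  · rw [hh]
    refine ball_subset_of_gap hΩ hS ?_ (hh ▸ hpos)
    have := frontier_subset_closure hR.2
    rwa [hh] at this

/-- The shape of the gap for uniformly `C^{1,α}` domains. -/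
theorem IsGapFrame.shape_C1 (hR : IsGapFrame Ω S h R) (hpos : 0 < h)
    (hh : h = setDist S (frontier Ω)) (hΩ : IsOpen Ω) (hS : S ⊆ Ω)
    {α k σ₀ : ℝ} (hα : 0 < α) (hΩ1 : UniformlyC1 α k σ₀ Ω) (hS1 : UniformlyC1 α k σ₀ S) :
    (∀ x : E3, ‖horiz x‖ < σ₀ → k * ‖horiz x‖ ^ (1 + α) < -x 2 → -x 2 < k * σ₀ ^ (1 + α) →
      R x ∉ Ω) ∧
    ∀ x : E3, ‖horiz x‖ < σ₀ → k * ‖horiz x‖ ^ (1 + α) < x 2 - h → x 2 - h < k * σ₀ ^ (1 + α) →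
      R x ∈ S := by
  obtain ⟨hk, hσ, hΩ1⟩ := hΩ1
  obtain ⟨-, -, hS1⟩ := hS1
  constructor
  · obtain ⟨R₀, h0, hR₀⟩ := hΩ1 _ hR.1
    obtain ⟨N, hN, hRN⟩ := exists_rotation (c := 0) (R := R) (R₀ := R₀)
      (by rw [h0]; congr 1; ext i; fin_cases i <;> simp)
      (hR.normal_domain hpos hh hΩ hS hα hk hσ h0 hR₀)
    intro x hx h1 h2
    rw [hRN, zero_smul, sub_zero]
    refine (hR₀ (N x) ?_).2 ?_ ?_ <;> simpa only [norm_horiz_of_fix hN, apply_two_of_fix hN]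
  · obtain ⟨R₀, h0, hR₀⟩ := hS1 _ hR.2
    obtain ⟨N, hN, hRN⟩ := exists_rotation (c := h) (R := R) (R₀ := R₀) h0
      (hR.normal_body hpos hh hα hk hσ h0 hR₀)
    intro x hx h1 h2
    have e1 : horiz (x - h • e3) = horiz x := by
      rw [sub_eq_add_neg, ← neg_smul, horiz_add, horiz_smul, horiz_e3, smul_zero, add_zero]
    have e2 : (x - h • e3) 2 = x 2 - h := by simp [e3]
    rw [hRN]
    refine (hR₀ (N (x - h • e3)) ?_).1 ?_ ?_ <;>
      simpa only [norm_horiz_of_fix hN, apply_two_of_fix hN, e1, e2]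

end Gap

/-! ### Quadratic growth and cubic odd part of the boundary graphs -/

theorem norm_le_of_fderiv_le {F : Type*} [NormedAddCommGroup F] [NormedSpace ℝ F] {f : E2 → F}
    {y : E2} {C : ℝ} (hd : ∀ z ∈ Metric.closedBall (0 : E2) ‖y‖, DifferentiableAt ℝ f z)
    (hC : ∀ z ∈ Metric.closedBall (0 : E2) ‖y‖, ‖fderiv ℝ f z‖ ≤ C) (h0 : f 0 = 0) :
    ‖f y‖ ≤ C * ‖y‖ := by
  have := (convex_closedBall (0 : E2) ‖y‖).norm_image_sub_le_of_norm_fderiv_le hd hC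
    (x := 0) (y := y) (by simp) (by simp)
  simpa [h0] using this

/-- The local graph of a boundary: `C¹`, of quadratic growth, and with odd part of cubic growth. -/
structure IsGraphFn (K σ₀ : ℝ) (g : E2 → ℝ) : Prop where
  contDiffOn : ContDiffOn ℝ 1 g (Metric.ball 0 σ₀)
  le_sq : ∀ y ∈ Metric.ball (0 : E2) σ₀, |g y| ≤ K * ‖y‖ ^ 2
  odd_le : ∀ y ∈ Metric.ball (0 : E2) σ₀, |g y - g (-y)| ≤ 2 * K * ‖y‖ ^ 3

-- The mean value inequality on balls about `0`, iterated. Twice for `g` itself, starting from the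
-- bound on the second derivative. For `g y - g (-y)` three times: the gradient `∇g(y) + ∇g(-y)`
-- vanishes at `0`, and its derivative `∇²g(y) - ∇²g(-y)` is at most `2 K |y|` by the bound on the
-- third derivative.
set_option maxSynthPendingDepth 4 in
theorem isGraphFn_of_contDiffOn {K σ₀ : ℝ} {g : E2 → ℝ}
    (hg : ContDiffOn ℝ 3 g (Metric.ball 0 σ₀)) (g0 : g 0 = 0) (g1 : fderiv ℝ g 0 = 0)
    (hK : ∀ y ∈ Metric.ball (0 : E2) σ₀,
        ‖iteratedFDeriv ℝ 2 g y‖ ≤ K ∧ ‖iteratedFDeriv ℝ 3 g y‖ ≤ K) :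
    IsGraphFn K σ₀ g := by
  have hat : ∀ y ∈ Metric.ball (0 : E2) σ₀, ContDiffAt ℝ 3 g y := fun y hy =>
    hg.contDiffAt (Metric.isOpen_ball.mem_nhds hy)
  have hat1 : ∀ y ∈ Metric.ball (0 : E2) σ₀, ContDiffAt ℝ 2 (fderiv ℝ g) y := fun y hy =>
    (hat y hy).fderiv_right (by norm_num)
  have hat2 : ∀ y ∈ Metric.ball (0 : E2) σ₀, ContDiffAt ℝ 1 (fderiv ℝ (fderiv ℝ g)) y :=
    fun y hy => (hat1 y hy).fderiv_right (by norm_num)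
  have n2 : ∀ y ∈ Metric.ball (0 : E2) σ₀, ‖fderiv ℝ (fderiv ℝ g) y‖ ≤ K := fun y hy => by
    rw [← norm_iteratedFDeriv_one, norm_iteratedFDeriv_fderiv]; exact (hK y hy).1
  have n3 : ∀ y ∈ Metric.ball (0 : E2) σ₀, ‖fderiv ℝ (fderiv ℝ (fderiv ℝ g)) y‖ ≤ K :=
    fun y hy => by
      rw [← norm_iteratedFDeriv_one, norm_iteratedFDeriv_fderiv, norm_iteratedFDeriv_fderiv]
      exact (hK y hy).2
  have hsub : ∀ y ∈ Metric.ball (0 : E2) σ₀,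
      Metric.closedBall (0 : E2) ‖y‖ ⊆ Metric.ball 0 σ₀ := fun y hy =>
    Metric.closedBall_subset_ball (by simpa using hy)
  have hle : ∀ {y z : E2}, z ∈ Metric.closedBall (0 : E2) ‖y‖ → ‖z‖ ≤ ‖y‖ := fun h => by
    simpa using h
  have hneg : ∀ y ∈ Metric.ball (0 : E2) σ₀, -y ∈ Metric.ball (0 : E2) σ₀ := fun y hy => by
    simpa using hy
  refine ⟨hg.of_le (by norm_num), fun y hy => ?_, fun y hy => ?_⟩
  · have hK0 : 0 ≤ K := (norm_nonneg _).trans (n2 y hy)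
    have h1 : ∀ z ∈ Metric.ball (0 : E2) σ₀, ‖fderiv ℝ g z‖ ≤ K * ‖z‖ := fun z hz =>
      norm_le_of_fderiv_le
        (fun w hw => (hat1 w (hsub z hz hw)).differentiableAt (by norm_num))
        (fun w hw => n2 w (hsub z hz hw)) g1
    have h2 := norm_le_of_fderiv_le (y := y) (f := g) (C := K * ‖y‖)
      (fun w hw => (hat w (hsub y hy hw)).differentiableAt (by norm_num))
      (fun w hw => (h1 w (hsub y hy hw)).trans (by gcongr; exact hle hw)) g0
    rw [Real.norm_eq_abs] at h2
    linarith
  · have hK0 : 0 ≤ K := (norm_nonneg _).trans (n2 y hy)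
    have hsplit : ∀ z ∈ Metric.ball (0 : E2) σ₀,
        ‖fderiv ℝ (fderiv ℝ g) z - fderiv ℝ (fderiv ℝ g) (-z)‖ ≤ 2 * K * ‖z‖ := by
      intro z hz
      have := (convex_ball (0 : E2) σ₀).norm_image_sub_le_of_norm_fderiv_le
        (fun w hw => (hat2 w hw).differentiableAt (by norm_num)) n3 (hneg z hz) hz
      have e : ‖z - -z‖ = 2 * ‖z‖ := by
        rw [sub_neg_eq_add, ← two_smul ℝ z, norm_smul]; simp
      rw [e] at this
      linarith
    have d1 : ∀ z ∈ Metric.ball (0 : E2) σ₀,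
        HasFDerivAt (fun w => fderiv ℝ g w + fderiv ℝ g (-w))
          (fderiv ℝ (fderiv ℝ g) z - fderiv ℝ (fderiv ℝ g) (-z)) z := by
      intro z hz
      have a := ((hat1 z hz).differentiableAt (by norm_num)).hasFDerivAt
      have b := ((hat1 (-z) (hneg z hz)).differentiableAt (by norm_num)).hasFDerivAt
      have c := b.comp z (hasFDerivAt_id z).neg
      have := a.add c
      refine this.congr_fderiv ?_
      ext u v
      simp [sub_eq_add_neg]
    have d0 : ∀ z ∈ Metric.ball (0 : E2) σ₀,
        HasFDerivAt (fun w => g w - g (-w)) (fderiv ℝ g z + fderiv ℝ g (-z)) z := by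
      intro z hz
      have a := ((hat z hz).differentiableAt (by norm_num)).hasFDerivAt
      have b := ((hat (-z) (hneg z hz)).differentiableAt (by norm_num)).hasFDerivAt
      have c := b.comp z (hasFDerivAt_id z).neg
      have := a.sub c
      refine this.congr_fderiv ?_
      ext u
      simp [sub_eq_add_neg]
    have h1 : ∀ z ∈ Metric.ball (0 : E2) σ₀,
        ‖fderiv ℝ g z + fderiv ℝ g (-z)‖ ≤ 2 * K * ‖z‖ * ‖z‖ := fun z hz =>
      norm_le_of_fderiv_le (f := fun w => fderiv ℝ g w + fderiv ℝ g (-w))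
        (fun w hw => (d1 w (hsub z hz hw)).differentiableAt)
        (fun w hw => by
          rw [(d1 w (hsub z hz hw)).fderiv]
          exact (hsplit w (hsub z hz hw)).trans (by gcongr; exact hle hw))
        (by simp [g1])
    have h2 := norm_le_of_fderiv_le (y := y) (f := fun w => g w - g (-w))
      (C := 2 * K * ‖y‖ * ‖y‖)
      (fun w hw => (d0 w (hsub y hy hw)).differentiableAt)
      (fun w hw => by
        rw [(d0 w (hsub y hy hw)).fderiv]
        refine (h1 w (hsub y hy hw)).trans ?_
        have := hle hw
        gcongr)
      (by simp)
    rw [Real.norm_eq_abs] at h2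
    calc |g y - g (-y)| ≤ 2 * K * ‖y‖ * ‖y‖ * ‖y‖ := h2
      _ = _ := by ring

/-- The map induced on the horizontal plane by a rotation about the vertical axis. -/
def planeMap (N : E3 ≃ₗᵢ[ℝ] E3) : E2 →ₗ[ℝ] E2 where
  toFun y := horiz (N (embed y))
  map_add' x y := by
    rw [← horiz_add, ← map_add]; congr 2; ext i; fin_cases i <;> simp [embed]
  map_smul' c x := by
    rw [RingHom.id_apply, ← horiz_smul, ← map_smul]; congr 2; ext i; fin_cases i <;> simp [embed]

/-- The induced map of the plane is linear and preserves the norm, in particular it commutes with `y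
↦ -y`. This allows to pass from the coordinates of the regularity assumption to any adapted
coordinates. -/
theorem IsGraphFn.comp_planeMap {K σ₀ : ℝ} {g : E2 → ℝ} (hg : IsGraphFn K σ₀ g)
    {N : E3 ≃ₗᵢ[ℝ] E3} (hN : N e3 = e3) : IsGraphFn K σ₀ (g ∘ planeMap N) := by
  have hnorm : ∀ y, ‖planeMap N y‖ = ‖y‖ := fun y => by
    change ‖horiz (N (embed y))‖ = ‖y‖
    rw [norm_horiz_of_fix hN, horiz_embed]
  have hmaps : ∀ y ∈ Metric.ball (0 : E2) σ₀, planeMap N y ∈ Metric.ball (0 : E2) σ₀ :=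
    fun y hy => by simpa [hnorm] using hy
  refine ⟨hg.contDiffOn.comp ?_ hmaps, fun y hy => ?_, fun y hy => ?_⟩
  · exact (LinearMap.toContinuousLinearMap (planeMap N)).contDiff.contDiffOn
  · have := hg.le_sq _ (hmaps y hy)
    rwa [hnorm] at this
  · have := hg.odd_le _ (hmaps y hy)
    rw [hnorm, ← map_neg] at this
    exact this

/-- A uniformly `C³` frame is a uniformly `C^{1,1}` frame. -/
theorem c1Frame_of_graph {K σ₀ : ℝ} (hK : 0 < K) {D : Set E3} {R : E3 ≃ᵃⁱ[ℝ] E3} {g : E2 → ℝ}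
    (hg : IsGraphFn K σ₀ g)
    (hD : ∀ x : E3, ‖horiz x‖ < σ₀ → |x 2| < K * σ₀ ^ 2 → (R x ∈ D ↔ g (horiz x) < x 2)) :
    C1Frame 1 K σ₀ D R := by
  have e : (1 : ℝ) + 1 = (2 : ℕ) := by norm_num
  intro x hx
  rw [e, Real.rpow_natCast, Real.rpow_natCast]
  have h0 : 0 ≤ K * ‖horiz x‖ ^ 2 := by positivity
  have h1 := abs_le.1 (hg.le_sq (horiz x) (by simpa using hx))
  refine ⟨fun h2 h3 => ?_, fun h2 h3 => ?_⟩
  · exact (hD x hx (by rw [abs_of_pos (by linarith)]; exact h3)).2 (by linarith)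
  · rw [hD x hx (by rw [abs_of_neg (by linarith)]; exact h3)]
    linarith

theorem UniformlyC3.exists_frame {K σ₀ : ℝ} {D : Set E3} (hD : UniformlyC3 K σ₀ D) {x₀ : E3}
    (hx₀ : x₀ ∈ frontier D) : ∃ R : E3 ≃ᵃⁱ[ℝ] E3, R 0 = x₀ ∧ ∃ g : E2 → ℝ, IsGraphFn K σ₀ g ∧
      ∀ x : E3, ‖horiz x‖ < σ₀ → |x 2| < K * σ₀ ^ 2 → (R x ∈ D ↔ g (horiz x) < x 2) := by
  obtain ⟨R, h0, g, h1, h2, h3, h4, h5⟩ := hD.2.2 x₀ hx₀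
  exact ⟨R, h0, g, isGraphFn_of_contDiffOn h1 h2 h3 h4, h5⟩

theorem UniformlyC3.uniformlyC1 {K σ₀ : ℝ} {D : Set E3} (hD : UniformlyC3 K σ₀ D) :
    UniformlyC1 1 K σ₀ D := by
  refine ⟨hD.1, hD.2.1, fun x₀ hx₀ => ?_⟩
  obtain ⟨R, h0, g, hg, hR⟩ := hD.exists_frame hx₀
  exact ⟨R, h0, c1Frame_of_graph hD.1 hg hR⟩

/-- The shape of the gap for uniformly `C³` domains. -/
theorem IsGapFrame.shape_C3 {Ω S : Set E3} {h : ℝ} {R : E3 ≃ᵃⁱ[ℝ] E3} (hR : IsGapFrame Ω S h R)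
    (hpos : 0 < h) (hh : h = setDist S (frontier Ω)) (hΩ : IsOpen Ω) (hS : S ⊆ Ω)
    {K σ₀ : ℝ} (hΩ1 : UniformlyC3 K σ₀ Ω) (hS1 : UniformlyC3 K σ₀ S) :
    (∃ β : E2 → ℝ, IsGraphFn K σ₀ β ∧ ∀ x : E3, ‖horiz x‖ < σ₀ → |x 2| < K * σ₀ ^ 2 →
      (R x ∈ Ω ↔ β (horiz x) < x 2)) ∧
    ∃ μ : E2 → ℝ, IsGraphFn K σ₀ μ ∧ ∀ x : E3, ‖horiz x‖ < σ₀ → |x 2 - h| < K * σ₀ ^ 2 →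
      (R x ∈ S ↔ μ (horiz x) < x 2 - h) := by
  constructor
  · obtain ⟨R₀, h0, g, hg, hR₀⟩ := hΩ1.exists_frame hR.1
    obtain ⟨N, hN, hRN⟩ := exists_rotation (c := 0) (R := R) (R₀ := R₀)
      (by rw [h0]; congr 1; ext i; fin_cases i <;> simp)
      (hR.normal_domain hpos hh hΩ hS one_pos hΩ1.1 hΩ1.2.1 h0 (c1Frame_of_graph hΩ1.1 hg hR₀))
    refine ⟨_, hg.comp_planeMap hN, fun x hx h1 => ?_⟩
    rw [hRN, zero_smul, sub_zero, hR₀ (N x) (by rwa [norm_horiz_of_fix hN])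
      (by rwa [apply_two_of_fix hN]), apply_two_of_fix hN, horiz_of_fix hN]
    rfl
  · obtain ⟨R₀, h0, g, hg, hR₀⟩ := hS1.exists_frame hR.2
    obtain ⟨N, hN, hRN⟩ := exists_rotation (c := h) (R := R) (R₀ := R₀) h0
      (hR.normal_body hpos hh one_pos hS1.1 hS1.2.1 h0 (c1Frame_of_graph hS1.1 hg hR₀))
    refine ⟨_, hg.comp_planeMap hN, fun x hx h1 => ?_⟩
    have e1 : horiz (x - h • e3) = horiz x := by
      rw [sub_eq_add_neg, ← neg_smul, horiz_add, horiz_smul, horiz_e3, smul_zero, add_zero]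
    have e2 : (x - h • e3) 2 = x 2 - h := by simp [e3]
    rw [hRN, hR₀ (N _) (by rwa [norm_horiz_of_fix hN, e1])
      (by rwa [apply_two_of_fix hN, e2]), apply_two_of_fix hN, horiz_of_fix hN, e1, e2]
    rfl
end

/-! ### Null boundaries and weak derivatives -/

noncomputable section

/-- The boundary of a uniformly `C^{1,α}` open set is a null set. -/
theorem UniformlyC1.volume_frontier {α k σ₀ : ℝ} (hα : 0 < α) {D : Set E3} (hDo : IsOpen D)
    (hD : UniformlyC1 α k σ₀ D) : volume (frontier D) = 0 := by
  obtain ⟨hk, hσ, hD⟩ := hD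
  have hfr : frontier D ∩ D = ∅ := by
    rw [hDo.frontier_eq]; exact sdiff_inter_self
  have hae := Besicovitch.ae_tendsto_measure_inter_div (volume : Measure E3) (frontier D)
  -- By Lebesgue's theorem almost every point of the boundary is a point of density one. It is shown
  -- that no boundary point is.
  have hfalse : ∀ᵐ x ∂(volume.restrict (frontier D)), False := by
    filter_upwards [hae, ae_restrict_mem isClosed_frontier.measurableSet] with x hx hxf
    obtain ⟨R, hR0, hR⟩ := hD x hxf
    have ht1 : Tendsto (fun r : ℝ => k * (1 + r) ^ (1 + α) * r ^ α) (𝓝[>] 0)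
        (𝓝 (k * (1 + 0) ^ (1 + α) * (0 : ℝ) ^ α)) := by
      have h1 := (Real.continuous_rpow_const hα.le).tendsto 0
      have h2 : Tendsto (fun r : ℝ => (1 + r) ^ (1 + α)) (𝓝 0) (𝓝 ((1 + 0) ^ (1 + α))) :=
        ((Real.continuous_rpow_const (by positivity : 0 ≤ 1 + α)).comp
          (continuous_const.add continuous_id)).tendsto 0
      exact ((h2.const_mul k).mul h1).mono_left nhdsWithin_le_nhds
    rw [Real.zero_rpow hα.ne', mul_zero] at ht1
    have ht2 : Tendsto (fun r : ℝ => r) (𝓝[>] 0) (𝓝 0) := nhdsWithin_le_nhds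
    have hev : ∀ᶠ r in 𝓝[>] (0 : ℝ),
        volume (frontier D ∩ Metric.closedBall x r) / volume (Metric.closedBall x r) ≤
          1 - ENNReal.ofReal (1 / 64) := by
      filter_upwards [self_mem_nhdsWithin, ht1.eventually_lt_const (show (0 : ℝ) < 1 by norm_num),
        ht2.eventually_lt_const hσ,
        ht2.eventually_lt_const (show 0 < k * σ₀ ^ (1 + α) by positivity)] with r hr0 h1 h2 h3
      have hr : 0 < r := hr0
      -- Once `k r ^ α < 1`, the ball of radius `r / 4` centred at height `r / 2` lies above
      -- `k|x'|^{1+α}`, hence in the open set `D`, which is disjoint from its boundary. It takes the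
      -- share `(1 / 4) ^ 3 = 1 / 64` of the ball of radius `r`.
      set c : E3 := R ((r / 2) • e3) with hc
      have hcx : dist c x = r / 2 := by
        rw [hc, ← hR0, R.dist_map, dist_zero_right, norm_smul, norm_e3, mul_one,
          Real.norm_of_nonneg (by positivity)]
      have hb1 : Metric.ball c (r / 4) ⊆ Metric.closedBall x r := fun y hy => by
        rw [Metric.mem_closedBall]
        rw [Metric.mem_ball] at hy
        linarith [dist_triangle y c x]
      have hb2 : Metric.ball c (r / 4) ⊆ D := by
        intro y hy
        set z := R.symm y with hz
        have hzy : R z = y := R.apply_symm_apply y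
        have hzc : ‖z - (r / 2) • e3‖ < r / 4 := by
          rw [← dist_eq_norm, ← R.dist_map, hzy]; exact hy
        have hsq := norm_sq_eq_horiz (z - (r / 2) • e3)
        have e1 : horiz (z - (r / 2) • e3) = horiz z := by
          rw [sub_eq_add_neg, ← neg_smul, horiz_add, horiz_smul, horiz_e3, smul_zero, add_zero]
        have e2 : (z - (r / 2) • e3) 2 = z 2 - r / 2 := by simp [e3]
        rw [e1, e2] at hsq
        have hlt : ‖z - (r / 2) • e3‖ ^ 2 < (r / 4) ^ 2 := by gcongr
        have h4 : ‖horiz z‖ < r / 4 :=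
          lt_of_pow_lt_pow_left₀ 2 (by positivity) (by nlinarith [sq_nonneg (z 2 - r / 2)])
        have h5 : |z 2 - r / 2| < r / 4 :=
          abs_lt_of_sq_lt_sq (by nlinarith [sq_nonneg ‖horiz z‖]) (by positivity)
        rw [abs_lt] at h5
        rw [← hzy]
        refine (hR z (by linarith)).1 ?_ (by linarith)
        have h6 : k * ‖horiz z‖ ^ (1 + α) ≤ k * (r / 4) ^ (1 + α) := by gcongr
        have h7 : (r / 4) ^ (1 + α) ≤ (r / 4) * r ^ α := by
          rw [Real.rpow_add (by positivity), Real.rpow_one]; gcongr; linarith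
        have h8 : k * r ^ α < 1 := by
          refine lt_of_le_of_lt ?_ h1
          have : (1 : ℝ) ≤ (1 + r) ^ (1 + α) := Real.one_le_rpow (by linarith) (by positivity)
          have h9 : k * 1 ≤ k * (1 + r) ^ (1 + α) := by gcongr
          have := Real.rpow_nonneg hr.le α
          nlinarith
        have h9 : k * ((r / 4) * r ^ α) < r / 4 := by
          calc k * ((r / 4) * r ^ α) = (r / 4) * (k * r ^ α) := by ring
            _ < (r / 4) * 1 := by gcongr
            _ = r / 4 := by ring
        have h10 : k * (r / 4) ^ (1 + α) ≤ k * ((r / 4) * r ^ α) := by gcongr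
        linarith
      have hsub : frontier D ∩ Metric.closedBall x r ⊆
          Metric.closedBall x r \ Metric.ball c (r / 4) := by
        rintro y ⟨hy1, hy2⟩
        exact ⟨hy2, fun hy3 => by
          have : y ∈ frontier D ∩ D := ⟨hy1, hb2 hy3⟩
          rw [hfr] at this; exact this⟩
      have hfin : volume (Metric.closedBall x r) ≠ ⊤ := measure_closedBall_lt_top.ne
      have hpos : volume (Metric.closedBall x r) ≠ 0 :=
        (Metric.measure_closedBall_pos volume x hr).ne'
      have hvol : volume (Metric.ball c (r / 4)) =
          ENNReal.ofReal (1 / 64) * volume (Metric.closedBall x r) := by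
        rw [Measure.addHaar_ball _ _ (by positivity), Measure.addHaar_closedBall _ _ hr.le,
          ← mul_assoc, ← ENNReal.ofReal_mul (by positivity)]
        congr 2
        simp only [finrank_euclideanSpace, Fintype.card_fin]
        ring
      refine ENNReal.div_le_of_le_mul ((measure_mono hsub).trans ?_)
      rw [measure_sdiff hb1 measurableSet_ball.nullMeasurableSet
        (measure_ball_lt_top.ne), hvol, ENNReal.sub_mul (fun _ _ => hfin), one_mul]
    have := le_of_tendsto hx hev
    have h2 : (1 : ℝ≥0∞) - ENNReal.ofReal (1 / 64) < 1 :=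
      ENNReal.sub_lt_self ENNReal.one_ne_top one_ne_zero (by simp)
    exact absurd this (not_le.2 h2)
  rw [ae_iff] at hfalse
  simpa using hfalse

section Sobolev

theorem integrable_smul_of_hasCompactSupport {V : Type*} [NormedAddCommGroup V] [NormedSpace ℝ V]
    {a : E3 → ℝ} (ha : Continuous a) (hac : HasCompactSupport a) {f : E3 → V} (hf : Continuous f) :
    Integrable (fun x => a x • f x) volume := by
  have hc : Continuous fun x => a x • f x := ha.smul hf
  exact hc.integrable_of_hasCompactSupport (hac.smul_right (f' := f))

theorem integrable_smul_of_memLp {V : Type*} [NormedAddCommGroup V] [NormedSpace ℝ V] {a : E3 → ℝ}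
    (ha : Continuous a) (hac : HasCompactSupport a) {p : ℝ≥0∞} (hp : 1 ≤ p) {ν : Measure E3}
    [IsLocallyFiniteMeasure ν] {f : E3 → V} (hf : MemLp f p ν) :
    Integrable (fun x => a x • f x) ν := by
  have := ENNReal.HolderConjugate.conjExponent hp
  have hq : MemLp a p.conjExponent ν := ha.memLp_of_hasCompactSupport hac
  exact memLp_one_iff_integrable.1 (hf.smul hq)

theorem tendsto_integral_smul_of_Lp {V : Type*} [NormedAddCommGroup V] [NormedSpace ℝ V]
    {a : E3 → ℝ} (ha : Continuous a) (hac : HasCompactSupport a) {p : ℝ≥0∞} (hp : 1 ≤ p)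
    {ν : Measure E3} [IsLocallyFiniteMeasure ν] {f : E3 → V} (hf : MemLp f p ν) {g : ℕ → E3 → V}
    (hg : ∀ n, MemLp (g n) p ν) (h : Tendsto (fun n => eLpNorm (g n - f) p ν) atTop (𝓝 0)) :
    Tendsto (fun n => ∫ x, a x • g n x ∂ν) atTop (𝓝 (∫ x, a x • f x ∂ν)) := by
  refine tendsto_integral_of_L1' _ (integrable_smul_of_memLp ha hac hp hf).1
    (Eventually.of_forall fun n => integrable_smul_of_memLp ha hac hp (hg n)) ?_
  have := ENNReal.HolderConjugate.conjExponent hp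
  have hq : MemLp a p.conjExponent ν := ha.memLp_of_hasCompactSupport hac
  have hlim := ENNReal.Tendsto.const_mul h (Or.inr hq.2.ne)
  rw [mul_zero] at hlim
  refine tendsto_of_tendsto_of_tendsto_of_le_of_le tendsto_const_nhds hlim (fun _ => zero_le)
    fun n => ?_
  have e : ((fun x => a x • g n x) - fun x => a x • f x) = a • (g n - f) := by
    ext x; simp [smul_sub]
  rw [e]
  exact eLpNorm_smul_le_mul_eLpNorm ((hg n).1.sub hf.1) hq.1

/-- A function in `W₀^{1,p}(Ω)` extended by zero is weakly differentiable in the whole space. -/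
theorem MemW10.integral_fderiv_smul {Ω : Set E3} {p : ℝ≥0∞} (hp : 1 ≤ p)
    {v : E3 → E3} {G : E3 → E3 →L[ℝ] E3} (h : MemW10 Ω p v G) {ψ : E3 → ℝ} (hψ : ContDiff ℝ 1 ψ)
    (hψc : HasCompactSupport ψ) (w : E3) :
    ∫ x in Ω, fderiv ℝ ψ x w • v x = -∫ x in Ω, ψ x • G x w := by
  obtain ⟨hv, hG, φ, hφ, h1, h2⟩ := h
  have hda : Continuous fun x => fderiv ℝ ψ x w :=
    (hψ.continuous_fderiv one_ne_zero).clm_apply continuous_const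
  have hdc : HasCompactSupport fun x => fderiv ℝ ψ x w :=
    (hψc.fderiv (𝕜 := ℝ)).comp_left (g := fun L : E3 →L[ℝ] ℝ => L w) (by simp)
  have hφd : ∀ n, Continuous (fderiv ℝ (φ n)) := fun n => (hφ n).1.continuous_fderiv (by simp)
  have hφdc : ∀ n, HasCompactSupport (fderiv ℝ (φ n)) := fun n => (hφ n).2.1.fderiv (𝕜 := ℝ)
  have l1 := tendsto_integral_smul_of_Lp hda hdc hp hv
    (fun n => ((hφ n).1.continuous.memLp_of_hasCompactSupport (hφ n).2.1).restrict Ω) h1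
  have l2 := tendsto_integral_smul_of_Lp hψ.continuous hψc hp hG
    (fun n => ((hφd n).memLp_of_hasCompactSupport (hφdc n)).restrict Ω) h2
  have l3 := ((ContinuousLinearMap.apply ℝ E3 w).continuous.tendsto _).comp l2
  have hzero : ∀ n x, x ∉ Ω → φ n x = 0 := fun n x hx =>
    image_eq_zero_of_notMem_tsupport fun h => hx ((hφ n).2.2 h)
  have hzero' : ∀ n x, x ∉ Ω → fderiv ℝ (φ n) x = 0 := fun n x hx =>
    image_eq_zero_of_notMem_tsupport fun h => hx ((hφ n).2.2 (tsupport_fderiv_subset ℝ h))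
  -- The approximating functions vanish outside `Ω`, so the integrals are integrals over the whole
  -- space and there is no boundary term, although `ψ` need not vanish on `∂Ω`.
  have e : ∀ n, ∫ x in Ω, fderiv ℝ ψ x w • φ n x =
      -(ContinuousLinearMap.apply ℝ E3 w) (∫ x in Ω, ψ x • fderiv ℝ (φ n) x) := by
    intro n
    have hint : Integrable fun x => ψ x • fderiv ℝ (φ n) x :=
      integrable_smul_of_hasCompactSupport hψ.continuous hψc (hφd n)
    rw [setIntegral_eq_integral_of_forall_compl_eq_zero (fun x hx => by rw [hzero n x hx, smul_zero]),
      setIntegral_eq_integral_of_forall_compl_eq_zero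
        (fun x hx => by rw [hzero' n x hx]; exact smul_zero _),
      ContinuousLinearMap.apply_apply, ContinuousLinearMap.integral_apply hint]
    have := integral_smul_fderiv_eq_neg_fderiv_smul_of_integrable (μ := (volume : Measure E3))
      (f := ψ) (g := φ n) (v := w)
      (integrable_smul_of_hasCompactSupport hda hdc (hφ n).1.continuous)
      (integrable_smul_of_hasCompactSupport hψ.continuous hψc
        ((hφd n).clm_apply continuous_const))
      (integrable_smul_of_hasCompactSupport hψ.continuous hψc (hφ n).1.continuous)
      (fun x _ => hψ.differentiable one_ne_zero x)
      (fun x _ => (hφ n).1.differentiable (by simp) x)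
    simp only [smul_apply]
    rw [this, neg_neg]
  have l4 := l3.neg
  have l5 : Tendsto (fun n => ∫ x in Ω, fderiv ℝ ψ x w • φ n x) atTop
      (𝓝 (-(ContinuousLinearMap.apply ℝ E3 w) (∫ x in Ω, ψ x • G x))) :=
    l4.congr fun n => (e n).symm
  rw [tendsto_nhds_unique l1 l5, ContinuousLinearMap.apply_apply,
    ContinuousLinearMap.integral_apply (integrable_smul_of_memLp hψ.continuous hψc hp hG)]
  simp

theorem hasFDerivAt_rigidVel (a b c x : E3) : HasFDerivAt (rigidVel a b c) (rot b) x := by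
  have h := (rot b).hasFDerivAt.comp x ((hasFDerivAt_id x).sub_const c)
  rw [ContinuousLinearMap.comp_id] at h
  exact h.const_add a

/-- On the open set `S` the weak gradient is determined by the values of `v`, and the rigid field
has the classical gradient `rot b`. The difference integrates to zero against all test functions
supported in `S`, and the fundamental lemma of the calculus of variations applies. -/
theorem MemW10.ae_eq_rot {Ω S : Set E3} (hS : IsOpen S) (hSΩ : S ⊆ Ω)
    (hΩ : IsOpen Ω) {p : ℝ≥0∞} (hp : 1 ≤ p)
    {v : E3 → E3} {G : E3 → E3 →L[ℝ] E3} (h : MemW10 Ω p v G) {a b c : E3}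
    (hv : ∀ᵐ x ∂(volume.restrict S), v x = rigidVel a b c x) :
    ∀ᵐ x ∂(volume.restrict S), G x = rot b := by
  have hd : ∀ x, HasFDerivAt (rigidVel a b c) (rot b) x := hasFDerivAt_rigidVel a b c
  have hvc : Continuous (rigidVel a b c) :=
    continuous_iff_continuousAt.2 fun x => (hd x).continuousAt
  have hloc : LocallyIntegrable (fun x => G x - rot b) (volume.restrict Ω) := by
    have h2 : LocallyIntegrable (fun _ : E3 => rot b) (volume.restrict Ω) :=
      continuous_const.locallyIntegrable
    exact (h.2.1.locallyIntegrable hp).sub h2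
  have key := hS.ae_eq_zero_of_integral_contDiff_smul_eq_zero (hloc.locallyIntegrableOn S)
    (f := fun x => G x - rot b) (U := S) (by
    intro ψ hψ hψc hψS
    have hψ1 : ContDiff ℝ 1 ψ := hψ.of_le (by simp)
    have i1 : Integrable (fun x => ψ x • G x) (volume.restrict Ω) :=
      integrable_smul_of_memLp hψ.continuous hψc hp h.2.1
    have i2 : Integrable (fun x => ψ x • rot b) (volume.restrict Ω) :=
      (integrable_smul_of_hasCompactSupport hψ.continuous hψc continuous_const).restrict
    simp only [smul_sub]
    rw [integral_sub i1 i2, sub_eq_zero]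
    ext1 w
    rw [ContinuousLinearMap.integral_apply i1, ContinuousLinearMap.integral_apply i2]
    simp only [smul_apply]
    have hdc : HasCompactSupport fun x => fderiv ℝ ψ x w :=
      (hψc.fderiv (𝕜 := ℝ)).comp_left (g := fun L : E3 →L[ℝ] ℝ => L w) (by simp)
    have hda : Continuous fun x => fderiv ℝ ψ x w :=
      (hψ1.continuous_fderiv one_ne_zero).clm_apply continuous_const
    have z1 : ∀ x, x ∉ S → fderiv ℝ ψ x w = 0 := fun x hx => by
      rw [image_eq_zero_of_notMem_tsupport (f := fderiv ℝ ψ) fun h => hx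
        (hψS (tsupport_fderiv_subset ℝ h)), zero_apply]
    have z2 : ∀ x, x ∉ S → ψ x = 0 := fun x hx =>
      image_eq_zero_of_notMem_tsupport fun h => hx (hψS h)
    have e1 := h.integral_fderiv_smul hp hψ1 hψc w
    have e2 : ∫ x in Ω, fderiv ℝ ψ x w • v x = ∫ x, fderiv ℝ ψ x w • rigidVel a b c x := by
      have s1 : ∫ x in Ω, fderiv ℝ ψ x w • v x = ∫ x in S, fderiv ℝ ψ x w • v x :=
        setIntegral_eq_of_subset_of_forall_sdiff_eq_zero hΩ.measurableSet hSΩ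
          fun x hx => by rw [z1 x hx.2, zero_smul]
      rw [s1, ← setIntegral_eq_integral_of_forall_compl_eq_zero (s := S)
        (f := fun x => fderiv ℝ ψ x w • rigidVel a b c x) (fun x hx => by rw [z1 x hx, zero_smul])]
      refine integral_congr_ae ?_
      filter_upwards [hv] with x hx
      rw [hx]
    have e3 := integral_smul_fderiv_eq_neg_fderiv_smul_of_integrable
      (μ := (volume : Measure E3)) (f := ψ) (g := rigidVel a b c) (v := w)
      (integrable_smul_of_hasCompactSupport hda hdc hvc)
      (by
        simp only [fun x => (hd x).fderiv]
        exact integrable_smul_of_hasCompactSupport hψ.continuous hψc continuous_const)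
      (integrable_smul_of_hasCompactSupport hψ.continuous hψc hvc)
      (fun x _ => hψ1.differentiable one_ne_zero x) (fun x _ => (hd x).differentiableAt)
    simp only [fun x => (hd x).fderiv] at e3
    rw [setIntegral_eq_integral_of_forall_compl_eq_zero (f := fun x => ψ x • (rot b) w)
      (fun x hx => by rw [z2 x fun h => hx (hSΩ h), zero_smul]), e3, ← e2, e1, neg_neg])
  rw [ae_restrict_iff' hΩ.measurableSet] at key
  rw [ae_restrict_iff' hS.measurableSet]
  filter_upwards [key] with x hx hxS
  exact sub_eq_zero.1 (hx (hSΩ hxS) hxS)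

/-- Test functions for weak derivatives may be of class `C¹`. -/
theorem HasWeakDeriv.integral_fderiv_smul {V : Type*} [NormedAddCommGroup V] [NormedSpace ℝ V]
    [CompleteSpace V] {U : Set E3} (hU : IsOpen U) {f : E3 → V} {G : E3 → E3 →L[ℝ] V}
    (h : HasWeakDeriv U f G) {ψ : E3 → ℝ} (hψ : ContDiff ℝ 1 ψ) (hψc : HasCompactSupport ψ)
    (hψU : tsupport ψ ⊆ U) (w : E3) :
    ∫ x in U, fderiv ℝ ψ x w • f x = -∫ x in U, ψ x • G x w := by
  obtain ⟨hf, hG, hw⟩ := h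
  obtain ⟨δ, hδ, hδU⟩ := hψc.isCompact.exists_cthickening_subset_open hU hψU
  set K := Metric.cthickening δ (tsupport ψ) with hK
  have hKc : IsCompact K := hψc.isCompact.cthickening
  let ρ : ℕ → ContDiffBump (0 : E3) := fun n =>
    { rIn := δ / (2 * (n + 1)), rOut := δ / (n + 1),
      rIn_pos := by positivity,
      rIn_lt_rOut := by
        have : (0 : ℝ) < n + 1 := by positivity
        exact div_lt_div_of_pos_left hδ this (by linarith) }
  have hρ : Tendsto (fun n => (ρ n).rOut) atTop (𝓝 0) := by
    have := (tendsto_one_div_add_atTop_nhds_zero_nat (𝕜 := ℝ)).const_mul δ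
    simpa [ρ, div_eq_mul_inv] using this
  have hρδ : ∀ n, (ρ n).rOut ≤ δ := fun n =>
    div_le_self hδ.le (by linarith [(Nat.cast_nonneg n : (0 : ℝ) ≤ n)])
  let L := ContinuousLinearMap.lsmul ℝ ℝ (E := ℝ)
  let Ψ : ℕ → E3 → ℝ := fun n => convolution ((ρ n).normed volume) ψ L volume
  have hsupp : ∀ n (g : E3 → ℝ), (∀ x ∉ tsupport ψ, g x = 0) →
      ∀ x ∉ K, convolution ((ρ n).normed volume) g L volume x = 0 := by
    intro n g hg x hx
    refine image_eq_zero_of_notMem_tsupport (f := convolution ((ρ n).normed volume) g L volume) ?_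
    refine fun hxt => hx ?_
    have hcl : IsClosed K := Metric.isClosed_cthickening
    refine closure_minimal ?_ hcl hxt
    refine (support_convolution_subset L).trans ?_
    rintro _ ⟨y, hy, z, hz, rfl⟩
    rw [(ρ n).support_normed_eq, mem_ball_zero_iff] at hy
    have hz' : z ∈ tsupport ψ := by
      by_contra hz'
      exact hz (hg z hz')
    refine Metric.mem_cthickening_of_dist_le _ z _ _ hz' ?_
    simp only [dist_eq_norm, add_sub_cancel_right]
    exact hy.le.trans (hρδ n)
  have hΨs : ∀ n, ContDiff ℝ ∞ (Ψ n) := fun n =>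
    ((ρ n).hasCompactSupport_normed).contDiff_convolution_left L ((ρ n).contDiff_normed)
      (hψ.continuous.locallyIntegrable)
  have hΨK : ∀ n, tsupport (Ψ n) ⊆ K := fun n =>
    closure_minimal (fun x hx => by
      by_contra hxK
      exact hx (hsupp n ψ (fun y hy => image_eq_zero_of_notMem_tsupport hy) x hxK))
      Metric.isClosed_cthickening
  have hda : Continuous fun x => fderiv ℝ ψ x w :=
    (hψ.continuous_fderiv one_ne_zero).clm_apply continuous_const
  have hdc : HasCompactSupport fun x => fderiv ℝ ψ x w :=
    (hψc.fderiv (𝕜 := ℝ)).comp_left (g := fun L : E3 →L[ℝ] ℝ => L w) (by simp)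
  have hΨd : ∀ n x, fderiv ℝ (Ψ n) x w =
      convolution ((ρ n).normed volume) (fun x => fderiv ℝ ψ x w) L volume x := by
    intro n x
    rw [(hψc.hasFDerivAt_convolution_right L
      ((ρ n).continuous_normed.locallyIntegrable) hψ x).fderiv]
    exact convolution_precompR_apply L ((ρ n).continuous_normed.locallyIntegrable)
      (hψc.fderiv (𝕜 := ℝ)) (hψ.continuous_fderiv one_ne_zero) x w
  have hlim : ∀ (W : Type _) [NormedAddCommGroup W] [NormedSpace ℝ W] (g : E3 → ℝ) (F : E3 → W),
      Continuous g → HasCompactSupport g → (∀ x ∉ tsupport ψ, g x = 0) →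
      LocallyIntegrableOn F U →
      Tendsto (fun n => ∫ x in U, convolution ((ρ n).normed volume) g L volume x • F x) atTop
        (𝓝 (∫ x in U, g x • F x)) := by
    intro W _ _ g F hg hgc hg0 hF
    obtain ⟨C, hC⟩ := hgc.exists_bound_of_continuous hg
    have hC0 : 0 ≤ C := (norm_nonneg _).trans (hC 0)
    have hFK : IntegrableOn F K := hF.integrableOn_compact_subset hδU hKc
    have hconv : ∀ n, Continuous (convolution ((ρ n).normed volume) g L volume) := fun n =>
      hgc.continuous_convolution_right L ((ρ n).continuous_normed.locallyIntegrable) hg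
    refine tendsto_integral_of_dominated_convergence
      (K.indicator fun x => (3 * C) * ‖F x‖) (fun n => ?_) ?_ (fun n => ?_) ?_
    · exact (hconv n).aestronglyMeasurable.smul
        (hF.aestronglyMeasurable)
    · refine IntegrableOn.integrable_indicator ?_ hKc.measurableSet
      exact (hFK.norm.const_mul (3 * C)).mono_measure (Measure.restrict_mono le_rfl
        Measure.restrict_le_self)
    · refine Eventually.of_forall fun x => ?_
      by_cases hx : x ∈ K
      · rw [indicator_of_mem hx, norm_smul]
        gcongr
        -- The mollification differs from `g` by at most the oscillation `2 * C`, which gives the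
        -- majorant with the factor `3 * C`.
        have h1 := (ρ n).dist_normed_convolution_le (μ := volume) (x₀ := x) (ε := 2 * C)
          hg.aestronglyMeasurable (fun y _ => by
            rw [dist_eq_norm]
            exact (norm_sub_le _ _).trans (by linarith [hC x, hC y]))
        rw [dist_eq_norm] at h1
        have h2 := norm_le_norm_add_norm_sub (g x)
          (convolution ((ρ n).normed volume) g L volume x)
        rw [norm_sub_rev] at h2
        linarith [hC x]
      · rw [hsupp n g hg0 x hx, zero_smul, norm_zero, indicator_of_notMem hx]
    · refine Eventually.of_forall fun x => ?_
      exact (ContDiffBump.convolution_tendsto_right_of_continuous hρ hg x).smul_const _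
  have hz1 : ∀ x ∉ tsupport ψ, fderiv ℝ ψ x w = 0 := fun x hx => by
    rw [image_eq_zero_of_notMem_tsupport (f := fderiv ℝ ψ) fun h => hx
      (tsupport_fderiv_subset ℝ h), zero_apply]
  have hGw : LocallyIntegrableOn (fun x => G x w) U := fun x hx => by
    obtain ⟨s, hs, hsi⟩ := hG x hx
    exact ⟨s, hs, (ContinuousLinearMap.apply ℝ V w).integrable_comp hsi⟩
  have l1 := hlim V _ f hda hdc hz1 hf
  have l2 := hlim V ψ (fun x => G x w) hψ.continuous hψc
    (fun y hy => image_eq_zero_of_notMem_tsupport hy) hGw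
  refine tendsto_nhds_unique l1 (l2.neg.congr fun n => ?_)
  simp only [← hΨd]
  exact (hw (Ψ n) (hΨs n) (hKc.of_isClosed_subset (isClosed_tsupport _) (hΨK n))
    ((hΨK n).trans hδU) w).symm

end Sobolev
end

/-! ### Splitting of coordinates, vertical cutoff and horizontal bump -/

noncomputable section

/-- The splitting of space into horizontal and vertical coordinates. -/
def splitHomeo : E3 ≃ₜ E2 × ℝ where
  toFun x := (horiz x, x 2)
  invFun p := !₂[p.1 0, p.1 1, p.2]
  left_inv x := by ext i; fin_cases i <;> simp [horiz]
  right_inv p := by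
    ext i
    · fin_cases i <;> simp [horiz]
    · simp
  continuous_toFun := by unfold horiz; fun_prop
  continuous_invFun := by fun_prop

theorem continuous_horiz : Continuous horiz := by unfold horiz; fun_prop

theorem measurePreserving_split : MeasurePreserving splitHomeo := by
  have h1 := PiLp.volume_preserving_ofLp (Fin 3)
  have h2 := volume_preserving_piFinSuccAbove (fun _ : Fin 3 => ℝ) 2
  have h3 := (Measure.measurePreserving_swap (μ := (volume : Measure ℝ))
    (ν := (volume : Measure (Fin 2 → ℝ))))
  have h4 := (PiLp.volume_preserving_toLp (Fin 2)).prod (MeasurePreserving.id (volume : Measure ℝ))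
  have h5 := h4.comp (h3.comp (h2.comp h1))
  convert h5 using 1
  ext x i
  · fin_cases i <;> rfl
  · rfl
  · rfl

theorem integral_split {V : Type*} [NormedAddCommGroup V] [NormedSpace ℝ V] (f : E2 × ℝ → V) :
    ∫ x : E3, f (horiz x, x 2) = ∫ p, f p :=
  measurePreserving_split.integral_comp splitHomeo.measurableEmbedding f

theorem integral_split_mul (f : E2 → ℝ) (g : ℝ → ℝ) :
    ∫ x : E3, f (horiz x) * g (x 2) = (∫ y, f y) * ∫ s, g s := by
  rw [integral_split fun p : E2 × ℝ => f p.1 * g p.2, ← integral_prod_mul]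
  rfl

/-- The horizontal projection as a linear map. -/
def horizL : E3 →L[ℝ] E2 := LinearMap.toContinuousLinearMap
  { toFun := horiz, map_add' := horiz_add, map_smul' := horiz_smul }

@[simp] theorem horizL_apply (x : E3) : horizL x = horiz x := rfl

/-- The coordinate vectors. -/
def ev (j : Fin 3) : E3 := EuclideanSpace.single j 1

theorem horiz_ev (j : Fin 2) : horiz (ev j.castSucc) = EuclideanSpace.single j 1 := by
  ext i; fin_cases j <;> fin_cases i <;> simp [horiz, ev]

theorem ev_castSucc_two (j : Fin 2) : (ev j.castSucc) 2 = 0 := by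
  fin_cases j <;> simp [ev]

theorem ev_two : ev 2 = e3 := by
  ext i; fin_cases i <;> simp [ev, e3]

theorem fderiv_mul_split {ξ : E2 → ℝ} {τ : ℝ → ℝ} (x : E3) (hξ : DifferentiableAt ℝ ξ (horiz x))
    (hτ : DifferentiableAt ℝ τ (x 2)) (w : E3) :
    fderiv ℝ (fun x : E3 => ξ (horiz x) * τ (x 2)) x w =
      fderiv ℝ ξ (horiz x) (horiz w) * τ (x 2) + ξ (horiz x) * (deriv τ (x 2) * w 2) := by
  have h1 : HasFDerivAt (fun x : E3 => ξ (horiz x)) ((fderiv ℝ ξ (horiz x)).comp horizL) x :=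
    HasFDerivAt.comp x (f := horizL) hξ.hasFDerivAt horizL.hasFDerivAt
  have h2 : HasFDerivAt (fun x : E3 => τ (x 2)) (deriv τ (x 2) •
      (EuclideanSpace.proj (2 : Fin 3) : E3 →L[ℝ] ℝ)) x :=
    HasDerivAt.comp_hasFDerivAt (f := fun x : E3 => x 2) x hτ.hasDerivAt
      (EuclideanSpace.proj (2 : Fin 3) : E3 →L[ℝ] ℝ).hasFDerivAt
  have h3 : HasFDerivAt (fun x : E3 => ξ (horiz x) * τ (x 2)) _ x := h1.mul h2
  rw [h3.fderiv]
  simp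
  ring

theorem contDiff_mul_split {n : WithTop ℕ∞} {ξ : E2 → ℝ} {τ : ℝ → ℝ} (hξ : ContDiff ℝ n ξ)
    (hτ : ContDiff ℝ n τ) : ContDiff ℝ n fun x : E3 => ξ (horiz x) * τ (x 2) :=
  (hξ.comp horizL.contDiff).mul
    (hτ.comp (EuclideanSpace.proj (2 : Fin 3) : E3 →L[ℝ] ℝ).contDiff)

section Cutoff

variable (h d : ℝ)

/-- A vertical cutoff function: `1` below `h + d` and `0` above `h + 3d/2`. -/
def chi (s : ℝ) : ℝ := Real.smoothTransition ((h + 3 / 2 * d - s) / (d / 2))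

/-- The primitive of `-chi` that vanishes above. -/
def Theta (s : ℝ) : ℝ := ∫ r in s..(h + 2 * d), chi h d r

variable {h d}

theorem contDiff_chi {n : ℕ∞} : ContDiff ℝ n (chi h d) :=
  Real.smoothTransition.contDiff.comp (by fun_prop)

theorem continuous_chi : Continuous (chi h d) := (contDiff_chi (n := 0)).continuous

theorem chi_nonneg (s : ℝ) : 0 ≤ chi h d s := Real.smoothTransition.nonneg _

theorem chi_le_one (s : ℝ) : chi h d s ≤ 1 := Real.smoothTransition.le_one _

theorem chi_eq_one (hd : 0 < d) {s : ℝ} (hs : s ≤ h + d) : chi h d s = 1 :=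
  Real.smoothTransition.one_of_one_le (by rw [le_div_iff₀ (by positivity)]; linarith)

theorem chi_eq_zero (hd : 0 < d) {s : ℝ} (hs : h + 3 / 2 * d ≤ s) : chi h d s = 0 :=
  Real.smoothTransition.zero_of_nonpos (div_nonpos_of_nonpos_of_nonneg (by linarith) (by positivity))

theorem deriv_chi_eq_zero_of_le (hd : 0 < d) {s : ℝ} (hs : s ≤ h + d) : deriv (chi h d) s = 0 :=
  IsLocalMax.deriv_eq_zero (Eventually.of_forall fun r => by
    rw [chi_eq_one hd hs]; exact chi_le_one r)

theorem deriv_chi_eq_zero_of_ge (hd : 0 < d) {s : ℝ} (hs : h + 3 / 2 * d ≤ s) :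
    deriv (chi h d) s = 0 :=
  IsLocalMin.deriv_eq_zero (Eventually.of_forall fun r => by
    rw [chi_eq_zero hd hs]; exact chi_nonneg r)

theorem hasDerivAt_chi (s : ℝ) : HasDerivAt (chi h d) (deriv (chi h d) s) s :=
  ((contDiff_chi (n := 1)).differentiable (by simp) s).hasDerivAt

theorem continuous_deriv_chi : Continuous (deriv (chi h d)) :=
  (contDiff_chi (n := 1)).continuous_deriv (by simp)

theorem integral_deriv_chi_mul (hd : 0 < d) (f : ℝ → ℝ) :
    ∫ s, deriv (chi h d) s * f s = ∫ s in (h + d)..(h + 2 * d), deriv (chi h d) s * f s := by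
  rw [intervalIntegral.integral_of_le (by linarith),
    setIntegral_eq_integral_of_forall_compl_eq_zero]
  intro s hs
  rw [mem_Ioc, not_and_or, not_lt, not_le] at hs
  rcases hs with hs | hs
  · rw [deriv_chi_eq_zero_of_le hd hs, zero_mul]
  · rw [deriv_chi_eq_zero_of_ge hd (by linarith), zero_mul]

theorem integral_deriv_chi (hd : 0 < d) : ∫ s, deriv (chi h d) s = -1 := by
  have := integral_deriv_chi_mul (h := h) hd fun _ => 1
  simp only [mul_one] at this
  rw [this, intervalIntegral.integral_eq_sub_of_hasDerivAt (fun s _ => hasDerivAt_chi s)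
    (continuous_deriv_chi.intervalIntegrable _ _), chi_eq_zero hd (by linarith),
    chi_eq_one hd le_rfl]
  norm_num

/-- The mean height of the cutoff. -/
def cutHeight (h d : ℝ) : ℝ := h + d + Theta h d (h + d)

/-- Integration by parts. With respect to the weight `-χ'`, which has total mass one, `cutHeight` is
the mean of the height; this is how the traces of linear functions are evaluated. -/
theorem integral_deriv_chi_mul_id (hd : 0 < d) :
    ∫ s, deriv (chi h d) s * s = -cutHeight h d := by
  rw [integral_deriv_chi_mul hd fun s => s]
  have := intervalIntegral.integral_deriv_mul_eq_sub (a := h + d) (b := h + 2 * d)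
    (u := chi h d) (v := fun s => s) (u' := deriv (chi h d)) (v' := fun _ => 1)
    (fun s _ => hasDerivAt_chi s) (fun s _ => hasDerivAt_id s)
    (continuous_deriv_chi.intervalIntegrable _ _) (by simp)
  have i1 : Continuous fun s => deriv (chi h d) s * s := continuous_deriv_chi.mul continuous_id
  have i2 : Continuous fun s => chi h d s * 1 := continuous_chi.mul continuous_const
  rw [intervalIntegral.integral_add (i1.intervalIntegrable _ _) (i2.intervalIntegrable _ _), chi_eq_zero hd (by linarith),
    chi_eq_one hd le_rfl] at this
  simp only [mul_one] at this
  rw [cutHeight, Theta]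
  linarith

theorem hasDerivAt_Theta (s : ℝ) : HasDerivAt (Theta h d) (-chi h d s) s :=
  intervalIntegral.integral_hasDerivAt_left (continuous_chi.intervalIntegrable _ _)
    (continuous_chi.stronglyMeasurableAtFilter _ _) continuous_chi.continuousAt

theorem contDiff_Theta : ContDiff ℝ 1 (Theta h d) := by
  rw [contDiff_one_iff_deriv]
  refine ⟨fun s => (hasDerivAt_Theta s).differentiableAt, ?_⟩
  rw [show deriv (Theta h d) = fun s => -chi h d s from
    funext fun s => (hasDerivAt_Theta s).deriv]
  exact continuous_chi.neg

theorem Theta_eq_zero (hd : 0 < d) {s : ℝ} (hs : h + 3 / 2 * d ≤ s) : Theta h d s = 0 := by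
  rw [Theta, intervalIntegral.integral_congr (g := fun _ => 0), intervalIntegral.integral_zero]
  intro r hr
  refine chi_eq_zero hd ?_
  rcases mem_uIcc.1 hr with hr | hr <;> linarith [hr.1, hr.2]

/-- Below the cutoff the slope is `-1`. The same constant `cutHeight` appears here and as the mean
of `-χ'`, and the exact formula makes the profile of the second order estimate quadratic. -/
theorem Theta_eq (hd : 0 < d) {s : ℝ} (hs : s ≤ h + d) : Theta h d s = cutHeight h d - s := by
  rw [cutHeight, Theta, Theta, ← intervalIntegral.integral_add_adjacent_intervals (b := h + d)
    (continuous_chi.intervalIntegrable _ _) (continuous_chi.intervalIntegrable _ _),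
    intervalIntegral.integral_congr (a := s) (b := h + d) (g := fun _ => 1),
    intervalIntegral.integral_const]
  · simp; ring
  · intro r hr
    rw [uIcc_of_le hs] at hr
    exact chi_eq_one hd hr.2

theorem Theta_nonneg {s : ℝ} (hs : s ≤ h + 2 * d) : 0 ≤ Theta h d s :=
  intervalIntegral.integral_nonneg hs fun r _ => chi_nonneg r

theorem Theta_le {s : ℝ} (hs : s ≤ h + 2 * d) : Theta h d s ≤ h + 2 * d - s := by
  have := intervalIntegral.integral_mono_on (μ := volume) hs
    ((continuous_chi (h := h) (d := d)).intervalIntegrable _ _)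
    (continuous_const.intervalIntegrable (μ := volume) _ _) (fun r _ => chi_le_one (h := h) (d := d) r)
  rw [intervalIntegral.integral_const] at this
  simpa [Theta] using this

theorem cutHeight_mem (hd : 0 < d) : cutHeight h d ∈ Icc (h + d) (h + 2 * d) := by
  have h1 := Theta_nonneg (h := h) (d := d) (s := h + d) (by linarith)
  have h2 := Theta_le (h := h) (d := d) (s := h + d) (by linarith)
  constructor <;> rw [cutHeight] <;> linarith

end Cutoff

section Bump

/-- A radial bump function in the plane. -/
def bump0 (y : E2) : ℝ := Real.smoothTransition (1 - 4 * ‖y‖ ^ 2)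

/-- The radial factor of the gradient of `bump0`. -/
def kappa0 (y : E2) : ℝ := -8 * deriv Real.smoothTransition (1 - 4 * ‖y‖ ^ 2)

theorem contDiff_bump0 {n : ℕ∞} : ContDiff ℝ n bump0 :=
  Real.smoothTransition.contDiff.comp (contDiff_const.sub (contDiff_const.mul (contDiff_norm_sq ℝ)))

theorem contDiff_kappa0 {n : ℕ∞} : ContDiff ℝ n kappa0 := by
  have h1 : ContDiff ℝ n (deriv Real.smoothTransition) := by
    have : ContDiff ℝ ∞ Real.smoothTransition := Real.smoothTransition.contDiff
    exact ((contDiff_infty_iff_deriv.1 this).2).of_le (by exact_mod_cast le_top)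
  exact contDiff_const.mul
    (h1.comp (contDiff_const.sub (contDiff_const.mul (contDiff_norm_sq ℝ))))

theorem bump0_eq_zero {y : E2} (hy : 1 / 2 ≤ ‖y‖) : bump0 y = 0 :=
  Real.smoothTransition.zero_of_nonpos (by nlinarith)

theorem kappa0_eq_zero {y : E2} (hy : 1 / 2 ≤ ‖y‖) : kappa0 y = 0 := by
  rw [kappa0, IsLocalMin.deriv_eq_zero (Eventually.of_forall fun r => by
    rw [Real.smoothTransition.zero_of_nonpos (by nlinarith)]
    exact Real.smoothTransition.nonneg r), mul_zero]

theorem hasCompactSupport_bump0 : HasCompactSupport bump0 :=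
  HasCompactSupport.intro (isCompact_closedBall 0 (1 / 2)) fun y hy =>
    bump0_eq_zero (by simpa using (not_le.1 (by simpa using hy)).le)

theorem hasCompactSupport_kappa0 : HasCompactSupport kappa0 :=
  HasCompactSupport.intro (isCompact_closedBall 0 (1 / 2)) fun y hy =>
    kappa0_eq_zero (by simpa using (not_le.1 (by simpa using hy)).le)

theorem fderiv_bump0 (y w : E2) : fderiv ℝ bump0 y w = inner ℝ y w * kappa0 y := by
  have h1 : HasFDerivAt (fun y : E2 => 1 - 4 * ‖y‖ ^ 2) (-((4 : ℝ) • (2 • innerSL ℝ y))) y := by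
    have h0 := (hasStrictFDerivAt_norm_sq y).hasFDerivAt
    exact (h0.const_mul 4).const_sub 1
  have h2 : HasDerivAt Real.smoothTransition
      (deriv Real.smoothTransition (1 - 4 * ‖y‖ ^ 2)) (1 - 4 * ‖y‖ ^ 2) :=
    (((Real.smoothTransition.contDiff (n := 1)).differentiable (by simp)) _).hasDerivAt
  have h3 : HasFDerivAt bump0 _ y := h2.comp_hasFDerivAt y h1
  rw [h3.fderiv, kappa0]
  simp
  ring

/-- The rescaled bump function with support in `|y| ≤ σ/2`. -/
def zeta (σ : ℝ) (y : E2) : ℝ := bump0 (σ⁻¹ • y)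

/-- The partial derivatives of `zeta`. -/
def dzeta (σ : ℝ) (j : Fin 2) (y : E2) : ℝ := σ⁻¹ * ((σ⁻¹ • y) j * kappa0 (σ⁻¹ • y))

variable {σ : ℝ}

theorem contDiff_zeta {n : ℕ∞} : ContDiff ℝ n (zeta σ) :=
  contDiff_bump0.comp (by fun_prop)

theorem contDiff_dzeta {n : ℕ∞} (j : Fin 2) : ContDiff ℝ n (dzeta σ j) := by
  have h1 : ContDiff ℝ n fun y : E2 => kappa0 (σ⁻¹ • y) := contDiff_kappa0.comp (by fun_prop)
  have h2 : ContDiff ℝ n fun y : E2 => (σ⁻¹ • y) j := by fun_prop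
  exact contDiff_const.mul (h2.mul h1)

theorem fderiv_zeta (j : Fin 2) (y : E2) :
    fderiv ℝ (zeta σ) y (EuclideanSpace.single j 1) = dzeta σ j y := by
  have h1 : HasFDerivAt bump0 (fderiv ℝ bump0 (σ⁻¹ • y)) (σ⁻¹ • y) :=
    ((contDiff_bump0 (n := 1)).differentiable (by simp) _).hasFDerivAt
  have h2 : HasFDerivAt (fun y : E2 => σ⁻¹ • y) (σ⁻¹ • ContinuousLinearMap.id ℝ E2) y :=
    (hasFDerivAt_id y).const_smul σ⁻¹
  have h3 : HasFDerivAt (zeta σ) _ y := h1.comp y h2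
  rw [h3.fderiv, dzeta]
  simp only [ContinuousLinearMap.comp_apply, smul_apply, ContinuousLinearMap.id_apply, map_smul,
    fderiv_bump0, smul_eq_mul, real_inner_comm, EuclideanSpace.inner_single_left]
  simp

theorem half_le_norm_inv_smul (hσ : 0 < σ) {y : E2} (hy : σ / 2 ≤ ‖y‖) : 1 / 2 ≤ ‖σ⁻¹ • y‖ := by
  rw [norm_smul, norm_inv, Real.norm_of_nonneg hσ.le, ← div_eq_inv_mul, le_div_iff₀ hσ]
  linarith

theorem zeta_eq_zero (hσ : 0 < σ) {y : E2} (hy : σ / 2 ≤ ‖y‖) : zeta σ y = 0 :=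
  bump0_eq_zero (half_le_norm_inv_smul hσ hy)

theorem dzeta_eq_zero (hσ : 0 < σ) (j : Fin 2) {y : E2} (hy : σ / 2 ≤ ‖y‖) : dzeta σ j y = 0 := by
  rw [dzeta, kappa0_eq_zero (half_le_norm_inv_smul hσ hy), mul_zero, mul_zero]

theorem zeta_nonneg (y : E2) : 0 ≤ zeta σ y := Real.smoothTransition.nonneg _

theorem zeta_le_one (y : E2) : zeta σ y ≤ 1 := Real.smoothTransition.le_one _

theorem abs_coord_le (y : E2) (j : Fin 2) : |y j| ≤ ‖y‖ := by
  simpa using PiLp.norm_apply_le y j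

/-- Scaling: one bound for `kappa0` serves all `σ`, since the rescaled coordinate is at most one on
the support. -/
theorem exists_dzeta_bound : ∃ C : ℝ, 0 < C ∧ ∀ σ > 0, ∀ j y, |dzeta σ j y| ≤ C / σ := by
  obtain ⟨C, hC⟩ := hasCompactSupport_kappa0.exists_bound_of_continuous
    (contDiff_kappa0 (n := 0)).continuous
  have hC0 : 0 ≤ C := (norm_nonneg _).trans (hC 0)
  refine ⟨C + 1, by positivity, fun σ hσ j y => ?_⟩
  rcases le_or_gt (σ / 2) ‖y‖ with hy | hy
  · rw [dzeta_eq_zero hσ j hy, abs_zero]; positivity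
  · have h1 : |(σ⁻¹ • y) j| ≤ 1 := by
      refine (abs_coord_le _ j).trans ?_
      rw [norm_smul, norm_inv, Real.norm_of_nonneg hσ.le, ← div_eq_inv_mul, div_le_one hσ]
      linarith
    rw [dzeta, abs_mul, abs_mul, abs_of_pos (inv_pos.2 hσ), div_eq_inv_mul]
    have h2 := hC (σ⁻¹ • y)
    rw [Real.norm_eq_abs] at h2
    gcongr
    calc _ ≤ 1 * C := by gcongr
      _ ≤ C + 1 := by linarith

/-- This oddness removes constants and even functions from the boundary integrals of the second
order estimate. -/
theorem dzeta_neg (j : Fin 2) (y : E2) : dzeta σ j (-y) = -dzeta σ j y := by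
  simp [dzeta, kappa0]

theorem zeta_neg (y : E2) : zeta σ (-y) = zeta σ y := by
  simp [zeta, bump0]

/-- The total mass of `bump0`. -/
def mass0 : ℝ := ∫ y, bump0 y

/-- The second moments of `bump0`. -/
def moment0 (j : Fin 2) : ℝ := ∫ y : E2, y j * y j * bump0 y

theorem mass0_pos : 0 < mass0 :=
  (contDiff_bump0 (n := 0)).continuous.integral_pos_of_hasCompactSupport_nonneg_nonzero
    hasCompactSupport_bump0 (fun y => Real.smoothTransition.nonneg _) (x := 0) (by simp [bump0])

theorem moment0_pos (j : Fin 2) : 0 < moment0 j := by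
  have hc : Continuous fun y : E2 => y j * y j * bump0 y :=
    ((by fun_prop : Continuous fun y : E2 => y j * y j)).mul
      (contDiff_bump0 (n := 0)).continuous
  refine hc.integral_pos_of_hasCompactSupport_nonneg_nonzero
    (hasCompactSupport_bump0.mul_left) (fun y => ?_)
    (x := EuclideanSpace.single j (1 / 4)) ?_
  · exact mul_nonneg (mul_self_nonneg _) (Real.smoothTransition.nonneg _)
  · refine mul_ne_zero (by simp) (Real.smoothTransition.pos_of_pos ?_).ne'
    simp
    norm_num

theorem integral_zeta (hσ : 0 < σ) : ∫ y, zeta σ y = σ ^ 2 * mass0 := by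
  have := Measure.integral_comp_smul (volume : Measure E2) bump0 σ⁻¹
  rw [finrank_euclideanSpace, Fintype.card_fin, inv_pow, inv_inv, abs_of_pos (by positivity),
    smul_eq_mul] at this
  exact this

theorem integral_coord_mul_zeta (j : Fin 2) : ∫ y : E2, y j * zeta σ y = 0 := by
  have := integral_neg_eq_self (fun y : E2 => y j * zeta σ y) volume
  simp only [zeta_neg, PiLp.neg_apply, neg_mul, integral_neg] at this
  linarith

theorem integral_coord_sq_mul_zeta (hσ : 0 < σ) (j : Fin 2) :
    ∫ y : E2, y j * y j * zeta σ y = σ ^ 4 * moment0 j := by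
  have := Measure.integral_comp_smul (volume : Measure E2) (fun y => y j * y j * bump0 y) σ⁻¹
  rw [finrank_euclideanSpace, Fintype.card_fin, inv_pow, inv_inv, abs_of_pos (by positivity),
    smul_eq_mul] at this
  have e : ∀ y : E2, y j * y j * zeta σ y =
      σ ^ 2 * ((σ⁻¹ • y) j * (σ⁻¹ • y) j * bump0 (σ⁻¹ • y)) := by
    intro y
    simp only [zeta, PiLp.smul_apply, smul_eq_mul]
    field_simp
  simp_rw [e]
  rw [integral_const_mul, this, moment0]
  ring

/-- The reflection of the second coordinate preserves the radial function `zeta` and changes the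
sign of the product. -/
theorem integral_mixed_mul_zeta : ∫ y : E2, y 0 * y 1 * zeta σ y = 0 := by
  let N : E2 ≃ₗᵢ[ℝ] E2 := LinearIsometryEquiv.piLpCongrRight 2
    (fun i : Fin 2 => if i = 0 then LinearIsometryEquiv.refl ℝ ℝ else LinearIsometryEquiv.neg ℝ)
  have h := N.measurePreserving.integral_comp N.toHomeomorph.measurableEmbedding
    (fun y : E2 => y 0 * y 1 * zeta σ y)
  have e0 : ∀ y, (N y) 0 = y 0 := fun y => by simp [N]
  have e1 : ∀ y, (N y) 1 = -y 1 := fun y => by simp [N]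
  have e2 : ∀ y, zeta σ (N y) = zeta σ y := fun y => by
    simp only [zeta, bump0, ← map_smul, N.norm_map]
  simp only [e0, e1, e2, mul_neg, neg_mul, integral_neg] at h
  linarith

end Bump
end

/-! ### The field in the gap: integral identities and first order bounds -/

noncomputable section

/-- The cylinder `|x'| < σ`, `-d < x₃ < h + 2d`. -/
def zone (h d σ : ℝ) : Set E3 := {x | ‖horiz x‖ < σ ∧ -d < x 2 ∧ x 2 < h + 2 * d}

theorem isOpen_zone (h d σ : ℝ) : IsOpen (zone h d σ) := by
  have h2 : Continuous fun x : E3 => x 2 := by fun_prop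
  exact (isOpen_lt continuous_horiz.norm continuous_const).inter
    ((isOpen_lt continuous_const h2).inter (isOpen_lt h2 continuous_const))

theorem isBounded_zone (h d σ : ℝ) : Bornology.IsBounded (zone h d σ) := by
  refine (Metric.isBounded_closedBall (x := (0 : E3)) (r := |σ| + (|d| + |h + 2 * d|))).subset ?_
  rintro x ⟨h1, h2, h3⟩
  rw [mem_closedBall_zero_iff]
  have e := norm_sq_eq_horiz x
  have a1 : |x 2| ≤ |d| + |h + 2 * d| := by
    rw [abs_le]
    constructor
    · linarith [neg_abs_le d, le_abs_self d, abs_nonneg (h + 2 * d)]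
    · linarith [le_abs_self (h + 2 * d), abs_nonneg d]
  have a2 : ‖horiz x‖ ≤ |σ| := h1.le.trans (le_abs_self σ)
  refine abs_le_of_sq_le_sq' ?_ (by positivity) |>.2
  rw [e, ← sq_abs (x 2)]
  nlinarith [norm_nonneg (horiz x), abs_nonneg (x 2), abs_nonneg σ,
    mul_nonneg (abs_nonneg σ) (add_nonneg (abs_nonneg d) (abs_nonneg (h + 2 * d)))]

theorem volume_zone {h d σ : ℝ} (hσ : 0 ≤ σ) :
    volume (zone h d σ) = ENNReal.ofReal
      (σ ^ 2 * (volume (Metric.ball (0 : E2) 1)).toReal * (h + 3 * d)) := by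
  have e : zone h d σ = splitHomeo ⁻¹' (Metric.ball (0 : E2) σ ×ˢ Ioo (-d) (h + 2 * d)) := by
    ext x; simp [zone, splitHomeo]
  have hb : volume (Metric.ball (0 : E2) 1) ≠ ⊤ := measure_ball_lt_top.ne
  have hm : MeasurableSet (Metric.ball (0 : E2) σ ×ˢ Ioo (-d) (h + 2 * d)) :=
    measurableSet_ball.prod measurableSet_Ioo
  rw [e, measurePreserving_split.measure_preimage hm.nullMeasurableSet,
    Measure.volume_eq_prod, Measure.prod_prod,
    Measure.addHaar_ball _ _ hσ, Real.volume_Ioo, finrank_euclideanSpace, Fintype.card_fin,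
    ENNReal.ofReal_mul (by positivity), ENNReal.ofReal_mul (by positivity),
    ENNReal.ofReal_toReal hb]
  congr 2
  ring

/-- A divergence-free field near the gap, in adapted coordinates. The body `B` moves with the rigid
velocity `V + M (x - h e₃)`, and the field vanishes below the gap. -/
structure GapFlow (h d σ : ℝ) (B : Set E3) (U : Fin 3 → E3 → ℝ) (G : Fin 3 → Fin 3 → E3 → ℝ)
    (Γ : E3 → ℝ) (V : Fin 3 → ℝ) (M : Fin 3 → Fin 3 → ℝ) : Prop where
  h_pos : 0 < h
  d_pos : 0 < d
  σ_pos : 0 < σ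
  isOpen_B : IsOpen B
  frontier_B : volume (frontier B) = 0
  G_int : ∀ i j, LocallyIntegrable (G i j)
  Γ_int : LocallyIntegrable Γ
  G_le : ∀ i j x, |G i j x| ≤ Γ x
  green : ∀ ψ : E3 → ℝ, ContDiff ℝ 1 ψ → HasCompactSupport ψ → ∀ i j,
    ∫ x, fderiv ℝ ψ x (ev j) * U i x = -∫ x, ψ x * G i j x
  bottom : ∀ x : E3, ‖horiz x‖ < σ → -(2 * d) ≤ x 2 → x 2 ≤ -d →
    (∀ i, U i x = 0) ∧ ∀ i j, G i j x = 0
  top : ∀ x : E3, ‖horiz x‖ < σ → h + d < x 2 → x 2 < h + 2 * d → x ∈ B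
  U_rigid : ∀ᵐ x : E3, x ∈ B → ∀ i,
    U i x = V i + M i 0 * x 0 + M i 1 * x 1 + M i 2 * (x 2 - h)
  G_rigid : ∀ᵐ x : E3, x ∈ B → ∀ i j, G i j x = M i j
  skew : ∀ i j, M i j = -M j i
  div_free : ∀ᵐ x : E3, G 0 0 x + G 1 1 x + G 2 2 x = 0

/-- The amount of gradient in the fluid part of the gap. -/
def gapMass (h d σ : ℝ) (B : Set E3) (Γ : E3 → ℝ) : ℝ := ∫ x in zone h d σ \ closure B, Γ x

namespace GapFlow

variable {h d σ : ℝ} {B : Set E3} {U : Fin 3 → E3 → ℝ} {G : Fin 3 → Fin 3 → E3 → ℝ}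
  {Γ : E3 → ℝ} {V : Fin 3 → ℝ} {M : Fin 3 → Fin 3 → ℝ}

theorem integrableOn_zone {f : E3 → ℝ} (hf : LocallyIntegrable f) (h d σ : ℝ) :
    IntegrableOn f (zone h d σ) :=
  (hf.integrableOn_isCompact (isBounded_zone h d σ).isCompact_closure).mono_set subset_closure

theorem integrableOn_zone_mul {f g : E3 → ℝ} (hf : Continuous f) (hg : LocallyIntegrable g)
    (h d σ : ℝ) : IntegrableOn (fun x => f x * g x) (zone h d σ) :=
  integrableOn_zone (hg.continuous_smul hf) h d σ

/-- The test function need not vanish at the bottom. It is multiplied by a cutoff `low` that varies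
only for `-2d ≤ x₃ ≤ -d`, where the field and its gradient vanish; hence the cutoff leaves no trace
in the integrals over the zone. -/
theorem green_zone (F : GapFlow h d σ B U G Γ V M) {ψ : E3 → ℝ} (hψ : ContDiff ℝ 1 ψ)
    (h0 : ∀ x : E3, σ / 2 < ‖horiz x‖ ∨ h + 3 / 2 * d < x 2 → ψ x = 0) (i j : Fin 3) :
    ∫ x in zone h d σ, fderiv ℝ ψ x (ev j) * U i x = -∫ x in zone h d σ, ψ x * G i j x := by
  have hd := F.d_pos
  have hσ := F.σ_pos
  have hh := F.h_pos
  let low : ℝ → ℝ := fun s => Real.smoothTransition ((s + 2 * d) / d)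
  have hlow : ContDiff ℝ 1 low := Real.smoothTransition.contDiff.comp (by fun_prop)
  have low1 : ∀ s, -d ≤ s → low s = 1 := fun s hs =>
    Real.smoothTransition.one_of_one_le (by rw [le_div_iff₀ hd]; linarith)
  have low0 : ∀ s, s ≤ -(2 * d) → low s = 0 := fun s hs =>
    Real.smoothTransition.zero_of_nonpos (div_nonpos_of_nonpos_of_nonneg (by linarith) hd.le)
  let φ : E3 → ℝ := fun x => low (x 2) * ψ x
  have c2 : Continuous fun x : E3 => x 2 := by fun_prop
  have hφ : ContDiff ℝ 1 φ :=
    (hlow.comp (EuclideanSpace.proj (2 : Fin 3) : E3 →L[ℝ] ℝ).contDiff).mul hψ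
  have z1 : ∀ x : E3, σ ≤ ‖horiz x‖ → φ x = 0 ∧ fderiv ℝ φ x = 0 := by
    intro x hx
    have hev : φ =ᶠ[𝓝 x] fun _ => 0 := by
      filter_upwards [continuous_horiz.norm.continuousAt.eventually_const_lt
        (show σ / 2 < ‖horiz x‖ by linarith)] with y hy
      simp only [φ, h0 y (Or.inl hy), mul_zero]
    exact ⟨hev.eq_of_nhds, by rw [hev.fderiv_eq]; simp⟩
  have z2 : ∀ x : E3, h + 2 * d ≤ x 2 → φ x = 0 ∧ fderiv ℝ φ x = 0 := by
    intro x hx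
    have hev : φ =ᶠ[𝓝 x] fun _ => 0 := by
      filter_upwards [c2.continuousAt.eventually_const_lt
        (show h + 3 / 2 * d < x 2 by linarith)] with y hy
      simp only [φ, h0 y (Or.inr hy), mul_zero]
    exact ⟨hev.eq_of_nhds, by rw [hev.fderiv_eq]; simp⟩
  have z3 : ∀ x : E3, x 2 < -(2 * d) → φ x = 0 ∧ fderiv ℝ φ x = 0 := by
    intro x hx
    have hev : φ =ᶠ[𝓝 x] fun _ => 0 := by
      filter_upwards [c2.continuousAt.eventually_lt_const hx] with y hy
      simp only [φ, low0 _ hy.le, zero_mul]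
    exact ⟨hev.eq_of_nhds, by rw [hev.fderiv_eq]; simp⟩
  have z4 : ∀ x : E3, -d < x 2 → φ x = ψ x ∧ fderiv ℝ φ x = fderiv ℝ ψ x := by
    intro x hx
    have hev : φ =ᶠ[𝓝 x] ψ := by
      filter_upwards [c2.continuousAt.eventually_const_lt hx] with y hy
      simp only [φ, low1 _ hy.le, one_mul]
    exact ⟨hev.eq_of_nhds, hev.fderiv_eq⟩
  have hφc : HasCompactSupport φ := by
    refine HasCompactSupport.intro (isBounded_zone h (3 * d) σ).isCompact_closure fun x hx => ?_
    have hx' : x ∉ zone h (3 * d) σ := fun hx' => hx (subset_closure hx')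
    by_cases a1 : σ ≤ ‖horiz x‖
    · exact (z1 x a1).1
    by_cases a2 : h + 2 * d ≤ x 2
    · exact (z2 x a2).1
    by_cases a3 : x 2 < -(2 * d)
    · exact (z3 x a3).1
    · exact absurd ⟨by linarith, by linarith, by linarith⟩ hx'
  have key := F.green φ hφ hφc i j
  have hZ : MeasurableSet (zone h d σ) := (isOpen_zone h d σ).measurableSet
  have cases : ∀ x : E3, x ∉ zone h d σ → (φ x = 0 ∧ fderiv ℝ φ x = 0) ∨
      (∀ i, U i x = 0) ∧ ∀ i j, G i j x = 0 := by
    intro x hx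
    by_cases a1 : σ ≤ ‖horiz x‖
    · exact Or.inl (z1 x a1)
    by_cases a2 : h + 2 * d ≤ x 2
    · exact Or.inl (z2 x a2)
    by_cases a3 : x 2 < -(2 * d)
    · exact Or.inl (z3 x a3)
    · right
      refine F.bottom x (not_le.1 a1) (not_lt.1 a3) ?_
      by_contra a4
      exact hx ⟨not_le.1 a1, not_le.1 a4, not_le.1 a2⟩
  have e1 : ∫ x in zone h d σ, fderiv ℝ ψ x (ev j) * U i x = ∫ x, fderiv ℝ φ x (ev j) * U i x := by
    rw [← setIntegral_eq_integral_of_forall_compl_eq_zero (s := zone h d σ)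
      (f := fun x => fderiv ℝ φ x (ev j) * U i x)]
    · refine setIntegral_congr_fun hZ fun x hx => ?_
      simp only [(z4 x hx.2.1).2]
    · intro x hx
      rcases cases x hx with hc | hc
      · simp [hc.2]
      · simp [hc.1]
  have e2 : ∫ x in zone h d σ, ψ x * G i j x = ∫ x, φ x * G i j x := by
    rw [← setIntegral_eq_integral_of_forall_compl_eq_zero (s := zone h d σ)
      (f := fun x => φ x * G i j x)]
    · refine setIntegral_congr_fun hZ fun x hx => ?_
      simp only [(z4 x hx.2.1).1]
    · intro x hx
      rcases cases x hx with hc | hc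
      · simp [hc.1]
      · simp [hc.2]
  rw [e1, e2, key]

theorem green_vertical (F : GapFlow h d σ B U G Γ V M) {ξ : E2 → ℝ} {τ : ℝ → ℝ}
    (hξ : ContDiff ℝ 1 ξ) (hτ : ContDiff ℝ 1 τ) (ξ0 : ∀ y, σ / 2 ≤ ‖y‖ → ξ y = 0)
    (τ0 : ∀ s, h + 3 / 2 * d ≤ s → τ s = 0) (i : Fin 3) :
    ∫ x in zone h d σ, ξ (horiz x) * deriv τ (x 2) * U i x =
      -∫ x in zone h d σ, ξ (horiz x) * τ (x 2) * G i 2 x := by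
  rw [← F.green_zone (contDiff_mul_split hξ hτ) ?_ i 2]
  · refine integral_congr_ae (Eventually.of_forall fun x => ?_)
    simp only
    rw [fderiv_mul_split x (hξ.differentiable one_ne_zero _) (hτ.differentiable one_ne_zero _),
      ev_two, horiz_e3, map_zero]
    simp [e3]
  · rintro x (hx | hx)
    · rw [ξ0 _ hx.le, zero_mul]
    · rw [τ0 _ hx.le, mul_zero]

theorem green_horizontal (F : GapFlow h d σ B U G Γ V M) {ξ : E2 → ℝ} {τ : ℝ → ℝ}
    (hξ : ContDiff ℝ 1 ξ) (hτ : ContDiff ℝ 1 τ) (ξ0 : ∀ y, σ / 2 ≤ ‖y‖ → ξ y = 0)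
    (τ0 : ∀ s, h + 3 / 2 * d ≤ s → τ s = 0) (i : Fin 3) (j : Fin 2) :
    ∫ x in zone h d σ, fderiv ℝ ξ (horiz x) (EuclideanSpace.single j 1) * τ (x 2) * U i x =
      -∫ x in zone h d σ, ξ (horiz x) * τ (x 2) * G i j.castSucc x := by
  rw [← F.green_zone (contDiff_mul_split hξ hτ) ?_ i j.castSucc]
  · refine integral_congr_ae (Eventually.of_forall fun x => ?_)
    simp only
    rw [fderiv_mul_split x (hξ.differentiable one_ne_zero _) (hτ.differentiable one_ne_zero _),
      horiz_ev, ev_castSucc_two]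
    simp
  · rintro x (hx | hx)
    · rw [ξ0 _ hx.le, zero_mul]
    · rw [τ0 _ hx.le, mul_zero]

/-- The averaged trace of the field on the body above the gap. -/
theorem integral_trace (F : GapFlow h d σ B U G Γ V M) {ξ : E2 → ℝ} (hξ : Continuous ξ)
    (ξ0 : ∀ y, σ / 2 ≤ ‖y‖ → ξ y = 0) (i : Fin 3) :
    ∫ x in zone h d σ, ξ (horiz x) * deriv (chi h d) (x 2) * U i x =
      -((V i + M i 2 * (cutHeight h d - h)) * (∫ y, ξ y) + M i 0 * (∫ y, y 0 * ξ y) +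
        M i 1 * ∫ y, y 1 * ξ y) := by
  have hd := F.d_pos
  have hσ := F.σ_pos
  have hξc : HasCompactSupport ξ := HasCompactSupport.intro (isCompact_closedBall 0 (σ / 2))
    fun y hy => ξ0 y (not_le.1 (by simpa using hy)).le
  have hχc : HasCompactSupport (deriv (chi h d)) :=
    HasCompactSupport.intro (isCompact_Icc (a := h + d) (b := h + 3 / 2 * d)) fun s hs => by
      rw [mem_Icc, not_and_or, not_le, not_le] at hs
      rcases hs with hs | hs
      · exact deriv_chi_eq_zero_of_le hd hs.le
      · exact deriv_chi_eq_zero_of_ge hd hs.le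
  -- The factor `χ'` lives in `h + d ≤ x₃ ≤ h + 3d/2`. There the zone belongs to the body, so `U`
  -- may be replaced by the rigid velocity and the integral extended to the whole space for Fubini.
  have e1 : ∫ x in zone h d σ, ξ (horiz x) * deriv (chi h d) (x 2) * U i x =
      ∫ x : E3, ξ (horiz x) * deriv (chi h d) (x 2) *
        (V i + M i 0 * x 0 + M i 1 * x 1 + M i 2 * (x 2 - h)) := by
    rw [← integral_indicator (isOpen_zone h d σ).measurableSet]
    refine integral_congr_ae ?_
    filter_upwards [F.U_rigid] with x hx
    by_cases hxz : x ∈ zone h d σ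
    · rw [indicator_of_mem hxz]
      by_cases a1 : h + d < x 2
      · rw [hx (F.top x hxz.1 a1 hxz.2.2)]
      · rw [deriv_chi_eq_zero_of_le hd (not_lt.1 a1)]; simp
    · rw [indicator_of_notMem hxz]
      by_cases a1 : σ / 2 ≤ ‖horiz x‖
      · rw [ξ0 _ a1]; simp
      by_cases a2 : x 2 ≤ h + d
      · rw [deriv_chi_eq_zero_of_le hd a2]; simp
      by_cases a3 : h + 3 / 2 * d ≤ x 2
      · rw [deriv_chi_eq_zero_of_ge hd a3]; simp
      exact absurd ⟨by linarith, by linarith [F.h_pos], by linarith⟩ hxz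
  have hsplit : ∀ (f : E2 → ℝ) (g : ℝ → ℝ), Continuous f → HasCompactSupport f → Continuous g →
      HasCompactSupport g → Integrable fun x : E3 => f (horiz x) * g (x 2) := by
    intro f g hf hfc hg hgc
    have h1 : Integrable (fun p : E2 × ℝ => f p.1 * g p.2) (volume.prod volume) :=
      (hf.integrable_of_hasCompactSupport hfc).mul_prod (hg.integrable_of_hasCompactSupport hgc)
    exact (measurePreserving_split.integrable_comp_emb splitHomeo.measurableEmbedding).2 h1
  have cχ := continuous_deriv_chi (h := h) (d := d)
  have c0 : Continuous fun y : E2 => y 0 * ξ y := (by fun_prop : Continuous fun y : E2 => y 0).mul hξ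
  have c1 : Continuous fun y : E2 => y 1 * ξ y := (by fun_prop : Continuous fun y : E2 => y 1).mul hξ
  have i0 := hsplit _ _ hξ hξc cχ hχc
  have i1 := hsplit _ _ c0 hξc.mul_left cχ hχc
  have i2 := hsplit _ _ c1 hξc.mul_left cχ hχc
  have i3 := hsplit ξ (fun s => deriv (chi h d) s * s) hξ hξc (cχ.mul continuous_id) hχc.mul_right
  have e2 : ∀ x : E3, ξ (horiz x) * deriv (chi h d) (x 2) *
        (V i + M i 0 * x 0 + M i 1 * x 1 + M i 2 * (x 2 - h)) =
      (V i - M i 2 * h) * (ξ (horiz x) * deriv (chi h d) (x 2)) +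
      M i 0 * ((horiz x) 0 * ξ (horiz x) * deriv (chi h d) (x 2)) +
      M i 1 * ((horiz x) 1 * ξ (horiz x) * deriv (chi h d) (x 2)) +
      M i 2 * (ξ (horiz x) * (deriv (chi h d) (x 2) * x 2)) := by
    intro x
    have a0 : (horiz x) 0 = x 0 := by simp [horiz]
    have a1 : (horiz x) 1 = x 1 := by simp [horiz]
    rw [a0, a1]; ring
  rw [e1]
  simp_rw [e2]
  rw [integral_add (((i0.const_mul _).fun_add (i1.const_mul _)).fun_add (i2.const_mul _))
      (i3.const_mul _),
    integral_add ((i0.const_mul _).fun_add (i1.const_mul _)) (i2.const_mul _),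
    integral_add (i0.const_mul _) (i1.const_mul _), integral_const_mul, integral_const_mul,
    integral_const_mul, integral_const_mul, integral_split_mul ξ,
    integral_split_mul (fun y => y 0 * ξ y), integral_split_mul (fun y => y 1 * ξ y),
    integral_split_mul ξ (fun s => deriv (chi h d) s * s), integral_deriv_chi hd,
    integral_deriv_chi_mul_id hd]
  ring

/-- Splitting of an integral of the gradient into the fluid part and the rigid part. -/
theorem abs_integral_sub_le (F : GapFlow h d σ B U G Γ V M) {f : E3 → ℝ} (hf : Continuous f)
    {A : ℝ} (hA : ∀ x ∈ zone h d σ, |f x| ≤ A) (i j : Fin 3) :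
    |(∫ x in zone h d σ, f x * G i j x) - M i j * ∫ x in zone h d σ ∩ B, f x| ≤
      A * gapMass h d σ B Γ := by
  have hZ : MeasurableSet (zone h d σ) := (isOpen_zone h d σ).measurableSet
  have hint := integrableOn_zone_mul hf (F.G_int i j) h d σ
  have hcl : MeasurableSet (closure B) := isClosed_closure.measurableSet
  have e1 := integral_inter_add_sdiff hcl hint
  -- The fluid is the complement of `closure B`, whereas rigidity is known on `B`; the difference is
  -- a null set.
  have hae : (zone h d σ ∩ closure B : Set E3) =ᵐ[volume] (zone h d σ ∩ B : Set E3) := by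
    refine (EventuallyEq.refl _ _).inter ?_
    exact (closure_ae_eq_of_null_frontier F.frontier_B)
  have e2 : ∫ x in zone h d σ ∩ closure B, f x * G i j x =
      M i j * ∫ x in zone h d σ ∩ B, f x := by
    rw [setIntegral_congr_set hae, ← integral_const_mul]
    refine setIntegral_congr_ae (hZ.inter F.isOpen_B.measurableSet) ?_
    filter_upwards [F.G_rigid] with x hx hxB
    rw [hx hxB.2, mul_comm]
  rw [← e1, e2, add_sub_cancel_left, gapMass, ← integral_const_mul]
  rw [← Real.norm_eq_abs]
  refine (norm_integral_le_of_norm_le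
    (((integrableOn_zone F.Γ_int h d σ).mono_set sdiff_subset).const_mul A) ?_)
  refine (ae_restrict_iff' (hZ.diff hcl)).2 (Eventually.of_forall fun x hx => ?_)
  rw [norm_mul, Real.norm_eq_abs, Real.norm_eq_abs]
  have := F.G_le i j x
  have h1 := hA x hx.1
  have h2 : 0 ≤ A := (abs_nonneg _).trans h1
  gcongr

theorem gapMass_nonneg (F : GapFlow h d σ B U G Γ V M) : 0 ≤ gapMass h d σ B Γ :=
  integral_nonneg fun x => (abs_nonneg _).trans (F.G_le 0 0 x)

theorem diag_zero (F : GapFlow h d σ B U G Γ V M) (i : Fin 3) : M i i = 0 := by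
  linarith [F.skew i i]

/-- The vertical velocity is given by the flux through the lateral boundary of the gap. -/
theorem flux_eq (F : GapFlow h d σ B U G Γ V M) :
    V 2 * (σ ^ 2 * mass0) = ∑ j : Fin 2, ∫ x in zone h d σ,
      dzeta σ j (horiz x) * Theta h d (x 2) * G j.castSucc 2 x := by
  have hd := F.d_pos
  have hσ := F.σ_pos
  have cζ : ContDiff ℝ 1 (zeta σ) := contDiff_zeta (n := 1)
  have cχ : ContDiff ℝ 1 (chi h d) := contDiff_chi (n := 1)
  have ζ0 : ∀ y, σ / 2 ≤ ‖y‖ → zeta σ y = 0 := fun y hy => zeta_eq_zero hσ hy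
  have χ0 : ∀ s, h + 3 / 2 * d ≤ s → chi h d s = 0 := fun s hs => chi_eq_zero hd hs
  have h1 : ∀ j : Fin 2, ∫ x in zone h d σ, dzeta σ j (horiz x) * chi h d (x 2) * U j.castSucc x =
      -∫ x in zone h d σ, zeta σ (horiz x) * chi h d (x 2) * G j.castSucc j.castSucc x := by
    intro j
    rw [← F.green_horizontal cζ cχ ζ0 χ0 j.castSucc j]
    simp only [fderiv_zeta]
  -- The trace of the third component: the first moments of `zeta` and the entry `M 2 2` are zero,
  -- so only the translation `V 2` survives.
  have h2 := F.green_vertical cζ cχ ζ0 χ0 2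
  rw [F.integral_trace cζ.continuous ζ0 2, integral_coord_mul_zeta, integral_coord_mul_zeta,
    F.diag_zero, integral_zeta hσ] at h2
  -- As `χ = -Θ'`, a second, vertical integration by parts trades the horizontal velocity for its
  -- vertical derivative. There is no boundary term: `Θ` vanishes at the top, the field at the
  -- bottom.
  have h3 : ∀ j : Fin 2, ∫ x in zone h d σ, dzeta σ j (horiz x) * chi h d (x 2) * U j.castSucc x =
      ∫ x in zone h d σ, dzeta σ j (horiz x) * Theta h d (x 2) * G j.castSucc 2 x := by
    intro j
    have := F.green_vertical (contDiff_dzeta (n := 1) j) contDiff_Theta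
      (fun y hy => dzeta_eq_zero hσ j hy) (fun s hs => Theta_eq_zero hd hs) j.castSucc
    simp only [(hasDerivAt_Theta (h := h) (d := d) _).deriv, mul_neg, neg_mul,
      integral_neg] at this
    linarith
  have hc : Continuous fun x : E3 => zeta σ (horiz x) * chi h d (x 2) :=
    (contDiff_mul_split cζ cχ).continuous
  -- The divergence condition tested with `ζ χ`; it connects the vertical trace with the horizontal
  -- fluxes.
  have hdiv : (∫ x in zone h d σ, zeta σ (horiz x) * chi h d (x 2) * G 0 0 x) +
      (∫ x in zone h d σ, zeta σ (horiz x) * chi h d (x 2) * G 1 1 x) +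
      (∫ x in zone h d σ, zeta σ (horiz x) * chi h d (x 2) * G 2 2 x) = 0 := by
    rw [← integral_add (integrableOn_zone_mul hc (F.G_int _ _) h d σ)
        (integrableOn_zone_mul hc (F.G_int _ _) h d σ),
      ← integral_add (Integrable.fun_add (integrableOn_zone_mul hc (F.G_int _ _) h d σ)
        (integrableOn_zone_mul hc (F.G_int _ _) h d σ))
        (integrableOn_zone_mul hc (F.G_int _ _) h d σ)]
    refine integral_eq_zero_of_ae ((ae_restrict_of_ae F.div_free).mono fun x hx => ?_)
    simp only [Pi.zero_apply]
    rw [← mul_add, ← mul_add, hx, mul_zero]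
  rw [Fin.sum_univ_two, ← h3, ← h3, h1, h1]
  simp only [Fin.castSucc_zero, Fin.castSucc_one]
  linarith

/-- The rotation about a horizontal axis is controlled by the gradient in the gap. -/
theorem rotation_bound (F : GapFlow h d σ B U G Γ V M) (j : Fin 2) :
    |M 2 j.castSucc| * (σ ^ 3 * moment0 j) ≤ gapMass h d σ B Γ := by
  have hd := F.d_pos
  have hσ := F.σ_pos
  have cζ : ContDiff ℝ 1 (zeta σ) := contDiff_zeta (n := 1)
  have cχ : ContDiff ℝ 1 (chi h d) := contDiff_chi (n := 1)
  have cξ : ContDiff ℝ 1 fun y : E2 => y j * zeta σ y :=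
    (by fun_prop : ContDiff ℝ 1 fun y : E2 => y j).mul cζ
  have ξ0 : ∀ y, σ / 2 ≤ ‖y‖ → y j * zeta σ y = 0 := fun y hy => by
    rw [zeta_eq_zero hσ hy, mul_zero]
  -- The additional weight `y j` removes the translation and selects the entry `M 2 j`, because the
  -- mixed second moment of `zeta` is zero.
  have h1 := F.green_vertical cξ cχ ξ0 (fun s hs => chi_eq_zero hd hs) 2
  rw [F.integral_trace cξ.continuous ξ0 2, F.diag_zero, integral_coord_mul_zeta, mul_zero,
    zero_add] at h1
  have h2 : M 2 0 * (∫ y : E2, y 0 * (y j * zeta σ y)) + M 2 1 * ∫ y : E2, y 1 * (y j * zeta σ y) =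
      M 2 j.castSucc * (σ ^ 4 * moment0 j) := by
    rw [← integral_coord_sq_mul_zeta hσ]
    have hm := integral_mixed_mul_zeta (σ := σ)
    simp only [← mul_assoc]
    fin_cases j
    · have e : ∀ y : E2, y 1 * y 0 * zeta σ y = y 0 * y 1 * zeta σ y := fun y => by ring
      simp [e, hm]
    · simp [hm]
  rw [h2] at h1
  have hc : Continuous fun x : E3 => (horiz x) j * zeta σ (horiz x) * chi h d (x 2) :=
    (contDiff_mul_split cξ cχ).continuous
  -- The derivative involved is `∂₃u₃`, which vanishes on the body since `M 2 2 = 0`. So the fluid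
  -- alone bounds the rotation.
  have h3 := F.abs_integral_sub_le hc (A := σ) (fun x hx => by
    rw [abs_mul, abs_mul, abs_of_nonneg (zeta_nonneg _), abs_of_nonneg (chi_nonneg _)]
    have a1 : |(horiz x) j| ≤ σ := (abs_coord_le _ j).trans hx.1.le
    calc |(horiz x) j| * zeta σ (horiz x) * chi h d (x 2) ≤ σ * 1 * 1 := by
          gcongr
          · exact chi_nonneg _
          · exact zeta_nonneg _
          · exact zeta_le_one _
          · exact chi_le_one _
      _ = σ := by ring) 2 2
  rw [F.diag_zero, zero_mul, sub_zero, ← neg_eq_iff_eq_neg.2 h1, neg_neg, abs_mul,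
    abs_of_pos (mul_pos (pow_pos hσ 4) (moment0_pos j))] at h3
  refine le_of_mul_le_mul_left ?_ hσ
  calc σ * (|M 2 j.castSucc| * (σ ^ 3 * moment0 j)) = |M 2 j.castSucc| * (σ ^ 4 * moment0 j) := by
        ring
    _ ≤ _ := h3

end GapFlow
end

/-! ### First order bound for the normal velocity -/

noncomputable section

/-- In the flux identity the weight `∂ⱼζ Θ` is of order `H / σ` with `H = h + 3d`. The fluid part is
therefore at most `C H ℓ / σ`, where `ℓ` is the gap mass. The body part is `M j 2` times the
integral of the weight over a set of volume of order `σ² H`, and `|M j 2| ≤ C ℓ / σ³`. Division by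
the mass `σ² mass0` gives the claim. -/
theorem GapFlow.exists_speed_bound : ∃ C : ℝ, 0 < C ∧ ∀ (h d σ : ℝ) (B : Set E3)
    (U : Fin 3 → E3 → ℝ) (G : Fin 3 → Fin 3 → E3 → ℝ) (Γ : E3 → ℝ) (V : Fin 3 → ℝ)
    (M : Fin 3 → Fin 3 → ℝ), GapFlow h d σ B U G Γ V M →
    |V 2| * σ ^ 3 ≤ C * (h + 3 * d) * (1 + (h + 3 * d) / σ) * gapMass h d σ B Γ := by
  obtain ⟨C₁, hC₁, hdz⟩ := exists_dzeta_bound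
  set m := min (moment0 0) (moment0 1)
  have hm : 0 < m := lt_min (moment0_pos 0) (moment0_pos 1)
  set vb := (volume (Metric.ball (0 : E2) 1)).toReal
  have hvb : 0 ≤ vb := ENNReal.toReal_nonneg
  have hm0 := mass0_pos
  refine ⟨2 * C₁ * (1 + vb / m) / mass0, by positivity, ?_⟩
  intro h d σ B U G Γ V M F
  have hh := F.h_pos
  have hd := F.d_pos
  have hσ := F.σ_pos
  set H := h + 3 * d with hH
  have hH0 : 0 < H := by positivity
  set ℓ := gapMass h d σ B Γ
  have hℓ : 0 ≤ ℓ := F.gapMass_nonneg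
  have hvol : volume.real (zone h d σ) = σ ^ 2 * vb * H := by
    rw [Measure.real, volume_zone hσ.le, ENNReal.toReal_ofReal (by positivity)]
  have hfin : volume (zone h d σ) < ⊤ := (isBounded_zone h d σ).measure_lt_top
  have key : ∀ j : Fin 2, |∫ x in zone h d σ,
      dzeta σ j (horiz x) * Theta h d (x 2) * G j.castSucc 2 x| ≤
        C₁ / σ * H * ℓ + C₁ * (vb / m) * H ^ 2 / σ ^ 2 * ℓ := by
    intro j
    have hc : Continuous fun x : E3 => dzeta σ j (horiz x) * Theta h d (x 2) :=
      (contDiff_mul_split (contDiff_dzeta (n := 1) j) contDiff_Theta).continuous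
    have hA : ∀ x ∈ zone h d σ, |dzeta σ j (horiz x) * Theta h d (x 2)| ≤ C₁ / σ * H := by
      intro x hx
      have h1 := Theta_nonneg (h := h) (d := d) hx.2.2.le
      have h2 := Theta_le (h := h) (d := d) hx.2.2.le
      rw [abs_mul, abs_of_nonneg h1]
      have := hdz σ hσ j (horiz x)
      gcongr
      linarith [hx.2.1]
    have h1 := F.abs_integral_sub_le hc hA j.castSucc 2
    have h2 : |∫ x in zone h d σ ∩ B, dzeta σ j (horiz x) * Theta h d (x 2)| ≤
        C₁ / σ * H * (σ ^ 2 * vb * H) := by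
      rw [← hvol]
      rw [← Real.norm_eq_abs]
      refine (norm_setIntegral_le_of_norm_le_const (C := C₁ / σ * H)
        ((measure_mono inter_subset_left).trans_lt hfin)
        fun x hx => by rw [Real.norm_eq_abs]; exact hA x hx.1).trans ?_
      gcongr
      · exact hfin.ne
      · exact inter_subset_left
    -- Skewness turns the entry needed here into the entry `M 2 j` that is controlled by
    -- `rotation_bound`.
    have h3 : |M j.castSucc 2| ≤ ℓ / (σ ^ 3 * m) := by
      rw [F.skew, abs_neg, le_div_iff₀ (by positivity)]
      refine le_trans ?_ (F.rotation_bound j)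
      gcongr
      fin_cases j
      · exact min_le_left _ _
      · exact min_le_right _ _
    have h4 : |M j.castSucc 2 * ∫ x in zone h d σ ∩ B, dzeta σ j (horiz x) * Theta h d (x 2)| ≤
        C₁ * (vb / m) * H ^ 2 / σ ^ 2 * ℓ := by
      rw [abs_mul]
      calc _ ≤ ℓ / (σ ^ 3 * m) * (C₁ / σ * H * (σ ^ 2 * vb * H)) := by gcongr
        _ = _ := by field_simp
    have h5 := abs_sub_abs_le_abs_sub (∫ x in zone h d σ,
      dzeta σ j (horiz x) * Theta h d (x 2) * G j.castSucc 2 x)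
      (M j.castSucc 2 * ∫ x in zone h d σ ∩ B, dzeta σ j (horiz x) * Theta h d (x 2))
    linarith
  have hflux := F.flux_eq
  rw [Fin.sum_univ_two] at hflux
  have h1 : |V 2| * (σ ^ 2 * mass0) ≤
      2 * (C₁ / σ * H * ℓ + C₁ * (vb / m) * H ^ 2 / σ ^ 2 * ℓ) := by
    rw [← abs_of_pos (show 0 < σ ^ 2 * mass0 by positivity), ← abs_mul, hflux]
    refine (abs_add_le _ _).trans ?_
    linarith [key 0, key 1]
  have h2 : |V 2| * σ ^ 3 = σ / mass0 * (|V 2| * (σ ^ 2 * mass0)) := by field_simp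
  rw [h2]
  calc σ / mass0 * (|V 2| * (σ ^ 2 * mass0)) ≤
      σ / mass0 * (2 * (C₁ / σ * H * ℓ + C₁ * (vb / m) * H ^ 2 / σ ^ 2 * ℓ)) := by gcongr
    _ = 2 * C₁ / mass0 * H * (1 + (vb / m) * (H / σ)) * ℓ := by field_simp
    _ ≤ 2 * C₁ / mass0 * H * ((1 + vb / m) * (1 + H / σ)) * ℓ := by
        gcongr
        have : 0 ≤ vb / m := by positivity
        have h6 : 0 ≤ H / σ := by positivity
        nlinarith
    _ = _ := by ring

/-! ### From the physical field to the coordinates of the gap -/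

section Transfer

variable {Ω S : Set E3} {p : ℝ≥0∞} {u : E3 → E3} {Du : E3 → E3 →L[ℝ] E3} {a b c : E3}

theorem measurePreserving_frame (R : E3 ≃ᵃⁱ[ℝ] E3) : MeasurePreserving R := by
  have h1 := R.linearIsometryEquiv.measurePreserving
  have h2 := measurePreserving_add_right (volume : Measure E3) (R 0)
  have e : (R : E3 → E3) = (fun x => x + R 0) ∘ R.linearIsometryEquiv :=
    funext fun x => frame_apply R x
  rw [e]
  exact h2.comp h1

theorem measurableEmbedding_frame (R : E3 ≃ᵃⁱ[ℝ] E3) : MeasurableEmbedding R :=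
  R.toHomeomorph.measurableEmbedding

/-- The components of a vector field in the coordinates given by a frame. -/
def frameField (R : E3 ≃ᵃⁱ[ℝ] E3) (Ω : Set E3) (u : E3 → E3) (i : Fin 3) (x : E3) : ℝ :=
  inner ℝ (R.linearIsometryEquiv (ev i)) (Ω.indicator u (R x))

/-- The components of a gradient in the coordinates given by a frame. -/
def frameGrad (R : E3 ≃ᵃⁱ[ℝ] E3) (Ω : Set E3) (Du : E3 → E3 →L[ℝ] E3) (i j : Fin 3) (x : E3) : ℝ :=
  inner ℝ (R.linearIsometryEquiv (ev i))
    (Ω.indicator Du (R x) (R.linearIsometryEquiv (ev j)))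

theorem norm_ev (j : Fin 3) : ‖ev j‖ = 1 := by simp [ev]

theorem memLp_frame {V : Type*} [NormedAddCommGroup V] (R : E3 ≃ᵃⁱ[ℝ] E3) (hΩ : IsOpen Ω)
    {f : E3 → V} (hf : MemLp f p (volume.restrict Ω)) :
    MemLp (fun x => Ω.indicator f (R x)) p volume :=
  ((memLp_indicator_iff_restrict hΩ.measurableSet).2 hf).comp_measurePreserving
    (measurePreserving_frame R)

theorem frame_expand (R : E3 ≃ᵃⁱ[ℝ] E3) (h : ℝ) (x : E3) :
    R x - R !₂[0, 0, h] = x 0 • R.linearIsometryEquiv (ev 0) + x 1 • R.linearIsometryEquiv (ev 1) +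
      (x 2 - h) • R.linearIsometryEquiv (ev 2) := by
  rw [frame_apply R x, frame_apply R !₂[0, 0, h], add_sub_add_right_eq_sub, ← map_sub, ← map_smul,
    ← map_smul, ← map_smul, ← map_add, ← map_add]
  congr 1
  ext i; fin_cases i <;> simp [ev]

theorem fderiv_comp_frame_symm (R : E3 ≃ᵃⁱ[ℝ] E3) {ψ : E3 → ℝ} (hψ : ContDiff ℝ 1 ψ) (x w : E3) :
    fderiv ℝ (fun z => ψ (R.symm z)) (R x) (R.linearIsometryEquiv w) = fderiv ℝ ψ x w := by
  have h1 : HasFDerivAt (R.symm : E3 → E3)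
      (R.symm.linearIsometryEquiv.toContinuousLinearEquiv : E3 →L[ℝ] E3) (R x) := by
    have e : (R.symm : E3 → E3) = fun z => R.symm.linearIsometryEquiv z + R.symm 0 :=
      funext fun z => frame_apply R.symm z
    rw [e]
    exact (ContinuousLinearMap.hasFDerivAt
      (R.symm.linearIsometryEquiv.toContinuousLinearEquiv : E3 →L[ℝ] E3)).add_const _
  have h2 : HasFDerivAt ψ (fderiv ℝ ψ x) (R.symm (R x)) := by
    rw [R.symm_apply_apply]
    exact (hψ.differentiable one_ne_zero x).hasFDerivAt
  have h3 : HasFDerivAt (fun z => ψ (R.symm z)) _ (R x) := h2.comp (R x) h1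
  rw [h3.fderiv, ContinuousLinearMap.comp_apply]
  congr 1
  have : R.symm.linearIsometryEquiv = R.linearIsometryEquiv.symm := rfl
  rw [this]
  simp

theorem contDiff_comp_frame_symm (R : E3 ≃ᵃⁱ[ℝ] E3) {ψ : E3 → ℝ} (hψ : ContDiff ℝ 1 ψ) :
    ContDiff ℝ 1 fun z => ψ (R.symm z) := by
  have e : (fun z => ψ (R.symm z)) = fun z => ψ (R.symm.linearIsometryEquiv z + R.symm 0) :=
    funext fun z => by rw [frame_apply R.symm z]
  rw [e]
  exact hψ.comp (R.symm.linearIsometryEquiv.contDiff.add contDiff_const)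

theorem hasCompactSupport_comp_frame_symm (R : E3 ≃ᵃⁱ[ℝ] E3) {ψ : E3 → ℝ}
    (hψ : HasCompactSupport ψ) : HasCompactSupport fun z => ψ (R.symm z) :=
  hψ.comp_homeomorph R.symm.toHomeomorph

/-- The field and its gradient are extended by zero outside `Ω`; membership in `W₀^{1,p}` makes the
extension weakly differentiable across `∂Ω`. The matrix of `y ↦ b × y` is skew in any orthonormal
basis, and the trace does not depend on the basis. -/
theorem MemW10.gapFlow (hΩ : IsOpen Ω) (hS : IsOpen S) (hSΩ : S ⊆ Ω) (hSf : volume (frontier S) = 0)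
    (hp : 1 ≤ p) (hu : MemW10 Ω p u Du)
    (hrig : ∀ᵐ x ∂(volume.restrict S), u x = rigidVel a b c x)
    (hdiv : ∀ᵐ x ∂(volume.restrict Ω), LinearMap.trace ℝ E3 (Du x : E3 →ₗ[ℝ] E3) = 0)
    (R : E3 ≃ᵃⁱ[ℝ] E3) {h d σ : ℝ} (hh : 0 < h) (hd : 0 < d) (hσ : 0 < σ)
    (hbot : ∀ x : E3, ‖horiz x‖ < σ → -(2 * d) ≤ x 2 → x 2 ≤ -d → R x ∉ Ω)
    (htop : ∀ x : E3, ‖horiz x‖ < σ → h + d < x 2 → x 2 < h + 2 * d → R x ∈ S) :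
    GapFlow h d σ (R ⁻¹' S) (frameField R Ω u) (frameGrad R Ω Du)
      (fun x => ‖Ω.indicator Du (R x)‖)
      (fun i => inner ℝ (R.linearIsometryEquiv (ev i)) (rigidVel a b c (R !₂[0, 0, h])))
      (fun i j => inner ℝ (R.linearIsometryEquiv (ev i))
        (cross3 b (R.linearIsometryEquiv (ev j)))) where
  h_pos := hh
  d_pos := hd
  σ_pos := hσ
  isOpen_B := hS.preimage R.continuous
  frontier_B := by
    have := R.toHomeomorph.preimage_frontier S
    change volume (frontier (R.toHomeomorph ⁻¹' S)) = 0
    rw [← this]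
    exact (measurePreserving_frame R).quasiMeasurePreserving.preimage_null hSf
  G_int i j := by
    have h1 := memLp_frame R hΩ hu.2.1
    have h2 : MemLp (fun x => Ω.indicator Du (R x) (R.linearIsometryEquiv (ev j))) p volume :=
      (ContinuousLinearMap.apply ℝ E3 (R.linearIsometryEquiv (ev j))).comp_memLp' h1
    exact (h2.const_inner _).locallyIntegrable hp
  Γ_int := (memLp_frame R hΩ hu.2.1).norm.locallyIntegrable hp
  G_le i j x := by
    refine (abs_real_inner_le_norm _ _).trans ?_
    rw [LinearIsometryEquiv.norm_map, norm_ev, one_mul]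
    refine (ContinuousLinearMap.le_opNorm _ _).trans ?_
    rw [LinearIsometryEquiv.norm_map, norm_ev, mul_one]
  green ψ hψ hψc i j := by
    have hψ' := contDiff_comp_frame_symm R hψ
    have hψc' := hasCompactSupport_comp_frame_symm R hψc
    have key := hu.integral_fderiv_smul hp hψ' hψc' (R.linearIsometryEquiv (ev j))
    have c1 : Continuous fun z => fderiv ℝ (fun z => ψ (R.symm z)) z
        (R.linearIsometryEquiv (ev j)) :=
      (hψ'.continuous_fderiv one_ne_zero).clm_apply continuous_const
    have c2 : HasCompactSupport fun z => fderiv ℝ (fun z => ψ (R.symm z)) z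
        (R.linearIsometryEquiv (ev j)) :=
      (hψc'.fderiv (𝕜 := ℝ)).comp_left
        (g := fun l : E3 →L[ℝ] ℝ => l (R.linearIsometryEquiv (ev j))) (by simp)
    have i1 := integrable_smul_of_memLp c1 c2 hp hu.1
    have hGw : MemLp (fun z => Du z (R.linearIsometryEquiv (ev j))) p (volume.restrict Ω) :=
      (ContinuousLinearMap.apply ℝ E3 (R.linearIsometryEquiv (ev j))).comp_memLp' hu.2.1
    have i2 := integrable_smul_of_memLp hψ'.continuous hψc' hp hGw
    have key2 := congrArg (fun z => inner ℝ (R.linearIsometryEquiv (ev i)) z) key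
    simp only [inner_neg_right] at key2
    rw [← integral_inner i1, ← integral_inner i2] at key2
    have e1 : ∫ x, fderiv ℝ ψ x (ev j) * frameField R Ω u i x =
        ∫ z in Ω, inner ℝ (R.linearIsometryEquiv (ev i))
          (fderiv ℝ (fun z => ψ (R.symm z)) z (R.linearIsometryEquiv (ev j)) • u z) := by
      rw [← integral_indicator hΩ.measurableSet,
        ← (measurePreserving_frame R).integral_comp (measurableEmbedding_frame R)
          (Ω.indicator fun z => inner ℝ (R.linearIsometryEquiv (ev i))
            (fderiv ℝ (fun z => ψ (R.symm z)) z (R.linearIsometryEquiv (ev j)) • u z))]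
      refine integral_congr_ae (Eventually.of_forall fun x => ?_)
      simp only [frameField]
      by_cases hx : R x ∈ Ω
      · rw [indicator_of_mem hx, indicator_of_mem hx, fderiv_comp_frame_symm R hψ,
          real_inner_smul_right]
      · rw [indicator_of_notMem hx, indicator_of_notMem hx, inner_zero_right, mul_zero]
    have e2 : ∫ x, ψ x * frameGrad R Ω Du i j x =
        ∫ z in Ω, inner ℝ (R.linearIsometryEquiv (ev i))
          (ψ (R.symm z) • Du z (R.linearIsometryEquiv (ev j))) := by
      rw [← integral_indicator hΩ.measurableSet,
        ← (measurePreserving_frame R).integral_comp (measurableEmbedding_frame R)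
          (Ω.indicator fun z => inner ℝ (R.linearIsometryEquiv (ev i))
            (ψ (R.symm z) • Du z (R.linearIsometryEquiv (ev j))))]
      refine integral_congr_ae (Eventually.of_forall fun x => ?_)
      simp only [frameGrad]
      by_cases hx : R x ∈ Ω
      · rw [indicator_of_mem hx, indicator_of_mem hx, R.symm_apply_apply,
          real_inner_smul_right]
      · rw [indicator_of_notMem hx, indicator_of_notMem hx]
        simp
    rw [e1, e2, key2]
  bottom x h1 h2 h3 := by
    have := hbot x h1 h2 h3
    refine ⟨fun i => ?_, fun i j => ?_⟩
    · rw [frameField, indicator_of_notMem this, inner_zero_right]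
    · rw [frameGrad, indicator_of_notMem this]; simp
  top := htop
  U_rigid := by
    rw [ae_restrict_iff' hS.measurableSet] at hrig
    filter_upwards [(measurePreserving_frame R).quasiMeasurePreserving.ae hrig] with x hx hxS i
    have hxS' : R x ∈ S := hxS
    have e : rigidVel a b c (R x) = rigidVel a b c (R !₂[0, 0, h]) +
        (x 0 • cross3 b (R.linearIsometryEquiv (ev 0)) +
          x 1 • cross3 b (R.linearIsometryEquiv (ev 1)) +
          (x 2 - h) • cross3 b (R.linearIsometryEquiv (ev 2))) := by
      have h1 := rigidVel_sub a b c (R x) (R !₂[0, 0, h])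
      rw [frame_expand] at h1
      have h2 : ∀ w, cross3 b w = rot b w := fun w => rfl
      rw [sub_eq_iff_eq_add'] at h1
      rw [h1]
      simp only [h2, map_add, map_smul]
    rw [frameField, indicator_of_mem (hSΩ hxS'), hx hxS', e]
    simp only [inner_add_right, real_inner_smul_right]
    ring
  G_rigid := by
    have h1 := hu.ae_eq_rot hS hSΩ hΩ hp hrig
    rw [ae_restrict_iff' hS.measurableSet] at h1
    filter_upwards [(measurePreserving_frame R).quasiMeasurePreserving.ae h1] with x hx hxS i j
    have hxS' : R x ∈ S := hxS
    rw [frameGrad, indicator_of_mem (hSΩ hxS'), hx hxS', rot_apply]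
  skew i j := by
    have h1 : ∀ x y : E3, inner ℝ x (cross3 b y) = -inner ℝ y (cross3 b x) := by
      intro x y
      rw [inner_E3, inner_E3, cross3_apply, cross3_apply]
      simp
      ring
    exact h1 _ _
  div_free := by
    rw [ae_restrict_iff' hΩ.measurableSet] at hdiv
    filter_upwards [(measurePreserving_frame R).quasiMeasurePreserving.ae hdiv] with x hx
    by_cases hxΩ : R x ∈ Ω
    · have h1 := LinearMap.trace_eq_sum_inner (Du (R x) : E3 →ₗ[ℝ] E3)
        ((EuclideanSpace.basisFun (Fin 3) ℝ).map R.linearIsometryEquiv)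
      rw [hx hxΩ, Fin.sum_univ_three] at h1
      simp only [frameGrad, indicator_of_mem hxΩ]
      rw [h1]
      simp [ev]
    · simp [frameGrad, indicator_of_notMem hxΩ]

theorem gapMass_frame (hΩ : IsOpen Ω) (R : E3 ≃ᵃⁱ[ℝ] E3) (h d σ : ℝ) :
    gapMass h d σ (R ⁻¹' S) (fun x => ‖Ω.indicator Du (R x)‖) =
      ∫ z in R '' zone h d σ ∩ (Ω \ closure S), ‖Du z‖ := by
  have e1 : zone h d σ \ closure (R ⁻¹' S) = R ⁻¹' (R '' zone h d σ \ closure S) := by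
    have := R.toHomeomorph.preimage_closure S
    rw [preimage_sdiff, preimage_image_eq _ R.injective]
    congr 1
    exact this.symm
  rw [gapMass, e1, (measurePreserving_frame R).setIntegral_preimage_emb
    (measurableEmbedding_frame R) (fun z => ‖Ω.indicator Du z‖)]
  have e2 : (fun z => ‖Ω.indicator Du z‖) = Ω.indicator fun z => ‖Du z‖ := by
    ext z
    exact norm_indicator_eq_indicator_norm _ _
  rw [e2, setIntegral_indicator hΩ.measurableSet]
  congr 2
  ext z
  rw [mem_inter_iff, mem_inter_iff, Set.mem_sdiff, Set.mem_sdiff]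
  tauto

/-- Hölder's inequality against the constant one. -/
theorem setIntegral_norm_le {V : Type*} [NormedAddCommGroup V] {f : E3 → V} {s : Set E3}
    (hp : 1 ≤ p) (hptop : p ≠ ⊤) (hf : MemLp f p (volume.restrict s)) (hs : volume s ≠ ⊤) {v : ℝ}
    (hv : (volume s).toReal ≤ v) :
    ∫ z in s, ‖f z‖ ≤ (eLpNorm f p (volume.restrict s)).toReal * v ^ (1 - 1 / p.toReal) := by
  have h1 := eLpNorm_le_eLpNorm_mul_rpow_measure_univ hp hf.1
  rw [Measure.restrict_apply_univ, eLpNorm_one_eq_lintegral_enorm, ENNReal.toReal_one,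
    div_one] at h1
  rw [integral_norm_eq_lintegral_enorm hf.1]
  have hp1 : 1 / p.toReal ≤ 1 := by
    have : 1 ≤ p.toReal := by
      rw [← ENNReal.toReal_one]; exact ENNReal.toReal_mono hptop hp
    rw [div_le_one (by linarith)]; exact this
  have h2 : volume s ^ (1 - 1 / p.toReal) ≠ ⊤ :=
    ENNReal.rpow_ne_top_of_nonneg (by linarith) hs
  refine (ENNReal.toReal_mono (ENNReal.mul_ne_top hf.2.ne h2) h1).trans ?_
  rw [ENNReal.toReal_mul, ← ENNReal.toReal_rpow]
  gcongr

end Transfer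
end

/-! ### Part (i): the bound in uniformly `C^{1,α}` domains -/

noncomputable section

theorem volume_frame_image (R : E3 ≃ᵃⁱ[ℝ] E3) (s : Set E3) : volume (R '' s) = volume s := by
  rw [← (measurePreserving_frame R).measure_preimage_emb (measurableEmbedding_frame R) (R '' s),
    preimage_image_eq _ R.injective]

/-- The gap distance is Lipschitz, and its derivative is the normal velocity of the body at the
closest point. -/
theorem IsRigidMotion.gap {Ω S₀ : Set E3} {T : ℝ} {us om xs : ℝ → E3} {X : ℝ → E3 → E3}
    (hX : IsRigidMotion Ω S₀ T us om xs X) (hS₀ : IsDomain3 S₀) (hS₀b : Bornology.IsBounded S₀)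
    {S : ℝ → Set E3} {h : ℝ → ℝ} (hS : ∀ t, S t = X t '' S₀)
    (hh : ∀ t, h t = setDist (S t) (frontier Ω)) :
    (∃ L : ℝ≥0, LipschitzOnWith L h (Ico 0 T)) ∧ ∃ A : ℝ → E3 ≃ᵃⁱ[ℝ] E3,
      (∀ t ∈ Ico 0 T, S t = A t '' S₀) ∧ ∀ᵐ t ∂(volume.restrict (Ioo 0 T)),
        DifferentiableAt ℝ h t ∧ (h t = 0 → deriv h t = 0) ∧
        ∀ R : E3 ≃ᵃⁱ[ℝ] E3, IsGapFrame Ω (S t) (h t) R → 0 < h t → deriv h t =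
          inner ℝ (R.linearIsometryEquiv (ev 2))
            (rigidVel (us t) (om t) (xs t) (R !₂[0, 0, h t])) := by
  obtain ⟨M, -, hM⟩ := hX.exists_lipschitz hS₀b
  have hlip : LipschitzOnWith M.toNNReal h (Ico 0 T) := by
    have e : h = fun t => setDist (X t '' S₀) (frontier Ω) := funext fun t => by rw [hh, hS]
    rw [e]
    exact setDist_lipschitz hS₀.2.nonempty hM
  obtain ⟨A, hA, hA'⟩ := hX.exists_isometries hS₀
  have hAS : ∀ t ∈ Ico 0 T, S t = A t '' S₀ := fun t ht => by
    rw [hS]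
    exact image_congr fun x hx => (hA t ht x hx).symm
  refine ⟨⟨_, hlip⟩, A, hAS, ?_⟩
  have hdiff := (hlip.mono Ioo_subset_Ico_self).ae_differentiableWithinAt
    (μ := volume) measurableSet_Ioo
  filter_upwards [hA', hdiff, ae_restrict_mem measurableSet_Ioo] with t h1 h2 ht
  have h3 : DifferentiableAt ℝ h t := h2.differentiableAt (isOpen_Ioo.mem_nhds ht)
  refine ⟨h3, deriv_gap_eq_zero hh, fun R hR hpos => ?_⟩
  rw [ev_two]
  exact deriv_gap_eq_inner hAS hh ht h3 h1 hpos hR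

/-- The radius `σ` is chosen with `σ ^ (1 + α) = h`. Then the deviation `d = k h` of the boundaries
from planes is comparable with the gap, the height `h + 3d` is `(1 + 3k) h`, and the smallness of
`h` keeps the layers `d` to `2d` beyond each wall inside the local coordinates. Apart from constants
the result is `h σ⁻³ (σ² h)^{1 - 1/p}` times the norm of the gradient. -/
theorem exists_speed_bound_C1 {α p k σ₀ : ℝ} (hα : 0 < α) (hp : 1 ≤ p) (hk : 0 < k) :
    ∃ C : ℝ, 0 < C ∧ ∀ (Ω S : Set E3) (u : E3 → E3) (Du : E3 → E3 →L[ℝ] E3) (a b c : E3) (h : ℝ)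
      (R : E3 ≃ᵃⁱ[ℝ] E3), IsOpen Ω → IsOpen S → S ⊆ Ω → UniformlyC1 α k σ₀ Ω →
      UniformlyC1 α k σ₀ S → MemW10 Ω (ENNReal.ofReal p) u Du →
      (∀ᵐ x ∂(volume.restrict S), u x = rigidVel a b c x) →
      (∀ᵐ x ∂(volume.restrict Ω), LinearMap.trace ℝ E3 (Du x : E3 →ₗ[ℝ] E3) = 0) →
      0 < h → h < 1 → 2 * h < σ₀ ^ (1 + α) → h = setDist S (frontier Ω) → IsGapFrame Ω S h R →
      |inner ℝ (R.linearIsometryEquiv (ev 2)) (rigidVel a b c (R !₂[0, 0, h]))| ≤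
        C * h ^ ((1 + 2 * α) / (p * (1 + α)) * (p - (3 + α) / (1 + 2 * α))) *
          (eLpNorm Du (ENNReal.ofReal p) (volume.restrict
            (R '' cyl k α h (h ^ (1 / (1 + α))) ∩ (Ω \ closure S)))).toReal := by
  obtain ⟨C, hC, hbound⟩ := GapFlow.exists_speed_bound
  set vb := (volume (Metric.ball (0 : E2) 1)).toReal
  have hvb : 0 < vb := ENNReal.toReal_pos (Metric.measure_ball_pos _ _ one_pos).ne'
    measure_ball_lt_top.ne
  refine ⟨C * (1 + 3 * k) * (2 + 3 * k) * ((1 + 3 * k) * vb) ^ (1 - 1 / p), by positivity, ?_⟩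
  intro Ω S u Du a b c h R hΩ hS hSΩ hΩ1 hS1 hu hrig hdiv hpos hh1 hh2 hh hR
  have hσ₀ : 0 < σ₀ := hΩ1.2.1
  set σ := h ^ (1 / (1 + α)) with hσdef
  have hσ : 0 < σ := by positivity
  have hσpow : σ ^ (1 + α) = h := by
    rw [hσdef, ← Real.rpow_mul hpos.le, one_div_mul_cancel (by linarith), Real.rpow_one]
  have hσσ : σ < σ₀ := by
    rw [← Real.rpow_lt_rpow_iff hσ.le hσ₀.le (show 0 < 1 + α by linarith), hσpow]
    linarith
  set d := k * σ ^ (1 + α) with hd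
  have hdh : d = k * h := by rw [hd, hσpow]
  have hd0 : 0 < d := by positivity
  have hcyl : cyl k α h σ = zone h d σ := rfl
  obtain ⟨s1, s2⟩ := hR.shape_C1 hpos hh hΩ hSΩ hα hΩ1 hS1
  have hlt : ∀ x : E3, ‖horiz x‖ < σ → k * ‖horiz x‖ ^ (1 + α) < d := fun x hx => by
    rw [hd]
    gcongr
  have h2d : 2 * d < k * σ₀ ^ (1 + α) := by
    rw [hdh]
    nlinarith
  have F := hu.gapFlow hΩ hS hSΩ (hS1.volume_frontier hα hS)
    (by rwa [ENNReal.one_le_ofReal]) hrig hdiv R hpos hd0 hσ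
    (fun x hx h1 h2 => s1 x (hx.trans hσσ) ((hlt x hx).trans_le (by linarith)) (by linarith))
    (fun x hx h1 h2 => s2 x (hx.trans hσσ) ((hlt x hx).trans (by linarith)) (by linarith))
  have key := hbound _ _ _ _ _ _ _ _ _ F
  rw [gapMass_frame hΩ] at key
  rw [hcyl]
  set N := (eLpNorm Du (ENNReal.ofReal p) (volume.restrict
            (R '' zone h d σ ∩ (Ω \ closure S)))).toReal with hN
  have hvol : volume (R '' zone h d σ ∩ (Ω \ closure S)) ≤ ENNReal.ofReal
      (σ ^ 2 * vb * (h + 3 * d)) := by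
    refine (measure_mono inter_subset_left).trans_eq ?_
    rw [volume_frame_image, volume_zone hσ.le]
  have hmass := setIntegral_norm_le (p := ENNReal.ofReal p) (by rwa [ENNReal.one_le_ofReal])
    ENNReal.ofReal_ne_top
    (hu.2.1.mono_measure (Measure.restrict_mono (show R '' zone h d σ ∩ (Ω \ closure S) ⊆ Ω from
      fun x hx => hx.2.1) le_rfl)) (hvol.trans_lt ENNReal.ofReal_lt_top).ne
    (ENNReal.toReal_le_of_le_ofReal (by positivity) hvol)
  rw [ENNReal.toReal_ofReal (by linarith)] at hmass
  have hN0 : 0 ≤ N := ENNReal.toReal_nonneg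
  have e1 : h + 3 * d = h * (1 + 3 * k) := by rw [hdh]; ring
  -- The gap is not higher than wide because `h < 1`; this bounds the factor `1 + (h + 3d) / σ` that
  -- comes from the rotation.
  have hhσ : h ≤ σ := by
    calc h = h ^ (1 : ℝ) := (Real.rpow_one h).symm
      _ ≤ σ := Real.rpow_le_rpow_of_exponent_ge hpos hh1.le (by
        rw [div_le_one (by linarith)]; linarith)
  have e2 : 1 + (h + 3 * d) / σ ≤ 2 + 3 * k := by
    have : h / σ ≤ 1 := (div_le_one hσ).2 hhσ
    calc 1 + (h + 3 * d) / σ = 1 + h / σ * (1 + 3 * k) := by rw [e1]; ring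
      _ ≤ 1 + 1 * (1 + 3 * k) := by gcongr
      _ = _ := by ring
  have e3 : (σ ^ 2 * vb * (h + 3 * d)) ^ (1 - 1 / p) =
      ((1 + 3 * k) * vb) ^ (1 - 1 / p) * (σ ^ 2 * h) ^ (1 - 1 / p) := by
    rw [← Real.mul_rpow (by positivity) (by positivity), e1]
    congr 1; ring
  -- With `σ = h^{1/(1+α)}` both sides are powers of `h`, and the exponents agree.
  have e4 : h * (σ ^ 2 * h) ^ (1 - 1 / p) =
      h ^ ((1 + 2 * α) / (p * (1 + α)) * (p - (3 + α) / (1 + 2 * α))) * σ ^ 3 := by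
    rw [← Real.rpow_natCast σ 2, ← Real.rpow_natCast σ 3, hσdef, ← Real.rpow_mul hpos.le,
      ← Real.rpow_mul hpos.le, ← Real.rpow_add hpos]
    nth_rewrite 3 [← Real.rpow_one h]
    nth_rewrite 1 [← Real.rpow_one h]
    rw [← Real.rpow_add hpos, ← Real.rpow_mul hpos.le, ← Real.rpow_add hpos]
    congr 1
    have : 1 + α ≠ 0 := by positivity
    have : 1 + 2 * α ≠ 0 := by positivity
    have : p ≠ 0 := by positivity
    push_cast
    field_simp
    ring
  refine le_of_mul_le_mul_right ?_ (show 0 < σ ^ 3 by positivity)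
  calc _ ≤ C * (h + 3 * d) * (1 + (h + 3 * d) / σ) *
        ∫ z in R '' zone h d σ ∩ (Ω \ closure S), ‖Du z‖ := key
    _ ≤ C * (h + 3 * d) * (2 + 3 * k) * (N * (σ ^ 2 * vb * (h + 3 * d)) ^ (1 - 1 / p)) := by
        gcongr
    _ = C * (1 + 3 * k) * (2 + 3 * k) * ((1 + 3 * k) * vb) ^ (1 - 1 / p) * N *
        (h * (σ ^ 2 * h) ^ (1 - 1 / p)) := by rw [e3, e1]; ring
    _ = _ := by rw [e4]; ring

theorem speed_bound_C1 (Ω S₀ : Set E3) (hΩ : IsDomain3 Ω) (hS₀ : IsDomain3 S₀)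
    (hS₀b : Bornology.IsBounded S₀) (α p k σ₀ : ℝ) (hα : 0 < α) (hp : 1 ≤ p)
    (hΩ1 : UniformlyC1 α k σ₀ Ω) (hS1 : UniformlyC1 α k σ₀ S₀) :
    ∃ H₀ Cw c₀ : ℝ, 0 < H₀ ∧ 0 < Cw ∧ 0 < c₀ ∧
        ∀ (T : ℝ) (us om xs : ℝ → E3) (X : ℝ → E3 → E3)
          (u : ℝ → E3 → E3) (Du : ℝ → E3 → E3 →L[ℝ] E3) (S : ℝ → Set E3) (h : ℝ → ℝ),
          0 < T →
          IsRigidMotion Ω S₀ T us om xs X →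
          (∀ t, S t = X t '' S₀) →
          (∀ t, h t = setDist (S t) (frontier Ω)) →
          InBodySpace Ω S T (ENNReal.ofReal p) us om xs u Du →
          (∃ L : ℝ≥0, LipschitzOnWith L h {t ∈ Ico 0 T | h t < H₀}) ∧
          ∀ᵐ t ∂(volume.restrict (Ioo 0 T)), h t < H₀ →
            DifferentiableAt ℝ h t ∧
            ∀ R : E3 ≃ᵃⁱ[ℝ] E3, IsGapFrame Ω (S t) (h t) R →
              |deriv h t| ≤
                Cw * h t ^ ((1 + 2 * α) / (p * (1 + α)) * (p - (3 + α) / (1 + 2 * α))) *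
                  (eLpNorm (Du t) (ENNReal.ofReal p) (volume.restrict
                    (R '' cyl k α (h t) (c₀ * h t ^ (1 / (1 + α))) ∩
                      (Ω \ closure (S t))))).toReal := by
  have hσ₀ : 0 < σ₀ := hΩ1.2.1
  obtain ⟨C, hC, hbound⟩ := exists_speed_bound_C1 (σ₀ := σ₀) hα hp hΩ1.1
  -- The threshold makes `h < 1` and `2 h < σ₀ ^ (1 + α)`, so that `2 d` stays below the height `k
  -- σ₀ ^ (1 + α)` of the local coordinates.
  refine ⟨min 1 (σ₀ ^ (1 + α) / 2), C, 1, by positivity, hC, one_pos, ?_⟩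
  intro T us om xs X u Du S h hT hX hS hh hu
  obtain ⟨⟨L, hL⟩, A, hA, hder⟩ := hX.gap hS₀ hS₀b hS hh
  refine ⟨⟨L, hL.mono fun t ht => ht.1⟩, ?_⟩
  filter_upwards [hder, hu.mem_W10, hu.rigid, hu.div_free, ae_restrict_mem measurableSet_Ioo]
    with t ⟨h1, h2, h3⟩ h4 h5 h6 ht hlt
  refine ⟨h1, fun R hR => ?_⟩
  have hnn : 0 ≤ h t := by rw [hh]; exact setDist_nonneg _ _
  rcases hnn.eq_or_lt with h0 | hpos
  · rw [h2 h0.symm, abs_zero]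
    positivity
  · rw [h3 R hR hpos, one_mul]
    have ht' := Ioo_subset_Ico_self ht
    have hlt' := lt_min_iff.1 hlt
    refine hbound Ω (S t) (u t) (Du t) _ _ _ _ R hΩ.1 ?_ ?_ hΩ1 ?_ h4 h5 h6 hpos hlt'.1
      (by linarith [hlt'.2]) (hh t) hR
    · rw [hA t ht']
      exact (A t).toHomeomorph.isOpenMap _ hS₀.1
    · rw [hS]; exact hX.inside t ht'
    · rw [hA t ht']; exact hS1.image (A t)

end

/-! ### The fluid channel and integration by parts up to its walls -/

noncomputable section

/-- A local graph function agrees near the origin with a globally defined one. -/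
theorem IsGraphFn.exists_extension {K σ₀ σ : ℝ} {g : E2 → ℝ} (hg : IsGraphFn K σ₀ g) (hK : 0 ≤ K)
    (hσ : 0 < σ) (hσσ : σ ≤ σ₀) : ∃ f : E2 → ℝ, ContDiff ℝ 1 f ∧ (∀ y, |f y| ≤ K * ‖y‖ ^ 2) ∧
      (∀ y, |f y - f (-y)| ≤ 2 * K * ‖y‖ ^ 3) ∧ ∀ y, ‖y‖ < 3 / 4 * σ → f y = g y := by
  -- The cutoff equals one for `|y| ≤ 3σ/4`, beyond the support `|y| ≤ σ/2` of the test functions,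
  -- and vanishes from `7σ/8 < σ₀` on. It is even, so the bound for the odd part survives
  -- multiplication.
  let θ : ContDiffBump (0 : E2) :=
    { rIn := 3 / 4 * σ, rOut := 7 / 8 * σ, rIn_pos := by positivity, rIn_lt_rOut := by linarith }
  have θ0 : ∀ y : E2, 7 / 8 * σ ≤ ‖y‖ → θ y = 0 := fun y hy =>
    θ.zero_of_le_dist (by simpa [θ] using hy)
  have θ1 : ∀ y : E2, ‖y‖ ≤ 3 / 4 * σ → θ y = 1 := fun y hy =>
    θ.one_of_mem_closedBall (by simpa [θ] using hy)
  have hneg : ∀ y : E2, θ (-y) = θ y := fun y => θ.neg y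
  have hcase : ∀ y : E2, θ y = 0 ∨ y ∈ Metric.ball (0 : E2) σ₀ := fun y => by
    by_cases h : 7 / 8 * σ ≤ ‖y‖
    · exact Or.inl (θ0 y h)
    · right; rw [mem_ball_zero_iff]; linarith
  refine ⟨fun y => θ y * g y, ?_, fun y => ?_, fun y => ?_, fun y hy => ?_⟩
  · rw [contDiff_iff_contDiffAt]
    intro y
    by_cases h : ‖y‖ < σ₀
    · exact θ.contDiff.contDiffAt.mul
        (hg.contDiffOn.contDiffAt (Metric.isOpen_ball.mem_nhds (by simpa using h)))
    · refine contDiffAt_const (c := (0 : ℝ)) |>.congr_of_eventuallyEq ?_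
      filter_upwards [continuous_norm.continuousAt.eventually_const_lt
        (show 7 / 8 * σ < ‖y‖ by linarith)] with z hz
      rw [θ0 z hz.le, zero_mul]
  · rcases hcase y with h | h
    · simp only [h, zero_mul, abs_zero]; positivity
    · rw [abs_mul, abs_of_nonneg θ.nonneg]
      calc θ y * |g y| ≤ 1 * |g y| := by gcongr; exact θ.le_one
        _ ≤ _ := by rw [one_mul]; exact hg.le_sq y h
  · simp only [hneg]
    rw [← mul_sub]
    rcases hcase y with h | h
    · simp only [h, zero_mul, abs_zero]; positivity
    · rw [abs_mul, abs_of_nonneg θ.nonneg]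
      calc θ y * |g y - g (-y)| ≤ 1 * |g y - g (-y)| := by gcongr; exact θ.le_one
        _ ≤ _ := by rw [one_mul]; exact hg.odd_le y h
  · simp only
    rw [θ1 y hy.le, one_mul]

theorem deriv_smoothTransition_of_one_le {x : ℝ} (hx : 1 ≤ x) :
    deriv Real.smoothTransition x = 0 :=
  IsLocalMax.deriv_eq_zero (Eventually.of_forall fun r => by
    rw [Real.smoothTransition.one_of_one_le hx]; exact Real.smoothTransition.le_one r)

theorem deriv_smoothTransition_of_nonpos {x : ℝ} (hx : x ≤ 0) :
    deriv Real.smoothTransition x = 0 :=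
  IsLocalMin.deriv_eq_zero (Eventually.of_forall fun r => by
    rw [Real.smoothTransition.zero_of_nonpos hx]; exact Real.smoothTransition.nonneg r)

/-- With `x = n q - 1` this is the term `n q` times the derivative in `dtrunc`. It is supported in
`0 ≤ x ≤ 1`, hence bounded uniformly in `n` and `q`. -/
theorem exists_deriv_smoothTransition_bound :
    ∃ C : ℝ, 0 ≤ C ∧ ∀ x, |(x + 1) * deriv Real.smoothTransition x| ≤ C := by
  have hc : Continuous fun x : ℝ => (x + 1) * deriv Real.smoothTransition x :=
    (by fun_prop : Continuous fun x : ℝ => x + 1).mul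
      (Real.smoothTransition.contDiff (n := 1).continuous_deriv (by simp))
  have hs : HasCompactSupport fun x : ℝ => (x + 1) * deriv Real.smoothTransition x :=
    HasCompactSupport.intro (isCompact_Icc (a := (0 : ℝ)) (b := 1)) fun x hx => by
      rw [mem_Icc, not_and_or, not_le, not_le] at hx
      rcases hx with hx | hx
      · rw [deriv_smoothTransition_of_nonpos hx.le, mul_zero]
      · rw [deriv_smoothTransition_of_one_le hx.le, mul_zero]
  obtain ⟨C, hC⟩ := hs.exists_bound_of_continuous hc
  exact ⟨C, (norm_nonneg _).trans (hC 0), hC⟩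

/-- A smooth truncation of the identity near `0`. -/
def trunc (n : ℕ) (q : ℝ) : ℝ := q * Real.smoothTransition (n * q - 1)

/-- The derivative of `trunc`. -/
def dtrunc (n : ℕ) (q : ℝ) : ℝ :=
  Real.smoothTransition (n * q - 1) + (n * q) * deriv Real.smoothTransition (n * q - 1)

theorem hasDerivAt_trunc (n : ℕ) (q : ℝ) : HasDerivAt (trunc n) (dtrunc n q) q := by
  have h1 : HasDerivAt Real.smoothTransition (deriv Real.smoothTransition (n * q - 1))
      (n * q - 1) :=
    ((Real.smoothTransition.contDiff (n := 1)).differentiable (by simp) _).hasDerivAt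
  have h2 : HasDerivAt (fun q : ℝ => (n : ℝ) * q - 1) n q := by
    simpa using ((hasDerivAt_id q).const_mul (n : ℝ)).sub_const 1
  have h3 := (hasDerivAt_id q).mul (h1.comp q h2)
  refine h3.congr_deriv ?_
  simp only [id, dtrunc, Function.comp]
  ring

theorem contDiff_trunc (n : ℕ) : ContDiff ℝ 1 (trunc n) :=
  contDiff_id.mul (Real.smoothTransition.contDiff.comp (by fun_prop))

theorem trunc_eq_zero {n : ℕ} {q : ℝ} (h : n * q ≤ 1) : trunc n q = 0 := by
  rw [trunc, Real.smoothTransition.zero_of_nonpos (by linarith), mul_zero]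

theorem abs_trunc_le (n : ℕ) (q : ℝ) : |trunc n q| ≤ |q| := by
  rw [trunc, abs_mul, abs_of_nonneg (Real.smoothTransition.nonneg _)]
  exact mul_le_of_le_one_right (abs_nonneg _) (Real.smoothTransition.le_one _)

theorem exists_dtrunc_bound : ∃ C : ℝ, 0 ≤ C ∧ ∀ n q, |dtrunc n q| ≤ C := by
  obtain ⟨C, hC, h⟩ := exists_deriv_smoothTransition_bound
  refine ⟨1 + C, by positivity, fun n q => (abs_add_le _ _).trans (add_le_add ?_ ?_)⟩
  · rw [abs_of_nonneg (Real.smoothTransition.nonneg _)]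
    exact Real.smoothTransition.le_one _
  · simpa using h (n * q - 1)

theorem eventually_two_le_mul {q : ℝ} (hq : 0 < q) : ∀ᶠ n : ℕ in atTop, 2 ≤ n * q :=
  (tendsto_natCast_atTop_atTop.atTop_mul_const hq).eventually_ge_atTop 2

theorem tendsto_trunc {q : ℝ} (hq : 0 < q) : Tendsto (fun n => trunc n q) atTop (𝓝 q) :=
  tendsto_const_nhds.congr' ((eventually_two_le_mul hq).mono fun n hn => by
    change q = trunc n q
    rw [trunc, Real.smoothTransition.one_of_one_le (by linarith), mul_one])

theorem tendsto_dtrunc {q : ℝ} (hq : 0 < q) : Tendsto (fun n => dtrunc n q) atTop (𝓝 1) :=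
  tendsto_const_nhds.congr' ((eventually_two_le_mul hq).mono fun n hn => by
    change 1 = dtrunc n q
    rw [dtrunc, Real.smoothTransition.one_of_one_le (by linarith),
      deriv_smoothTransition_of_one_le (by linarith), mul_zero, add_zero])

/-- The fluid region `β(x') < x₃ < h + μ(x')` of the gap. -/
def channel (h σ : ℝ) (β μ : E2 → ℝ) : Set E3 :=
  {x | ‖horiz x‖ < 3 / 4 * σ ∧ β (horiz x) < x 2 ∧ x 2 < h + μ (horiz x)}

/-- The fluid part of the gap is the region between two graphs, and the gradient has a weak vertical
derivative there. -/
structure GapChannel (h d σ K : ℝ) (B : Set E3) (G : Fin 3 → Fin 3 → E3 → ℝ)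
    (H : Fin 2 → E3 → ℝ) (β μ : E2 → ℝ) : Prop where
  K_nonneg : 0 ≤ K
  K_le : K * σ ^ 2 ≤ d
  β_contDiff : ContDiff ℝ 1 β
  μ_contDiff : ContDiff ℝ 1 μ
  β_le : ∀ y, |β y| ≤ K * ‖y‖ ^ 2
  μ_le : ∀ y, |μ y| ≤ K * ‖y‖ ^ 2
  β_odd : ∀ y, |β y - β (-y)| ≤ 2 * K * ‖y‖ ^ 3
  μ_odd : ∀ y, |μ y - μ (-y)| ≤ 2 * K * ‖y‖ ^ 3
  body : ∀ x : E3, ‖horiz x‖ < 3 / 4 * σ → -d < x 2 → x 2 < h + 2 * d →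
    (x ∈ B ↔ h + μ (horiz x) < x 2)
  below : ∀ x : E3, ‖horiz x‖ < 3 / 4 * σ → -d < x 2 → x 2 ≤ β (horiz x) →
    ∀ i j, G i j x = 0
  β_le_μ : ∀ y, ‖y‖ < 3 / 4 * σ → β y ≤ h + μ y
  H_int : ∀ j, IntegrableOn (H j) (channel h σ β μ)
  weak : ∀ ψ : E3 → ℝ, ContDiff ℝ 1 ψ → HasCompactSupport ψ → tsupport ψ ⊆ channel h σ β μ →
    ∀ j : Fin 2, ∫ x in channel h σ β μ, fderiv ℝ ψ x (ev 2) * G j.castSucc 2 x =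
      -∫ x in channel h σ β μ, ψ x * H j x

namespace GapChannel

variable {h d σ K : ℝ} {B : Set E3} {U : Fin 3 → E3 → ℝ} {G : Fin 3 → Fin 3 → E3 → ℝ}
  {Γ : E3 → ℝ} {V : Fin 3 → ℝ} {M : Fin 3 → Fin 3 → ℝ} {H : Fin 2 → E3 → ℝ} {β μ : E2 → ℝ}

theorem isOpen_channel (hβ : Continuous β) (hμ : Continuous μ) : IsOpen (channel h σ β μ) := by
  have h2 : Continuous fun x : E3 => x 2 := by fun_prop
  exact (isOpen_lt continuous_horiz.norm continuous_const).inter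
    ((isOpen_lt (hβ.comp continuous_horiz) h2).inter
      (isOpen_lt h2 (continuous_const.add (hμ.comp continuous_horiz))))

theorem height_bound (C : GapChannel h d σ K B G H β μ) {y : E2}
    (hy : ‖y‖ < 3 / 4 * σ) : |β y| ≤ 9 / 16 * d ∧ |μ y| ≤ 9 / 16 * d := by
  have h1 : K * ‖y‖ ^ 2 ≤ 9 / 16 * d := by
    calc K * ‖y‖ ^ 2 ≤ K * (3 / 4 * σ) ^ 2 := by
          have := C.K_nonneg
          gcongr
      _ = 9 / 16 * (K * σ ^ 2) := by ring
      _ ≤ _ := by linarith [C.K_le]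
  exact ⟨(C.β_le y).trans h1, (C.μ_le y).trans h1⟩

theorem channel_subset_zone (C : GapChannel h d σ K B G H β μ) (hσ : 0 < σ) (hd : 0 < d) :
    channel h σ β μ ⊆ zone h d σ := by
  rintro x ⟨h1, h2, h3⟩
  obtain ⟨b1, b2⟩ := C.height_bound h1
  rw [abs_le] at b1 b2
  exact ⟨by linarith, by linarith, by linarith⟩

/-- Integration by parts in the vertical direction with a profile that vanishes on the walls. -/
theorem integral_profile (C : GapChannel h d σ K B G H β μ) (hσ : 0 < σ) (hd : 0 < d)
    (hG : ∀ i j, LocallyIntegrable (G i j)) {η : E2 → ℝ} (hη : ContDiff ℝ 1 η)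
    (η0 : ∀ y, σ / 2 ≤ ‖y‖ → η y = 0) (j : Fin 2) :
    ∫ x in channel h σ β μ, η (horiz x) * ((β (horiz x) + (h + μ (horiz x))) / 2 - x 2) *
        G j.castSucc 2 x =
      -∫ x in channel h σ β μ,
        η (horiz x) * ((x 2 - β (horiz x)) * (h + μ (horiz x) - x 2) / 2) * H j x := by
  set W := channel h σ β μ with hW
  have hWo : IsOpen W := isOpen_channel C.β_contDiff.continuous C.μ_contDiff.continuous
  have hWz : W ⊆ zone h d σ := C.channel_subset_zone hσ hd
  let q : E3 → ℝ := fun x => (x 2 - β (horiz x)) * (h + μ (horiz x) - x 2) / 2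
  let dq : E3 → ℝ := fun x => (β (horiz x) + (h + μ (horiz x))) / 2 - x 2
  have c2 : ContDiff ℝ 1 fun x : E3 => x 2 :=
    (EuclideanSpace.proj (2 : Fin 3) : E3 →L[ℝ] ℝ).contDiff
  have cβ : ContDiff ℝ 1 fun x : E3 => β (horiz x) := C.β_contDiff.comp horizL.contDiff
  have cμ : ContDiff ℝ 1 fun x : E3 => μ (horiz x) := C.μ_contDiff.comp horizL.contDiff
  have cη : ContDiff ℝ 1 fun x : E3 => η (horiz x) := hη.comp horizL.contDiff
  have cq : ContDiff ℝ 1 q := ((c2.sub cβ).mul ((contDiff_const.add cμ).sub c2)).div_const 2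
  have cdq : Continuous dq :=
    ((cβ.continuous.add (continuous_const.add cμ.continuous)).div_const 2).sub c2.continuous
  have hqpos : ∀ x ∈ W, 0 < q x := fun x hx => by
    have h1 := hx.2.1
    have h2 := hx.2.2
    exact div_pos (mul_pos (by linarith) (by linarith)) two_pos
  -- The profile `q` vanishes on the walls but does not have compact support in the open channel, as
  -- the weak derivative requires. Truncation where `q ≤ 1 / n` repairs this. Since the derivatives
  -- `dtrunc` are bounded uniformly in `n`, dominated convergence removes the truncation.
  let ψ : ℕ → E3 → ℝ := fun n x => η (horiz x) * trunc n (q x)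
  have cψ : ∀ n, ContDiff ℝ 1 (ψ n) := fun n => cη.mul ((contDiff_trunc n).comp cq)
  have hsupp : ∀ n, tsupport (ψ n) ⊆ W := by
    intro n
    have hcl : IsClosed {x : E3 | ‖horiz x‖ ≤ σ / 2 ∧ 1 ≤ n * q x} :=
      (isClosed_le continuous_horiz.norm continuous_const).inter
        (isClosed_le continuous_const (continuous_const.mul cq.continuous))
    refine (closure_minimal (fun x hx => ?_) hcl).trans ?_
    · constructor
      · by_contra h1
        exact hx (by simp only [ψ, η0 _ (not_le.1 h1).le, zero_mul])
      · by_contra h1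
        exact hx (by simp only [ψ, trunc_eq_zero (not_le.1 h1).le, mul_zero])
    · rintro x ⟨h1, h2⟩
      have h3 : ‖horiz x‖ < 3 / 4 * σ := by linarith
      have h4 : 0 < q x := by
        by_contra h5
        have : (n : ℝ) * q x ≤ 0 := mul_nonpos_of_nonneg_of_nonpos n.cast_nonneg (not_lt.1 h5)
        linarith
      have h5 : 0 < (x 2 - β (horiz x)) * (h + μ (horiz x) - x 2) := by
        have : q x = (x 2 - β (horiz x)) * (h + μ (horiz x) - x 2) / 2 := rfl
        linarith
      have h6 := C.β_le_μ _ h3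
      -- The profile is also positive if both factors are negative, that is above the upper and
      -- below the lower wall; `β ≤ h + μ` excludes this.
      rcases pos_and_pos_or_neg_and_neg_of_mul_pos h5 with h7 | h7
      · exact ⟨h3, by linarith [h7.1], by linarith [h7.2]⟩
      · linarith [h7.1, h7.2]
  have hψc : ∀ n, HasCompactSupport (ψ n) := fun n =>
    (isBounded_zone h d σ).isCompact_closure.of_isClosed_subset (isClosed_tsupport _)
      (((hsupp n).trans hWz).trans subset_closure)
  have hderiv : ∀ n x, fderiv ℝ (ψ n) x (ev 2) = η (horiz x) * (dtrunc n (q x) * dq x) := by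
    intro n x
    -- Along a vertical line `x'` is frozen, so `η`, `β` and `μ` are constants and only the
    -- quadratic profile is differentiated.
    rw [← ((cψ n).differentiable one_ne_zero x).lineDeriv_eq_fderiv]
    have hl : HasDerivAt (fun t : ℝ => ψ n (x + t • ev 2))
        (η (horiz x) * (dtrunc n (q x) * dq x)) 0 := by
      have e : (fun t : ℝ => ψ n (x + t • ev 2)) = fun t => η (horiz x) *
          trunc n ((x 2 + t - β (horiz x)) * (h + μ (horiz x) - (x 2 + t)) / 2) := by
        funext t
        have a1 : horiz (x + t • ev 2) = horiz x := by
          rw [horiz_add, horiz_smul, ev_two, horiz_e3, smul_zero, add_zero]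
        have a2 : (x + t • ev 2) 2 = x 2 + t := by simp [ev]
        simp only [ψ, q, a1, a2]
      rw [e]
      refine HasDerivAt.const_mul _ ?_
      have h1 : HasDerivAt
          (fun t : ℝ => (x 2 + t - β (horiz x)) * (h + μ (horiz x) - (x 2 + t)) / 2) (dq x) 0 := by
        have u1 : HasDerivAt (fun t : ℝ => x 2 + t - β (horiz x)) 1 0 :=
          ((hasDerivAt_id (0 : ℝ)).const_add _).sub_const _
        have u2 : HasDerivAt (fun t : ℝ => h + μ (horiz x) - (x 2 + t)) (-1) 0 :=
          ((hasDerivAt_id (0 : ℝ)).const_add _).const_sub _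
        refine ((u1.mul u2).div_const 2).congr_deriv ?_
        simp only [dq]
        ring
      have h2 := hasDerivAt_trunc n (q x)
      refine HasDerivAt.comp (0 : ℝ) (h₂ := trunc n) ?_ h1
      simpa [q] using h2
    exact hl.deriv
  have hweak := fun n => C.weak (ψ n) (cψ n) (hψc n) (hsupp n) j
  simp only [hderiv] at hweak
  obtain ⟨D, hD, hDb⟩ := exists_dtrunc_bound
  have cont : Continuous fun x : E3 => η (horiz x) * dq x := cη.continuous.mul cdq
  have cont2 : Continuous fun x : E3 => η (horiz x) * q x := cη.continuous.mul cq.continuous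
  have iG : IntegrableOn (fun x => (η (horiz x) * dq x) * G j.castSucc 2 x) W :=
    (GapFlow.integrableOn_zone_mul cont (hG _ _) h d σ).mono_set hWz
  have iH : IntegrableOn (fun x => (η (horiz x) * q x) * H j x) W := by
    obtain ⟨A, hA⟩ := (isBounded_zone h d σ).isCompact_closure.exists_bound_of_continuousOn
      cont2.continuousOn
    refine (C.H_int j).bdd_mul (c := A) cont2.aestronglyMeasurable ?_
    exact (ae_restrict_iff' hWo.measurableSet).2
      (Eventually.of_forall fun x hx => hA x (subset_closure (hWz hx)))
  have l1 : Tendsto (fun n => ∫ x in W, η (horiz x) * (dtrunc n (q x) * dq x) *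
      G j.castSucc 2 x) atTop (𝓝 (∫ x in W, η (horiz x) * dq x * G j.castSucc 2 x)) := by
    refine tendsto_integral_of_dominated_convergence
      (fun x => D * ‖η (horiz x) * dq x * G j.castSucc 2 x‖) (fun n => ?_) (iG.norm.const_mul D)
      (fun n => Eventually.of_forall fun x => ?_) ?_
    · refine AEStronglyMeasurable.mul (Continuous.aestronglyMeasurable ?_)
        (hG _ _).aestronglyMeasurable.restrict
      have : Continuous (dtrunc n) := by
        have hn : Continuous fun q : ℝ => (n : ℝ) * q := by fun_prop
        have := (Real.smoothTransition.contDiff (n := 1)).continuous_deriv (by simp)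
        exact (Real.smoothTransition.continuous.comp (hn.sub continuous_const)).add
          (hn.mul (this.comp (hn.sub continuous_const)))
      exact cη.continuous.mul ((this.comp cq.continuous).mul cdq)
    · have : η (horiz x) * (dtrunc n (q x) * dq x) * G j.castSucc 2 x =
          dtrunc n (q x) * (η (horiz x) * dq x * G j.castSucc 2 x) := by ring
      rw [this, norm_mul]
      gcongr
      exact hDb n _
    · refine (ae_restrict_iff' hWo.measurableSet).2 (Eventually.of_forall fun x hx => ?_)
      have := ((tendsto_dtrunc (hqpos x hx)).mul_const (dq x)).const_mul (η (horiz x))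
      simpa using this.mul_const (G j.castSucc 2 x)
  have l2 : Tendsto (fun n => ∫ x in W, ψ n x * H j x) atTop
      (𝓝 (∫ x in W, η (horiz x) * q x * H j x)) := by
    refine tendsto_integral_of_dominated_convergence
      (fun x => ‖η (horiz x) * q x * H j x‖) (fun n => ?_) iH.norm
      (fun n => Eventually.of_forall fun x => ?_) ?_
    · exact (cψ n).continuous.aestronglyMeasurable.mul (C.H_int j).aestronglyMeasurable
    · simp only [ψ, norm_mul]
      gcongr
      exact abs_trunc_le n _
    · refine (ae_restrict_iff' hWo.measurableSet).2 (Eventually.of_forall fun x hx => ?_)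
      exact ((tendsto_trunc (hqpos x hx)).const_mul (η (horiz x))).mul_const (H j x)
  exact tendsto_nhds_unique l1 (l2.neg.congr fun n => (hweak n).symm)

end GapChannel
end

/-! ### Contributions of the fluid and of the body to the flux -/

noncomputable section

/-- The part above `h + d` depends on the shape of the cutoff, but not on `m`; below, `Θ` is linear.
What matters is that `c₂` is independent of `m` and `e`: it later disappears against the odd
function `dzeta`. -/
theorem exists_column_integral {h d : ℝ} (hd : 0 < d) : ∃ c₂ : ℝ, ∀ m ≤ h + d, ∀ e,
    ∫ s in Ioi m, (Theta h d s - e * chi h d s) =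
      c₂ + (cutHeight h d - m) ^ 2 / 2 - e * (cutHeight h d - m) := by
  set c := cutHeight h d
  refine ⟨(∫ s in (h + d)..(h + 2 * d), Theta h d s) - (c - (h + d)) ^ 2 / 2, fun m hm e => ?_⟩
  have cT : Continuous (Theta h d) := contDiff_Theta.continuous
  have cχ : Continuous (chi h d) := continuous_chi
  have e1 : ∫ s in Ioi m, (Theta h d s - e * chi h d s) =
      ∫ s in m..(h + 2 * d), (Theta h d s - e * chi h d s) := by
    rw [intervalIntegral.integral_of_le (by linarith)]
    refine setIntegral_eq_of_subset_of_forall_sdiff_eq_zero measurableSet_Ioi Ioc_subset_Ioi_self ?_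
    rintro s ⟨hs1, hs2⟩
    have hs3 : h + 2 * d < s := by
      by_contra h3
      exact hs2 ⟨hs1, not_lt.1 h3⟩
    rw [Theta_eq_zero hd (by linarith), chi_eq_zero hd (by linarith)]
    ring
  have e2 : ∫ s in m..(h + 2 * d), chi h d s = c - m := by
    rw [← Theta_eq hd hm]; rfl
  have e3 : ∫ s in m..(h + d), Theta h d s = (c - m) ^ 2 / 2 - (c - (h + d)) ^ 2 / 2 := by
    have h1 : ∀ s ∈ uIcc m (h + d), HasDerivAt (fun s => -((c - s) ^ 2 / 2)) (Theta h d s) s := by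
      intro s hs
      rw [uIcc_of_le hm] at hs
      rw [Theta_eq hd hs.2]
      have := (((hasDerivAt_id s).const_sub c).pow 2).div_const 2 |>.neg
      refine this.congr_deriv ?_
      simp [c]
      ring
    rw [intervalIntegral.integral_eq_sub_of_hasDerivAt h1 (cT.intervalIntegrable _ _)]
    ring
  rw [e1, intervalIntegral.integral_sub (cT.intervalIntegrable _ _)
    ((cχ.intervalIntegrable _ _).const_mul e), intervalIntegral.integral_const_mul, e2,
    ← intervalIntegral.integral_add_adjacent_intervals (b := h + d)
    (cT.intervalIntegrable _ _) (cT.intervalIntegrable _ _), e3]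
  ring

theorem integrable_dzeta_mul {σ : ℝ} (hσ : 0 < σ) {f : E2 → ℝ} (hf : Continuous f) (j : Fin 2) :
    Integrable fun y => dzeta σ j y * f y := by
  have hc : HasCompactSupport (dzeta σ j) := HasCompactSupport.intro
    (isCompact_closedBall 0 (σ / 2)) fun y hy => dzeta_eq_zero hσ j (not_le.1 (by simpa using hy)).le
  exact ((contDiff_dzeta (n := 0) j).continuous.mul hf).integrable_of_hasCompactSupport hc.mul_right

/-- Integrals against `dzeta` only see the odd part. -/
theorem abs_integral_dzeta_mul_le {C₁ : ℝ} (hC₁ : ∀ σ > 0, ∀ j y, |dzeta σ j y| ≤ C₁ / σ) {σ : ℝ}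
    (hσ : 0 < σ) {f : E2 → ℝ} (hf : Continuous f) {D : ℝ}
    (hD : ∀ y, ‖y‖ < σ / 2 → |f y - f (-y)| ≤ 2 * D) (j : Fin 2) :
    |∫ y, dzeta σ j y * f y| ≤ C₁ * (volume (Metric.ball (0 : E2) 1)).toReal * σ * D := by
  have hD0 : 0 ≤ D := by
    have := (abs_nonneg _).trans (hD 0 (by simpa using hσ))
    linarith
  have hC0 : 0 ≤ C₁ := by
    have := (abs_nonneg _).trans (hC₁ 1 one_pos 0 0)
    simpa using this
  -- Substitution of `-y` for `y`. It follows that `f` may be replaced by half of `f y - f (-y)`.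
  have e1 : ∫ y, dzeta σ j y * f (-y) = -∫ y, dzeta σ j y * f y := by
    have := integral_neg_eq_self (fun y : E2 => dzeta σ j y * f (-y)) volume
    simp only [dzeta_neg, neg_neg, neg_mul, integral_neg] at this
    linarith
  have e2 : ∫ y, dzeta σ j y * f y = (∫ y, dzeta σ j y * (f y - f (-y))) / 2 := by
    simp_rw [mul_sub]
    rw [integral_sub (integrable_dzeta_mul hσ hf j)
      (integrable_dzeta_mul hσ (f := fun y => f (-y)) (hf.comp continuous_neg) j), e1]
    ring
  have e3 : ∫ y, dzeta σ j y * (f y - f (-y)) =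
      ∫ y in Metric.ball (0 : E2) σ, dzeta σ j y * (f y - f (-y)) := by
    refine (setIntegral_eq_integral_of_forall_compl_eq_zero fun y hy => ?_).symm
    rw [dzeta_eq_zero hσ j, zero_mul]
    rw [mem_ball_zero_iff, not_lt] at hy
    linarith
  have h4 : |∫ y in Metric.ball (0 : E2) σ, dzeta σ j y * (f y - f (-y))| ≤
      C₁ / σ * (2 * D) * volume.real (Metric.ball (0 : E2) σ) := by
    rw [← Real.norm_eq_abs]
    refine norm_setIntegral_le_of_norm_le_const measure_ball_lt_top fun y _ => ?_
    rw [norm_mul, Real.norm_eq_abs, Real.norm_eq_abs]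
    by_cases hy : ‖y‖ < σ / 2
    · have := hC₁ σ hσ j y
      have := hD y hy
      gcongr
    · rw [dzeta_eq_zero hσ j (not_lt.1 hy), abs_zero, zero_mul]
      positivity
  have h5 : volume.real (Metric.ball (0 : E2) σ) =
      σ ^ 2 * (volume (Metric.ball (0 : E2) 1)).toReal := by
    rw [Measure.real, Measure.addHaar_ball _ _ hσ.le, finrank_euclideanSpace, Fintype.card_fin,
      ENNReal.toReal_mul, ENNReal.toReal_ofReal (by positivity)]
  rw [e2, e3, abs_div, abs_two, div_le_iff₀ two_pos]
  refine h4.trans_eq ?_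
  rw [h5]
  field_simp

namespace GapChannel

variable {h d σ K : ℝ} {B : Set E3} {U : Fin 3 → E3 → ℝ} {G : Fin 3 → Fin 3 → E3 → ℝ}
  {Γ : E3 → ℝ} {V : Fin 3 → ℝ} {M : Fin 3 → Fin 3 → ℝ} {H : Fin 2 → E3 → ℝ} {β μ : E2 → ℝ}

/-- Splitting of an integral over the gap into the fluid and the body parts. -/
theorem integral_zone_eq (C : GapChannel h d σ K B G H β μ) (F : GapFlow h d σ B U G Γ V M)
    {f : E3 → ℝ} (hf : Continuous f) (f0 : ∀ x : E3, σ / 2 ≤ ‖horiz x‖ → f x = 0) (i j : Fin 3) :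
    ∫ x in zone h d σ, f x * G i j x =
      (∫ x in channel h σ β μ, f x * G i j x) + M i j * ∫ x in zone h d σ ∩ B, f x := by
  have hσ := F.σ_pos
  have hd := F.d_pos
  have hZ : MeasurableSet (zone h d σ) := (isOpen_zone h d σ).measurableSet
  have hcl : MeasurableSet (closure B) := isClosed_closure.measurableSet
  have hWo : IsOpen (channel h σ β μ) :=
    isOpen_channel C.β_contDiff.continuous C.μ_contDiff.continuous
  rw [← integral_inter_add_sdiff hcl (GapFlow.integrableOn_zone_mul hf (F.G_int i j) h d σ), add_comm]
  congr 1
  · rw [← integral_indicator (hZ.diff hcl), ← integral_indicator hWo.measurableSet]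
    congr 1
    funext x
    by_cases h0 : σ / 2 ≤ ‖horiz x‖
    · have : f x * G i j x = 0 := by rw [f0 x h0, zero_mul]
      have hz : ∀ s : Set E3, s.indicator (fun x => f x * G i j x) x = 0 := fun s =>
        indicator_apply_eq_zero.2 fun _ => this
      rw [hz, hz]
    have h1 : ‖horiz x‖ < 3 / 4 * σ := by linarith
    obtain ⟨b1, b2⟩ := C.height_bound h1
    rw [abs_le] at b1 b2
    by_cases hx : x ∈ channel h σ β μ
    · have hxZ := C.channel_subset_zone hσ hd hx
      have : x ∉ closure B := by
        intro hxc
        obtain ⟨z, hz1, hz2⟩ := mem_closure_iff.1 hxc _ hWo hx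
        have hzZ := C.channel_subset_zone hσ hd hz1
        have := (C.body z hz1.1 hzZ.2.1 hzZ.2.2).1 hz2
        linarith [hz1.2.2]
      rw [indicator_of_mem hx, indicator_of_mem (show x ∈ zone h d σ \ closure B from ⟨hxZ, this⟩)]
    · rw [indicator_of_notMem hx]
      by_cases hx2 : x ∈ zone h d σ \ closure B
      · rw [indicator_of_mem hx2]
        obtain ⟨hxZ, hxB⟩ := hx2
        by_cases h3 : x 2 ≤ β (horiz x)
        · rw [C.below x h1 hxZ.2.1 h3, mul_zero]
        · exfalso
          have h4 : h + μ (horiz x) ≤ x 2 := by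
            by_contra h4
            exact hx ⟨h1, not_le.1 h3, not_le.1 h4⟩
          -- A point on the upper wall or above it is a limit of points shifted upwards, which
          -- belong to `B`. The index is shifted by `N` so that the whole sequence stays in the open
          -- zone.
          refine hxB (mem_closure_iff_seq_limit.2 ?_)
          have hlim : Tendsto (fun n : ℕ => x + (1 / ((n : ℝ) + 1)) • e3) atTop (𝓝 x) := by
            have := (tendsto_one_div_add_atTop_nhds_zero_nat (𝕜 := ℝ)).smul_const e3
            simpa using this.const_add x
          have hev := hlim.eventually ((isOpen_zone h d σ).mem_nhds hxZ)
          obtain ⟨N, hN⟩ := eventually_atTop.1 hev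
          refine ⟨fun n => x + (1 / (((n + N : ℕ) : ℝ) + 1)) • e3, fun n => ?_,
            hlim.comp (tendsto_add_atTop_nat N)⟩
          have hz := hN (n + N) (Nat.le_add_left _ _)
          have a1 : horiz (x + (1 / (((n + N : ℕ) : ℝ) + 1)) • e3) = horiz x := by
            rw [horiz_add, horiz_smul, horiz_e3, smul_zero, add_zero]
          have a2 : (x + (1 / (((n + N : ℕ) : ℝ) + 1)) • e3) 2 =
              x 2 + 1 / (((n + N : ℕ) : ℝ) + 1) := by simp [e3]
          have a3 : 0 < 1 / (((n + N : ℕ) : ℝ) + 1) := by positivity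
          refine (C.body _ (by rw [a1]; exact h1) hz.2.1 hz.2.2).2 ?_
          rw [a1, a2]
          linarith
      · rw [indicator_of_notMem hx2]
  · have hae : (zone h d σ ∩ closure B : Set E3) =ᵐ[volume] (zone h d σ ∩ B : Set E3) :=
      (EventuallyEq.refl _ _).inter (closure_ae_eq_of_null_frontier F.frontier_B)
    rw [setIntegral_congr_set hae, ← integral_const_mul]
    refine setIntegral_congr_ae (hZ.inter F.isOpen_B.measurableSet) ?_
    filter_upwards [F.G_rigid] with x hx hxB
    rw [hx hxB.2, mul_comm]

/-- The contribution of the body to the flux. -/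
theorem integral_body (C : GapChannel h d σ K B G H β μ) (F : GapFlow h d σ B U G Γ V M)
    (j : Fin 2) {E : E2 → ℝ} (hE : Continuous E)
    (hEdef : ∀ y, E y = cutHeight h d - (β y + (h + μ y)) / 2) :
    ∫ x in zone h d σ ∩ B, (dzeta σ j (horiz x) * Theta h d (x 2) -
        dzeta σ j (horiz x) * E (horiz x) * chi h d (x 2)) =
      -∫ y, dzeta σ j y * ((cutHeight h d - (h + μ y)) * (cutHeight h d - β y) / 2) := by
  have hσ := F.σ_pos
  have hd := F.d_pos
  have hh := F.h_pos
  obtain ⟨c₂, hc₂⟩ := exists_column_integral (h := h) hd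
  set c := cutHeight h d
  have hm : MeasurableSet (zone h d σ ∩ B) :=
    (isOpen_zone h d σ).measurableSet.inter F.isOpen_B.measurableSet
  let f : E2 × ℝ → ℝ := fun p => dzeta σ j p.1 *
    (Ioi (h + μ p.1)).indicator (fun s => Theta h d s - E p.1 * chi h d s) p.2
  have hfx : ∀ x : E3, (zone h d σ ∩ B).indicator (fun x => dzeta σ j (horiz x) * Theta h d (x 2) -
        dzeta σ j (horiz x) * E (horiz x) * chi h d (x 2)) x = f (horiz x, x 2) := by
    intro x
    simp only [f]
    by_cases h0 : σ / 2 ≤ ‖horiz x‖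
    · rw [dzeta_eq_zero hσ j h0, zero_mul]
      refine indicator_apply_eq_zero.2 fun _ => ?_
      rw [dzeta_eq_zero hσ j h0]
      ring
    have h1 : ‖horiz x‖ < 3 / 4 * σ := by linarith
    obtain ⟨b1, b2⟩ := C.height_bound h1
    rw [abs_le] at b1 b2
    by_cases h2 : h + μ (horiz x) < x 2
    · rw [indicator_of_mem (show x 2 ∈ Ioi (h + μ (horiz x)) from h2)]
      by_cases h3 : x 2 < h + 2 * d
      · have hxZ : x ∈ zone h d σ := ⟨by linarith, by linarith, h3⟩
        rw [indicator_of_mem (show x ∈ zone h d σ ∩ B from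
          ⟨hxZ, (C.body x h1 hxZ.2.1 hxZ.2.2).2 h2⟩)]
        ring
      · rw [indicator_of_notMem (fun hx => h3 hx.1.2.2), Theta_eq_zero hd (by linarith),
          chi_eq_zero hd (by linarith)]
        ring
    · rw [indicator_of_notMem (show x 2 ∉ Ioi (h + μ (horiz x)) from h2),
        indicator_of_notMem (fun hx => h2 ((C.body x h1 hx.1.2.1 hx.1.2.2).1 hx.2)), mul_zero]
  have hcont : Continuous fun x : E3 => dzeta σ j (horiz x) * Theta h d (x 2) -
        dzeta σ j (horiz x) * E (horiz x) * chi h d (x 2) := by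
    have c2 : Continuous fun x : E3 => x 2 := by fun_prop
    have c1 : Continuous fun x : E3 => dzeta σ j (horiz x) :=
      (contDiff_dzeta (n := 0) j).continuous.comp continuous_horiz
    exact (c1.mul (contDiff_Theta.continuous.comp c2)).sub
      ((c1.mul (hE.comp continuous_horiz)).mul (continuous_chi.comp c2))
  have hint : Integrable fun x : E3 => f (horiz x, x 2) := by
    rw [← funext hfx, integrable_indicator_iff hm]
    exact (GapFlow.integrableOn_zone hcont.locallyIntegrable h d σ).mono_set inter_subset_left
  have hint2 : Integrable f (volume.prod volume) :=
    (measurePreserving_split.integrable_comp_emb splitHomeo.measurableEmbedding).1 hint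
  rw [← integral_indicator hm, funext hfx, integral_split, Measure.volume_eq_prod,
    integral_prod _ hint2]
  -- The column integral with `m = h + μ` and `e = E`: for this `E` the quadratic polynomial factors
  -- into `-(c - (h + μ)) (c - β) / 2`.
  have inner : ∀ y, ∫ s, f (y, s) =
      dzeta σ j y * c₂ - dzeta σ j y * ((c - (h + μ y)) * (c - β y) / 2) := by
    intro y
    simp only [f]
    rw [integral_const_mul, integral_indicator measurableSet_Ioi]
    by_cases h0 : σ / 2 ≤ ‖y‖
    · rw [dzeta_eq_zero hσ j h0]; ring
    obtain ⟨b1, b2⟩ := C.height_bound (show ‖y‖ < 3 / 4 * σ by linarith)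
    rw [abs_le] at b1 b2
    rw [hc₂ _ (by linarith), hEdef]
    ring
  simp_rw [inner]
  have i1 : Integrable fun y => dzeta σ j y * c₂ := integrable_dzeta_mul hσ continuous_const j
  have i2 : Integrable fun y => dzeta σ j y * ((c - (h + μ y)) * (c - β y) / 2) :=
    integrable_dzeta_mul hσ (((continuous_const.sub
      (continuous_const.add C.μ_contDiff.continuous)).mul
      (continuous_const.sub C.β_contDiff.continuous)).div_const 2) j
  have z : ∫ y, dzeta σ j y * c₂ = 0 := by
    have := integral_neg_eq_self (fun y : E2 => dzeta σ j y * c₂) volume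
    simp only [dzeta_neg, neg_mul, integral_neg] at this
    linarith
  rw [integral_sub i1 i2, z, zero_sub]

end GapChannel
end

/-! ### Second order bound for the normal velocity -/

noncomputable section

/-- The horizontal velocity of the body is controlled by the gradient in the gap. -/
theorem GapFlow.horizontal_bound {h d σ : ℝ} {B : Set E3} {U : Fin 3 → E3 → ℝ}
    {G : Fin 3 → Fin 3 → E3 → ℝ} {Γ : E3 → ℝ} {V : Fin 3 → ℝ} {M : Fin 3 → Fin 3 → ℝ}
    (F : GapFlow h d σ B U G Γ V M) (i : Fin 3) :
    |V i| * (σ ^ 2 * mass0) ≤ gapMass h d σ B Γ + |M i 2| * ((h + 3 * d) *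
      (σ ^ 2 * (mass0 + (volume (Metric.ball (0 : E2) 1)).toReal))) := by
  have hd := F.d_pos
  have hσ := F.σ_pos
  have hh := F.h_pos
  set vb := (volume (Metric.ball (0 : E2) 1)).toReal
  have cζ : ContDiff ℝ 1 (zeta σ) := contDiff_zeta (n := 1)
  have cχ : ContDiff ℝ 1 (chi h d) := contDiff_chi (n := 1)
  have ζ0 : ∀ y, σ / 2 ≤ ‖y‖ → zeta σ y = 0 := fun y hy => zeta_eq_zero hσ hy
  -- The field vanishes below the gap, so the vertical derivative controls its mean on the body,
  -- which is `V i` plus a contribution of the rotation.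
  have h1 := F.green_vertical cζ cχ ζ0 (fun s hs => chi_eq_zero hd hs) i
  rw [F.integral_trace cζ.continuous ζ0 i, integral_coord_mul_zeta, integral_coord_mul_zeta,
    integral_zeta hσ] at h1
  have hc : Continuous fun x : E3 => zeta σ (horiz x) * chi h d (x 2) :=
    (contDiff_mul_split cζ cχ).continuous
  have hA : ∀ x ∈ zone h d σ, |zeta σ (horiz x) * chi h d (x 2)| ≤ 1 := fun x _ => by
    rw [abs_mul, abs_of_nonneg (zeta_nonneg _), abs_of_nonneg (chi_nonneg _)]
    exact mul_le_one₀ (zeta_le_one _) (chi_nonneg _) (chi_le_one _)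
  have h2 := F.abs_integral_sub_le hc hA i 2
  have hfin : volume (zone h d σ) < ⊤ := (isBounded_zone h d σ).measure_lt_top
  have h3 : |∫ x in zone h d σ ∩ B, zeta σ (horiz x) * chi h d (x 2)| ≤ σ ^ 2 * vb * (h + 3 * d) := by
    have hvol : volume.real (zone h d σ) = σ ^ 2 * vb * (h + 3 * d) := by
      rw [Measure.real, volume_zone hσ.le, ENNReal.toReal_ofReal (by positivity)]
    rw [← hvol, ← Real.norm_eq_abs]
    refine (norm_setIntegral_le_of_norm_le_const (C := 1)
      ((measure_mono inter_subset_left).trans_lt hfin)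
      fun x hx => by rw [Real.norm_eq_abs]; exact hA x hx.1).trans ?_
    rw [one_mul]
    exact measureReal_mono inter_subset_left hfin.ne
  obtain ⟨hc1, hc2⟩ := cutHeight_mem (h := h) hd
  have h4 : |cutHeight h d - h| ≤ h + 3 * d := by
    rw [abs_of_nonneg (by linarith)]
    linarith
  have hm0 := mass0_pos
  set I := ∫ x in zone h d σ, zeta σ (horiz x) * chi h d (x 2) * G i 2 x
  set J := ∫ x in zone h d σ ∩ B, zeta σ (horiz x) * chi h d (x 2)
  have h5 : V i * (σ ^ 2 * mass0) =
      (I - M i 2 * J) + (M i 2 * J - M i 2 * ((cutHeight h d - h) * (σ ^ 2 * mass0))) := by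
    linarith
  rw [← abs_of_pos (show 0 < σ ^ 2 * mass0 by positivity), ← abs_mul, h5]
  refine (abs_add_le _ _).trans (add_le_add (by simpa using h2) ?_)
  rw [← mul_sub, abs_mul]
  gcongr
  refine (abs_sub _ _).trans ?_
  rw [abs_mul, abs_of_pos (show 0 < σ ^ 2 * mass0 by positivity)]
  calc |J| + |cutHeight h d - h| * (σ ^ 2 * mass0) ≤
      σ ^ 2 * vb * (h + 3 * d) + (h + 3 * d) * (σ ^ 2 * mass0) := by gcongr
    _ = _ := by ring

namespace GapChannel

variable {h d σ K : ℝ} {B : Set E3} {U : Fin 3 → E3 → ℝ} {G : Fin 3 → Fin 3 → E3 → ℝ}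
  {Γ : E3 → ℝ} {V : Fin 3 → ℝ} {M : Fin 3 → Fin 3 → ℝ} {H : Fin 2 → E3 → ℝ} {β μ : E2 → ℝ}

/-- The decomposition of the flux into a second order term and odd moments of the profile. -/
theorem flux_decomposition (C : GapChannel h d σ K B G H β μ) (F : GapFlow h d σ B U G Γ V M)
    (j : Fin 2) {E : E2 → ℝ} (hE : ContDiff ℝ 1 E)
    (hEdef : ∀ y, E y = cutHeight h d - (β y + (h + μ y)) / 2) :
    ∫ x in zone h d σ, dzeta σ j (horiz x) * Theta h d (x 2) * G j.castSucc 2 x =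
      -(∫ x in channel h σ β μ, dzeta σ j (horiz x) *
          ((x 2 - β (horiz x)) * (h + μ (horiz x) - x 2) / 2) * H j x) -
        M j.castSucc 2 * (∫ y, dzeta σ j y *
          ((cutHeight h d - (h + μ y)) * (cutHeight h d - β y) / 2)) +
        ((V j.castSucc + M j.castSucc 2 * (cutHeight h d - h)) * (∫ y, dzeta σ j y * E y) +
          M j.castSucc 0 * (∫ y, y 0 * (dzeta σ j y * E y)) +
          M j.castSucc 1 * ∫ y, y 1 * (dzeta σ j y * E y)) := by
  have hσ := F.σ_pos
  have hd := F.d_pos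
  have cξ : ContDiff ℝ 1 fun y => dzeta σ j y * E y := (contDiff_dzeta (n := 1) j).mul hE
  have cχ : ContDiff ℝ 1 (chi h d) := contDiff_chi (n := 1)
  have ξ0 : ∀ y, σ / 2 ≤ ‖y‖ → dzeta σ j y * E y = 0 := fun y hy => by
    rw [dzeta_eq_zero hσ j hy, zero_mul]
  have h1 := F.green_vertical cξ cχ ξ0 (fun s hs => chi_eq_zero hd hs) j.castSucc
  rw [F.integral_trace cξ.continuous ξ0 j.castSucc] at h1
  have c1 : Continuous fun x : E3 => dzeta σ j (horiz x) * Theta h d (x 2) :=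
    (contDiff_mul_split (contDiff_dzeta (n := 1) j) contDiff_Theta).continuous
  have c2 : Continuous fun x : E3 => dzeta σ j (horiz x) * E (horiz x) * chi h d (x 2) :=
    (contDiff_mul_split cξ cχ).continuous
  have h2 := C.integral_zone_eq F (c1.sub c2) (fun x hx => by
    simp only [Pi.sub_apply, dzeta_eq_zero hσ j hx, zero_mul, sub_zero]) j.castSucc 2
  simp only [Pi.sub_apply] at h2
  rw [C.integral_body F j hE.continuous hEdef] at h2
  have hWo : IsOpen (channel h σ β μ) :=
    isOpen_channel C.β_contDiff.continuous C.μ_contDiff.continuous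
  -- In the channel `Θ = cutHeight - x₃` and `χ = 1`. The function `E` is chosen such that `Θ - E χ`
  -- is the distance below the mid-surface of the channel, the vertical derivative of the profile
  -- that vanishes on both walls.
  have h3 : ∫ x in channel h σ β μ, (dzeta σ j (horiz x) * Theta h d (x 2) -
      dzeta σ j (horiz x) * E (horiz x) * chi h d (x 2)) * G j.castSucc 2 x =
      ∫ x in channel h σ β μ, dzeta σ j (horiz x) *
        ((β (horiz x) + (h + μ (horiz x))) / 2 - x 2) * G j.castSucc 2 x := by
    refine setIntegral_congr_fun hWo.measurableSet fun x hx => ?_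
    obtain ⟨b1, b2⟩ := C.height_bound hx.1
    rw [abs_le] at b1 b2
    have hs : x 2 ≤ h + d := by linarith [hx.2.2]
    simp only [Theta_eq hd hs, chi_eq_one hd hs, hEdef]
    ring
  rw [h3, C.integral_profile hσ hd F.G_int (contDiff_dzeta (n := 1) j)
    (fun y hy => dzeta_eq_zero hσ j hy) j] at h2
  have h4 : ∫ x in zone h d σ, (dzeta σ j (horiz x) * Theta h d (x 2) -
      dzeta σ j (horiz x) * E (horiz x) * chi h d (x 2)) * G j.castSucc 2 x =
      (∫ x in zone h d σ, dzeta σ j (horiz x) * Theta h d (x 2) * G j.castSucc 2 x) -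
      ∫ x in zone h d σ, dzeta σ j (horiz x) * E (horiz x) * chi h d (x 2) * G j.castSucc 2 x := by
    rw [← integral_sub (GapFlow.integrableOn_zone_mul c1 (F.G_int _ _) h d σ)
      (GapFlow.integrableOn_zone_mul c2 (F.G_int _ _) h d σ)]
    simp only [sub_mul]
  rw [h4] at h2
  linarith

/-- The profile is of order `(h + 3d)²` and `dzeta` of order `1 / σ`, which gives the first term. In
the moments only the odd parts of `β` and `μ`, of order `K σ³`, remain; with `dzeta` on a disc of
area of order `σ²` they contribute `K σ⁴` times the velocities of the body. -/
theorem speed_bound (C : GapChannel h d σ K B G H β μ) (F : GapFlow h d σ B U G Γ V M)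
    {C₁ : ℝ} (hC₁ : ∀ σ > 0, ∀ j y, |dzeta σ j y| ≤ C₁ / σ) {I W N : ℝ}
    (hI : ∀ j, ∫ x in channel h σ β μ, |H j x| ≤ I) (hW : ∀ j : Fin 2, |V j.castSucc| ≤ W)
    (hN : ∀ j : Fin 2, |M j.castSucc 2| ≤ N) :
    |V 2| * (σ ^ 2 * mass0) ≤ C₁ * (h + 3 * d) ^ 2 / σ * I +
      4 * C₁ * (volume (Metric.ball (0 : E2) 1)).toReal * K * σ ^ 4 * (W + 2 * (h + 3 * d) * N) := by
  have hσ := F.σ_pos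
  have hd := F.d_pos
  have hh := F.h_pos
  have hK := C.K_nonneg
  set vb := (volume (Metric.ball (0 : E2) 1)).toReal
  set c := cutHeight h d with hc
  obtain ⟨hc1, hc2⟩ := cutHeight_mem (h := h) hd
  rw [← hc] at hc1 hc2
  set L := h + 3 * d with hL
  have hL0 : 0 < L := by positivity
  have hC0 : 0 ≤ C₁ := by
    have := (abs_nonneg _).trans (hC₁ 1 one_pos 0 0)
    simpa using this
  have hN0 : 0 ≤ N := (abs_nonneg _).trans (hN 0)
  have hW0 : 0 ≤ W := (abs_nonneg _).trans (hW 0)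
  let E : E2 → ℝ := fun y => c - (β y + (h + μ y)) / 2
  have cE : ContDiff ℝ 1 E :=
    contDiff_const.sub ((C.β_contDiff.add (contDiff_const.add C.μ_contDiff)).div_const 2)
  have hdec := fun j => C.flux_decomposition F j cE fun y => rfl
  simp only [← hc] at hdec
  have hcub : ∀ y : E2, ‖y‖ < σ / 2 → 2 * K * ‖y‖ ^ 3 ≤ 2 * K * σ ^ 3 := fun y hy => by
    have : ‖y‖ ≤ σ := by linarith
    gcongr
  have b1 : ∀ j, |∫ y, dzeta σ j y * E y| ≤ C₁ * vb * σ * (K * σ ^ 3) := fun j => by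
    refine abs_integral_dzeta_mul_le hC₁ hσ cE.continuous (fun y hy => ?_) j
    have h1 := abs_le.1 ((C.β_odd y).trans (hcub y hy))
    have h2 := abs_le.1 ((C.μ_odd y).trans (hcub y hy))
    rw [abs_le]
    constructor <;> simp only [E] <;> linarith
  have b2 : ∀ j, |∫ y, dzeta σ j y * ((c - (h + μ y)) * (c - β y) / 2)| ≤
      C₁ * vb * σ * (K * σ ^ 3 * L) := fun j => by
    refine abs_integral_dzeta_mul_le hC₁ hσ ?_ (fun y hy => ?_) j
    · exact ((continuous_const.sub (continuous_const.add C.μ_contDiff.continuous)).mul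
        (continuous_const.sub C.β_contDiff.continuous)).div_const 2
    · have h1 := (C.β_odd y).trans (hcub y hy)
      have h2 := (C.μ_odd y).trans (hcub y hy)
      obtain ⟨h3, -⟩ := C.height_bound (show ‖y‖ < 3 / 4 * σ by linarith)
      obtain ⟨-, h4⟩ := C.height_bound (y := -y) (by rw [norm_neg]; linarith)
      have h5 : |c - β y| ≤ L := by rw [abs_le] at *; constructor <;> linarith
      have h6 : |c - (h + μ (-y))| ≤ L := by rw [abs_le] at *; constructor <;> linarith
      -- A discrete product rule: the odd part of the product is small because each factor has a
      -- small odd part and size at most `L`.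
      have e : (c - (h + μ y)) * (c - β y) / 2 - (c - (h + μ (-y))) * (c - β (-y)) / 2 =
          -((μ y - μ (-y)) * (c - β y) / 2) - (c - (h + μ (-y))) * (β y - β (-y)) / 2 := by ring
      rw [e]
      refine (abs_sub _ _).trans ?_
      rw [abs_neg, abs_div, abs_div, abs_mul, abs_mul, abs_two]
      calc |μ y - μ (-y)| * |c - β y| / 2 + |c - (h + μ (-y))| * |β y - β (-y)| / 2 ≤
          2 * K * σ ^ 3 * L / 2 + L * (2 * K * σ ^ 3) / 2 := by gcongr
        _ = _ := by ring
  have hWo : IsOpen (channel h σ β μ) :=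
    isOpen_channel C.β_contDiff.continuous C.μ_contDiff.continuous
  have b3 : ∀ j, |∫ x in channel h σ β μ, dzeta σ j (horiz x) *
      ((x 2 - β (horiz x)) * (h + μ (horiz x) - x 2) / 2) * H j x| ≤ C₁ / σ * (L ^ 2 / 2) * I := by
    intro j
    have h1 : |∫ x in channel h σ β μ, dzeta σ j (horiz x) *
        ((x 2 - β (horiz x)) * (h + μ (horiz x) - x 2) / 2) * H j x| ≤
        ∫ x in channel h σ β μ, C₁ / σ * (L ^ 2 / 2) * |H j x| := by
      rw [← Real.norm_eq_abs]
      refine norm_integral_le_of_norm_le ((C.H_int j).abs.const_mul _) ?_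
      refine (ae_restrict_iff' hWo.measurableSet).2 (Eventually.of_forall fun x hx => ?_)
      obtain ⟨h3, h4⟩ := C.height_bound hx.1
      have h5 := hx.2.1
      have h6 := hx.2.2
      have h7 := hC₁ σ hσ j (horiz x)
      rw [norm_mul, norm_mul, Real.norm_eq_abs, Real.norm_eq_abs, Real.norm_eq_abs,
        abs_of_nonneg (show 0 ≤ (x 2 - β (horiz x)) * (h + μ (horiz x) - x 2) / 2 from
          div_nonneg (mul_nonneg (by linarith) (by linarith)) two_pos.le)]
      rw [abs_le] at h3 h4
      have h8 : (x 2 - β (horiz x)) * (h + μ (horiz x) - x 2) ≤ L * L := by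
        apply mul_le_mul <;> linarith
      have h9 : 0 ≤ (x 2 - β (horiz x)) * (h + μ (horiz x) - x 2) :=
        mul_nonneg (by linarith) (by linarith)
      gcongr
      rw [sq]
      exact h8
    refine h1.trans ?_
    rw [integral_const_mul]
    have := hI j
    gcongr
  have b4 : ∀ j : Fin 2, |V j.castSucc + M j.castSucc 2 * (c - h)| ≤ W + N * L := fun j => by
    refine (abs_add_le _ _).trans (add_le_add (hW j) ?_)
    rw [abs_mul, abs_of_nonneg (show 0 ≤ c - h by linarith)]
    have := hN j
    have : c - h ≤ L := by linarith
    gcongr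
    linarith
  -- For the radial `zeta` one has `y₁ ∂₀ζ = y₀ ∂₁ζ`. Together with `M 1 0 = -M 0 1`, the rotation
  -- about the vertical axis, which nothing here controls, drops out of the flux.
  have hsk : ∫ y, y 1 * (dzeta σ 0 y * E y) = ∫ y, y 0 * (dzeta σ 1 y * E y) := by
    refine integral_congr_ae (Eventually.of_forall fun y => ?_)
    simp only [dzeta, PiLp.smul_apply, smul_eq_mul]
    ring
  have hflux := F.flux_eq
  rw [Fin.sum_univ_two, hdec, hdec] at hflux
  simp only [Fin.castSucc_zero, Fin.castSucc_one, F.diag_zero, zero_mul, add_zero,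
    hsk, F.skew 1 0] at hflux
  let Q : Fin 2 → ℝ := fun j => -(∫ x in channel h σ β μ, dzeta σ j (horiz x) *
          ((x 2 - β (horiz x)) * (h + μ (horiz x) - x 2) / 2) * H j x) -
        M j.castSucc 2 * (∫ y, dzeta σ j y * ((c - (h + μ y)) * (c - β y) / 2)) +
        (V j.castSucc + M j.castSucc 2 * (c - h)) * (∫ y, dzeta σ j y * E y)
  have hbd : ∀ j : Fin 2, |Q j| ≤
      C₁ / σ * (L ^ 2 / 2) * I + N * (C₁ * vb * σ * (K * σ ^ 3 * L)) +
        (W + N * L) * (C₁ * vb * σ * (K * σ ^ 3)) := by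
    intro j
    refine (abs_add_le _ _).trans (add_le_add ((abs_sub _ _).trans (add_le_add ?_ ?_)) ?_)
    · rw [abs_neg]; exact b3 j
    · rw [abs_mul]
      have := hN j
      have := b2 j
      gcongr
    · rw [abs_mul]
      have := b4 j
      have := b1 j
      gcongr
  rw [← abs_of_pos (show 0 < σ ^ 2 * mass0 from mul_pos (by positivity) mass0_pos), ← abs_mul]
  have e : V 2 * (σ ^ 2 * mass0) = Q 0 + Q 1 := by
    rw [hflux]
    simp only [Q, Fin.castSucc_zero, Fin.castSucc_one]
    ring
  rw [e]
  refine (abs_add_le _ _).trans ((add_le_add (hbd 0) (hbd 1)).trans ?_)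
  have hx : 0 ≤ C₁ * vb * K * σ ^ 4 * W := by positivity
  have e1 : C₁ / σ * (L ^ 2 / 2) * I + N * (C₁ * vb * σ * (K * σ ^ 3 * L)) +
        (W + N * L) * (C₁ * vb * σ * (K * σ ^ 3)) +
      (C₁ / σ * (L ^ 2 / 2) * I + N * (C₁ * vb * σ * (K * σ ^ 3 * L)) +
        (W + N * L) * (C₁ * vb * σ * (K * σ ^ 3))) =
      C₁ * L ^ 2 / σ * I + 2 * (C₁ * vb * K * σ ^ 4 * W) + 4 * (C₁ * vb * K * σ ^ 4 * (L * N)) := by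
    field_simp
    ring
  have hy : 0 ≤ C₁ * vb * K * σ ^ 4 * (L * N) := by positivity
  rw [e1]
  linarith

end GapChannel

/-- The second order bound for the normal velocity of the body. -/
theorem GapChannel.exists_speed_bound : ∃ C₀ : ℝ, 0 < C₀ ∧ ∀ (h d σ K : ℝ) (B : Set E3)
    (U : Fin 3 → E3 → ℝ) (G : Fin 3 → Fin 3 → E3 → ℝ) (Γ : E3 → ℝ) (V : Fin 3 → ℝ)
    (M : Fin 3 → Fin 3 → ℝ) (H : Fin 2 → E3 → ℝ) (β μ : E2 → ℝ) (I : ℝ),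
    GapFlow h d σ B U G Γ V M → GapChannel h d σ K B G H β μ →
    (∀ j, ∫ x in channel h σ β μ, |H j x| ≤ I) →
    |V 2| ≤ C₀ * ((h + 3 * d) ^ 2 / σ ^ 3 * I +
      K * (1 + (h + 3 * d) / σ) * gapMass h d σ B Γ) := by
  obtain ⟨C₁, hC₁, hdz⟩ := exists_dzeta_bound
  set m := min (moment0 0) (moment0 1)
  have hm : 0 < m := lt_min (moment0_pos 0) (moment0_pos 1)
  set vb := (volume (Metric.ball (0 : E2) 1)).toReal with hvb
  have hvb0 : 0 ≤ vb := ENNReal.toReal_nonneg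
  have hm0 := mass0_pos
  set a := (mass0 + vb) / m with ha
  have ha0 : 0 ≤ a := by positivity
  -- The first two terms come from `horizontal_bound`, where `a` accounts for the rotation; the last
  -- comes from the explicit rotation term of `speed_bound`.
  set e := 1 / mass0 + a / mass0 + 2 / m with he
  have he0 : 0 ≤ e := by positivity
  refine ⟨C₁ / mass0 * (1 + 4 * vb * e), by positivity, ?_⟩
  intro h d σ K B U G Γ V M H β μ I F C hI
  have hh := F.h_pos
  have hd := F.d_pos
  have hσ := F.σ_pos
  have hK := C.K_nonneg
  set L := h + 3 * d with hL
  have hL0 : 0 < L := by positivity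
  set ℓ := gapMass h d σ B Γ
  have hℓ : 0 ≤ ℓ := F.gapMass_nonneg
  have hI0 : 0 ≤ I := (integral_nonneg fun x => abs_nonneg (H 0 x)).trans (hI 0)
  have hN : ∀ j : Fin 2, |M j.castSucc 2| ≤ ℓ / (σ ^ 3 * m) := fun j => by
    rw [F.skew, abs_neg, le_div_iff₀ (by positivity)]
    refine le_trans ?_ (F.rotation_bound j)
    gcongr
    fin_cases j
    · exact min_le_left _ _
    · exact min_le_right _ _
  have hW : ∀ j : Fin 2, |V j.castSucc| ≤ ℓ / σ ^ 2 * (1 / mass0 + a / mass0 * (L / σ)) := fun j => by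
    have h1 := F.horizontal_bound j.castSucc
    rw [← le_div_iff₀ (by positivity)] at h1
    refine h1.trans ?_
    calc _ ≤ (ℓ + ℓ / (σ ^ 3 * m) * (L * (σ ^ 2 * (mass0 + vb)))) / (σ ^ 2 * mass0) := by
          have := hN j
          gcongr
      _ = _ := by rw [ha]; field_simp
  have key := C.speed_bound F hdz hI hW hN
  rw [← hL, ← hvb, ← le_div_iff₀ (by positivity)] at key
  refine key.trans ?_
  set r := L / σ with hr
  have hr0 : 0 ≤ r := by positivity
  have hLr : L = r * σ := by rw [hr]; field_simp
  have e1 : ℓ / σ ^ 2 * (1 / mass0 + a / mass0 * r) + 2 * L * (ℓ / (σ ^ 3 * m)) ≤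
      ℓ / σ ^ 2 * (e * (1 + r)) := by
    have : ℓ / σ ^ 2 * (1 / mass0 + a / mass0 * r) + 2 * L * (ℓ / (σ ^ 3 * m)) =
        ℓ / σ ^ 2 * (1 / mass0 + (a / mass0 + 2 / m) * r) := by
      rw [hLr]; field_simp
      ring
    rw [this]
    gcongr
    have p1 : 0 ≤ 1 / mass0 := by positivity
    have p2 : 0 ≤ a / mass0 := by positivity
    have p3 : 0 ≤ 2 / m := by positivity
    rw [he]
    nlinarith [mul_nonneg p1 hr0]
  calc _ ≤ (C₁ * L ^ 2 / σ * I + 4 * C₁ * vb * K * σ ^ 4 * (ℓ / σ ^ 2 * (e * (1 + r)))) /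
        (σ ^ 2 * mass0) := by gcongr
    _ = C₁ / mass0 * (L ^ 2 / σ ^ 3 * I + 4 * vb * e * (K * (1 + r) * ℓ)) := by
        field_simp
    _ ≤ C₁ / mass0 * ((1 + 4 * vb * e) * (L ^ 2 / σ ^ 3 * I) +
          (1 + 4 * vb * e) * (K * (1 + r) * ℓ)) := by
        have p1 : 0 ≤ L ^ 2 / σ ^ 3 * I := by positivity
        have p2 : 0 ≤ K * (1 + r) * ℓ := by positivity
        have p3 : 0 ≤ 4 * vb * e := by positivity
        refine mul_le_mul_of_nonneg_left (add_le_add ?_ ?_) (by positivity)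
        · exact le_mul_of_one_le_left p1 (by linarith)
        · exact mul_le_mul_of_nonneg_right (by linarith) p2
    _ = _ := by ring
end

/-! ### Part (ii): the bound in uniformly `C³` domains -/

noncomputable section

section Transfer

variable {Ω S : Set E3} {u : E3 → E3} {Du : E3 → E3 →L[ℝ] E3}
  {D2u : E3 → E3 →L[ℝ] E3 →L[ℝ] E3} {h d σ σ₀ K : ℝ} {β μ : E2 → ℝ}

/-- The second vertical derivatives of the horizontal components in the coordinates of a frame. -/
def frameHess (R : E3 ≃ᵃⁱ[ℝ] E3) (D2u : E3 → E3 →L[ℝ] E3 →L[ℝ] E3) (j : Fin 2) (x : E3) : ℝ :=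
  inner ℝ (R.linearIsometryEquiv (ev j.castSucc))
    (D2u (R x) (R.linearIsometryEquiv (ev 2)) (R.linearIsometryEquiv (ev 2)))

theorem abs_frameHess_le (R : E3 ≃ᵃⁱ[ℝ] E3) (D2u : E3 → E3 →L[ℝ] E3 →L[ℝ] E3) (j : Fin 2)
    (x : E3) : |frameHess R D2u j x| ≤ ‖D2u (R x)‖ := by
  refine (abs_real_inner_le_norm _ _).trans ?_
  rw [LinearIsometryEquiv.norm_map, norm_ev, one_mul]
  refine (ContinuousLinearMap.le_opNorm₂ _ _ _).trans ?_
  rw [LinearIsometryEquiv.norm_map, norm_ev, mul_one, mul_one]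

/-- The channel is contained in the fluid region. -/
theorem mapsTo_channel (R : E3 ≃ᵃⁱ[ℝ] E3) (hβ : Continuous β) (hμ : Continuous μ)
    (hin : ∀ x ∈ channel h σ β μ, R x ∈ Ω) (hout : ∀ x ∈ channel h σ β μ, R x ∉ S) :
    channel h σ β μ ⊆ R ⁻¹' (Ω \ closure S) := by
  intro x hx
  refine ⟨hin x hx, fun hxS => ?_⟩
  have h1 : x ∈ closure (R ⁻¹' S) := by
    have := R.toHomeomorph.preimage_closure S
    change R.toHomeomorph ⁻¹' closure S = closure (R ⁻¹' S) at this
    rw [← this]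
    exact hxS
  obtain ⟨z, hz1, hz2⟩ := mem_closure_iff.1 h1 _ (GapChannel.isOpen_channel hβ hμ) hx
  exact hout z hz1 hz2

theorem memLp_comp_frame {V : Type*} [NormedAddCommGroup V] (R : E3 ≃ᵃⁱ[ℝ] E3) {p : ℝ≥0∞}
    {W : Set E3} (hW : MeasurableSet W) {f : E3 → V} (hf : MemLp f p (volume.restrict W)) :
    MemLp (fun x => f (R x)) p (volume.restrict (R ⁻¹' W)) :=
  hf.comp_measurePreserving ((measurePreserving_frame R).restrict_preimage hW)

theorem integrableOn_frameHess (R : E3 ≃ᵃⁱ[ℝ] E3) {W A : Set E3} (hW : MeasurableSet W)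
    (hD : MemLp D2u 2 (volume.restrict W)) (hA : A ⊆ R ⁻¹' W) (hAfin : volume A < ⊤) (j : Fin 2) :
    IntegrableOn (frameHess R D2u j) A := by
  have h1 := (memLp_comp_frame (V := E3 →L[ℝ] E3 →L[ℝ] E3) R hW hD).mono_measure (Measure.restrict_mono hA le_rfl)
  have : IsFiniteMeasure (volume.restrict A) := ⟨by simpa using hAfin⟩
  have h2 : MemLp ((ContinuousLinearMap.apply ℝ (E3 →L[ℝ] E3) (R.linearIsometryEquiv (ev 2))) ∘
      fun x => D2u (R x)) 2 (volume.restrict A) :=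
    ContinuousLinearMap.comp_memLp' (E := E3 →L[ℝ] E3 →L[ℝ] E3) _ h1
  exact ((h2.integrable (by norm_num)).apply_continuousLinearMap
    (R.linearIsometryEquiv (ev 2))).const_inner _

/-- The weak derivative of the gradient in the fluid, taken in the direction `w` of the third axis
and composed with the functional `ℓ` that extracts the entry `∂₃uⱼ`. The change of variables is by
an isometry, and `tsupport ψ ⊆ W` allows to pass between `W` and the whole fluid region. -/
theorem HasWeakDeriv.frame (hΩ : IsOpen Ω) {p : ℝ≥0∞} (hp : 1 ≤ p)
    (hDu : MemLp Du p (volume.restrict Ω)) (hw : HasWeakDeriv (Ω \ closure S) Du D2u)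
    (hD2 : MemLp D2u 2 (volume.restrict (Ω \ closure S))) (R : E3 ≃ᵃⁱ[ℝ] E3) {W : Set E3}
    (hW : W ⊆ R ⁻¹' (Ω \ closure S)) {ψ : E3 → ℝ} (hψ : ContDiff ℝ 1 ψ)
    (hψc : HasCompactSupport ψ) (hψW : tsupport ψ ⊆ W) (j : Fin 2) :
    ∫ x in W, fderiv ℝ ψ x (ev 2) * frameGrad R Ω Du j.castSucc 2 x =
      -∫ x in W, ψ x * frameHess R D2u j x := by
  set A := Ω \ closure S with hA
  have hAo : IsOpen A := hΩ.sdiff isClosed_closure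
  set w := R.linearIsometryEquiv (ev 2) with hwdef
  have hψ' := contDiff_comp_frame_symm R hψ
  have hψc' := hasCompactSupport_comp_frame_symm R hψc
  have hsupp : tsupport (fun z => ψ (R.symm z)) ⊆ A := by
    have hcl : IsClosed (R.symm ⁻¹' tsupport ψ) :=
      (isClosed_tsupport ψ).preimage R.symm.continuous
    refine (closure_minimal (fun z hz => ?_) hcl).trans ?_
    · exact subset_closure hz
    · intro z hz
      have := hW (hψW hz)
      rwa [mem_preimage, R.apply_symm_apply] at this
  have key := hw.integral_fderiv_smul hAo hψ' hψc' hsupp w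
  let ℓ : (E3 →L[ℝ] E3) →L[ℝ] ℝ :=
    (innerSL ℝ (R.linearIsometryEquiv (ev j.castSucc))).comp (ContinuousLinearMap.apply ℝ E3 w)
  have hℓ : ∀ L, ℓ L = inner ℝ (R.linearIsometryEquiv (ev j.castSucc)) (L w) := fun L => rfl
  have c1 : Continuous fun z => fderiv ℝ (fun z => ψ (R.symm z)) z w :=
    (hψ'.continuous_fderiv one_ne_zero).clm_apply continuous_const
  have c2 : HasCompactSupport fun z => fderiv ℝ (fun z => ψ (R.symm z)) z w :=
    (hψc'.fderiv (𝕜 := ℝ)).comp_left (g := fun l : E3 →L[ℝ] ℝ => l w) (by simp)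
  have i1 := integrable_smul_of_memLp c1 c2 hp
    (hDu.mono_measure (Measure.restrict_mono (sdiff_subset : A ⊆ Ω) le_rfl))
  have hD2w : MemLp ((ContinuousLinearMap.apply ℝ (E3 →L[ℝ] E3) w) ∘ D2u) 2 (volume.restrict A) :=
    ContinuousLinearMap.comp_memLp' (E := E3 →L[ℝ] E3 →L[ℝ] E3) _ hD2
  have i2 := integrable_smul_of_memLp hψ'.continuous hψc' (by norm_num) hD2w
  have key2 := congrArg ℓ key
  rw [map_neg, ← ℓ.integral_comp_comm i1] at key2
  have key3 := ℓ.integral_comp_comm i2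
  rw [show (∫ x in A, ψ (R.symm x) • D2u x w) = ∫ x in A, ψ (R.symm x) •
    ((ContinuousLinearMap.apply ℝ (E3 →L[ℝ] E3) w) ∘ D2u) x from rfl, ← key3] at key2
  have hpre : MeasurableSet (R ⁻¹' A) := (hAo.preimage R.continuous).measurableSet
  have e1 : ∫ x in W, fderiv ℝ ψ x (ev 2) * frameGrad R Ω Du j.castSucc 2 x =
      ∫ z in A, ℓ (fderiv ℝ (fun z => ψ (R.symm z)) z w • Du z) := by
    rw [← (measurePreserving_frame R).setIntegral_preimage_emb (measurableEmbedding_frame R)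
        (fun z => ℓ (fderiv ℝ (fun z => ψ (R.symm z)) z w • Du z)),
      ← setIntegral_eq_of_subset_of_forall_sdiff_eq_zero hpre hW]
    · refine setIntegral_congr_fun hpre fun x hx => ?_
      have hxΩ : R x ∈ Ω := hx.1
      simp only [hwdef, fderiv_comp_frame_symm R hψ, hℓ, frameGrad,
        indicator_of_mem hxΩ, _root_.smul_apply, real_inner_smul_right]
    · rintro x ⟨-, hx⟩
      have : fderiv ℝ ψ x = 0 := by
        by_contra hne
        exact hx (hψW (support_fderiv_subset ℝ hne))
      rw [this]
      simp
  have e2 : ∫ x in W, ψ x * frameHess R D2u j x =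
      ∫ z in A, ℓ (ψ (R.symm z) • ((ContinuousLinearMap.apply ℝ (E3 →L[ℝ] E3) w) ∘ D2u) z) := by
    rw [← (measurePreserving_frame R).setIntegral_preimage_emb (measurableEmbedding_frame R)
        (fun z => ℓ (ψ (R.symm z) • ((ContinuousLinearMap.apply ℝ (E3 →L[ℝ] E3) w) ∘ D2u) z)),
      ← setIntegral_eq_of_subset_of_forall_sdiff_eq_zero hpre hW]
    · refine setIntegral_congr_fun hpre fun x hx => ?_
      simp only [R.symm_apply_apply, hℓ, frameHess, _root_.smul_apply, real_inner_smul_right,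
        Function.comp, ContinuousLinearMap.apply_apply, hwdef]
    · rintro x ⟨-, hx⟩
      have : ψ x = 0 := by
        by_contra hne
        exact hx (hψW (subset_closure hne))
      rw [this, zero_mul]
  rw [e1, e2, key2]

theorem integral_frameHess_le (hΩ : IsOpen Ω)
    (hD2 : MemLp D2u 2 (volume.restrict (Ω \ closure S))) (R : E3 ≃ᵃⁱ[ℝ] E3) {W Z : Set E3}
    (hW : W ⊆ R ⁻¹' (Ω \ closure S)) (hWZ : W ⊆ Z) (hWm : MeasurableSet W)
    (hZfin : volume Z < ⊤) (j : Fin 2) :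
    ∫ x in W, |frameHess R D2u j x| ≤ ∫ z in R '' Z ∩ (Ω \ closure S), ‖D2u z‖ := by
  set A := Ω \ closure S with hA
  have hAo : IsOpen A := hΩ.sdiff isClosed_closure
  have e : R ⁻¹' (R '' Z ∩ A) = Z ∩ R ⁻¹' A := by
    rw [preimage_inter, preimage_image_eq _ R.injective]
  rw [← (measurePreserving_frame R).setIntegral_preimage_emb (measurableEmbedding_frame R)
    (fun z => ‖D2u z‖), e]
  have h1 := (memLp_comp_frame (V := E3 →L[ℝ] E3 →L[ℝ] E3) R hAo.measurableSet hD2).mono_measure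
    (Measure.restrict_mono (inter_subset_right : Z ∩ R ⁻¹' A ⊆ R ⁻¹' A) le_rfl)
  have hfin : volume (Z ∩ R ⁻¹' A) < ⊤ := (measure_mono inter_subset_left).trans_lt hZfin
  have : IsFiniteMeasure (volume.restrict (Z ∩ R ⁻¹' A)) := ⟨by simpa using hfin⟩
  have h2 : IntegrableOn (fun x => ‖D2u (R x)‖) (Z ∩ R ⁻¹' A) :=
    (h1.integrable (by norm_num)).norm
  have hsub : W ⊆ Z ∩ R ⁻¹' A := subset_inter hWZ hW
  refine le_trans ?_ (setIntegral_mono_set h2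
    (Eventually.of_forall fun x => norm_nonneg (D2u (R x))) hsub.eventuallyLE)
  refine setIntegral_mono_on ?_ (h2.mono_set hsub) hWm fun x _ => abs_frameHess_le R D2u j x
  exact (integrableOn_frameHess R hAo.measurableSet hD2 hW
    ((measure_mono hWZ).trans_lt hZfin) j).abs

end Transfer

/-- With `σ = √h` one has `d = K h`, and the cylinder has a volume of order `σ² h = σ⁴`. Each
integral is thus at most a multiple of `σ²` times an `L²` norm. The coefficient of the second
derivative, `(h + 3d)² / σ³`, is of order `σ`, which gives `σ³ = h^{3/2}`; that of the gradient is
bounded, which gives `σ² = h`. -/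
theorem exists_speed_bound_C3 {K σ₀ : ℝ} (hK : 0 < K) :
    ∃ C : ℝ, 0 < C ∧ ∀ (Ω S : Set E3) (u : E3 → E3) (Du : E3 → E3 →L[ℝ] E3)
      (D2u : E3 → E3 →L[ℝ] E3 →L[ℝ] E3) (a b c : E3) (h : ℝ)
      (R : E3 ≃ᵃⁱ[ℝ] E3), IsOpen Ω → IsOpen S → S ⊆ Ω → UniformlyC3 K σ₀ Ω →
      UniformlyC3 K σ₀ S → MemW10 Ω 2 u Du →
      (∀ᵐ x ∂(volume.restrict S), u x = rigidVel a b c x) →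
      (∀ᵐ x ∂(volume.restrict Ω), LinearMap.trace ℝ E3 (Du x : E3 →ₗ[ℝ] E3) = 0) →
      HasWeakDeriv (Ω \ closure S) Du D2u → MemLp D2u 2 (volume.restrict (Ω \ closure S)) →
      0 < h → h < 1 → h < σ₀ ^ 2 → (1 + 2 * K) * h < K * σ₀ ^ 2 →
      h = setDist S (frontier Ω) → IsGapFrame Ω S h R →
      |inner ℝ (R.linearIsometryEquiv (ev 2)) (rigidVel a b c (R !₂[0, 0, h]))| ≤
        C * (h ^ (3 / 2 : ℝ) * (eLpNorm D2u 2 (volume.restrict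
            (R '' cyl K 1 h (h ^ (1 / 2 : ℝ)) ∩ (Ω \ closure S)))).toReal +
          h * (eLpNorm Du 2 (volume.restrict
            (R '' cyl K 1 h (h ^ (1 / 2 : ℝ)) ∩ (Ω \ closure S)))).toReal) := by
  obtain ⟨C₀, hC₀, hbound⟩ := GapChannel.exists_speed_bound
  set vb := (volume (Metric.ball (0 : E2) 1)).toReal
  have hvb : 0 < vb := ENNReal.toReal_pos (Metric.measure_ball_pos _ _ one_pos).ne'
    measure_ball_lt_top.ne
  set s := √(vb * (1 + 3 * K)) with hs
  have hs0 : 0 < s := by positivity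
  refine ⟨C₀ * s * ((1 + 3 * K) ^ 2 + K * (2 + 3 * K)), by positivity, ?_⟩
  intro Ω S u Du D2u a b c h R hΩ hS hSΩ hΩ3 hS3 hu hrig hdiv hw hD2 hpos hh1 hh2 hh3 hh hR
  have hσ₀ : 0 < σ₀ := hΩ3.2.1
  set σ := h ^ (1 / 2 : ℝ) with hσdef
  have hσ : 0 < σ := by positivity
  have hσ2 : σ ^ 2 = h := by
    rw [hσdef, ← Real.rpow_natCast, ← Real.rpow_mul hpos.le]
    norm_num
  have hσ3 : σ ^ 3 = h ^ (3 / 2 : ℝ) := by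
    rw [hσdef, ← Real.rpow_natCast, ← Real.rpow_mul hpos.le]
    norm_num
  have hσ1 : σ < 1 := by nlinarith
  have hσσ : σ < σ₀ := by nlinarith
  set d := K * σ ^ ((1 : ℝ) + 1) with hd
  have hdh : d = K * h := by
    rw [hd, ← hσ2, ← Real.rpow_natCast]
    norm_num
  have hd0 : 0 < d := by positivity
  have hcyl : cyl K 1 h σ = zone h d σ := rfl
  obtain ⟨⟨β₀, hβ₀, hΩg⟩, μ₀, hμ₀, hSg⟩ := hR.shape_C3 hpos hh hΩ hSΩ hΩ3 hS3
  have hgr : ∀ {g : E2 → ℝ}, IsGraphFn K σ₀ g → ∀ x : E3, ‖horiz x‖ < σ →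
      |g (horiz x)| ≤ d := fun {g} hg x hx => by
    refine (hg.le_sq _ (by simpa using hx.trans hσσ)).trans ?_
    rw [hdh, ← hσ2]
    gcongr
  have hKd : h + 2 * d < K * σ₀ ^ 2 := by rw [hdh]; linarith
  have F := hu.gapFlow hΩ hS hSΩ (hS3.uniformlyC1.volume_frontier one_pos hS) (by norm_num)
    hrig hdiv R hpos hd0 hσ
    (fun x hx h1 h2 hxΩ => by
      have h3 := (hΩg x (hx.trans hσσ) (by rw [abs_lt]; constructor <;> linarith)).1 hxΩ
      linarith [(abs_le.1 (hgr hβ₀ x hx)).1])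
    (fun x hx h1 h2 => by
      refine (hSg x (hx.trans hσσ) (by rw [abs_lt]; constructor <;> linarith)).2 ?_
      linarith [(abs_le.1 (hgr hμ₀ x hx)).2])
  obtain ⟨β, β1, β2, β3, β4⟩ := hβ₀.exists_extension hK.le hσ hσσ.le
  obtain ⟨μ, μ1, μ2, μ3, μ4⟩ := hμ₀.exists_extension hK.le hσ hσσ.le
  have hsmall : ∀ {g : E2 → ℝ}, (∀ y, |g y| ≤ K * ‖y‖ ^ 2) → ∀ y, ‖y‖ < 3 / 4 * σ →
      |g y| ≤ d := fun {g} hg y hy => by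
    refine (hg y).trans ?_
    rw [hdh, ← hσ2]
    have : ‖y‖ ≤ σ := by linarith
    gcongr
  have hbody : ∀ x : E3, ‖horiz x‖ < 3 / 4 * σ → -d < x 2 → x 2 < h + 2 * d →
      (R x ∈ S ↔ h + μ (horiz x) < x 2) := fun x hx h1 h2 => by
    rw [hSg x (by linarith) (by rw [abs_lt]; constructor <;> linarith), μ4 _ hx,
      lt_sub_iff_add_lt']
  have hdom : ∀ x : E3, ‖horiz x‖ < 3 / 4 * σ → -d < x 2 → x 2 < h + 2 * d →
      (R x ∈ Ω ↔ β (horiz x) < x 2) := fun x hx h1 h2 => by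
    rw [hΩg x (by linarith) (by rw [abs_lt]; constructor <;> linarith), β4 _ hx]
  have hrange : ∀ x ∈ channel h σ β μ, -d < x 2 ∧ x 2 < h + 2 * d := by
    rintro x ⟨h1, h2, h3⟩
    have := abs_le.1 (hsmall β2 _ h1)
    have := abs_le.1 (hsmall μ2 _ h1)
    constructor <;> linarith
  have hchan : channel h σ β μ ⊆ R ⁻¹' (Ω \ closure S) :=
    mapsTo_channel R β1.continuous μ1.continuous
      (fun x hx => (hdom x hx.1 (hrange x hx).1 (hrange x hx).2).2 hx.2.1)
      fun x hx hxS => by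
        have := (hbody x hx.1 (hrange x hx).1 (hrange x hx).2).1 hxS
        linarith [hx.2.2]
  have hcz : channel h σ β μ ⊆ zone h d σ := fun x hx =>
    ⟨by linarith [hx.1], (hrange x hx).1, (hrange x hx).2⟩
  have hzfin : volume (zone h d σ) < ⊤ := (isBounded_zone h d σ).measure_lt_top
  have hAo : IsOpen (Ω \ closure S) := hΩ.sdiff isClosed_closure
  have hWo : IsOpen (channel h σ β μ) := GapChannel.isOpen_channel β1.continuous μ1.continuous
  have G : GapChannel h d σ K (R ⁻¹' S) (frameGrad R Ω Du) (frameHess R D2u) β μ :=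
    { K_nonneg := hK.le
      K_le := by rw [hdh, hσ2]
      β_contDiff := β1
      μ_contDiff := μ1
      β_le := β2
      μ_le := μ2
      β_odd := β3
      μ_odd := μ3
      body := hbody
      below := fun x hx h1 h2 i j => by
        have h3 := abs_le.1 (hsmall β2 _ hx)
        have : R x ∉ Ω := fun hxΩ => by
          have := (hdom x hx h1 (by linarith)).1 hxΩ
          linarith
        rw [frameGrad, indicator_of_notMem this]
        simp
      β_le_μ := fun y hy => by
        by_contra hlt
        rw [not_le] at hlt
        have h3 := abs_le.1 (hsmall β2 _ hy)
        have h4 := abs_le.1 (hsmall μ2 _ hy)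
        -- If the walls crossed, the midpoint between them would be above the graph of the body and
        -- below that of `Ω`, contrary to `S ⊆ Ω`.
        let x : E3 := embed y + ((h + μ y + β y) / 2) • e3
        have x1 : horiz x = y := by
          rw [horiz_add, horiz_embed, horiz_smul, horiz_e3, smul_zero, add_zero]
        have x2 : x 2 = (h + μ y + β y) / 2 := by simp [x, embed, e3]
        have h5 := (hbody x (by rwa [x1]) (by rw [x2]; linarith) (by rw [x2]; linarith)).2
          (by rw [x1, x2]; linarith)
        have h6 := (hdom x (by rwa [x1]) (by rw [x2]; linarith) (by rw [x2]; linarith)).1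
          (hSΩ h5)
        rw [x1, x2] at h6
        linarith
      H_int := fun j => integrableOn_frameHess R hAo.measurableSet hD2 hchan
        ((measure_mono hcz).trans_lt hzfin) j
      weak := fun ψ h1 h2 h3 j => hw.frame hΩ (by norm_num) hu.2.1 hD2 R hchan h1 h2 h3 j }
  have key := hbound _ _ _ _ _ _ _ _ _ _ _ _ _ _ F G fun j =>
    integral_frameHess_le hΩ hD2 R hchan hcz hWo.measurableSet hzfin j
  rw [gapMass_frame hΩ] at key
  rw [hcyl]
  have hvol : volume (R '' zone h d σ ∩ (Ω \ closure S)) ≤ ENNReal.ofReal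
      (σ ^ 2 * vb * (h + 3 * d)) := by
    refine (measure_mono inter_subset_left).trans_eq ?_
    rw [volume_frame_image, volume_zone hσ.le]
  have hL : h + 3 * d = (1 + 3 * K) * σ ^ 2 := by rw [hdh, hσ2]; ring
  have hsqrt : (σ ^ 2 * vb * (h + 3 * d)) ^ (1 - 1 / (2 : ℝ≥0∞).toReal) = s * σ ^ 2 := by
    rw [ENNReal.toReal_ofNat, show (1 : ℝ) - 1 / 2 = 1 / 2 by norm_num, ← Real.sqrt_eq_rpow, hL,
      show σ ^ 2 * vb * ((1 + 3 * K) * σ ^ 2) = vb * (1 + 3 * K) * (σ ^ 2) ^ 2 by ring,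
      Real.sqrt_mul (by positivity), Real.sqrt_sq (by positivity)]
  have hne := (hvol.trans_lt ENNReal.ofReal_lt_top).ne
  have hle := ENNReal.toReal_le_of_le_ofReal (by positivity) hvol
  have m1 := setIntegral_norm_le (p := 2) (by norm_num) (by norm_num)
    (hu.2.1.mono_measure (Measure.restrict_mono (show R '' zone h d σ ∩ (Ω \ closure S) ⊆ Ω from
      fun x hx => hx.2.1) le_rfl)) hne hle
  have m2 := setIntegral_norm_le (V := E3 →L[ℝ] E3 →L[ℝ] E3) (p := 2) (by norm_num) (by norm_num)
    (hD2.mono_measure (Measure.restrict_mono (inter_subset_right :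
      R '' zone h d σ ∩ (Ω \ closure S) ⊆ Ω \ closure S) le_rfl)) hne hle
  rw [hsqrt] at m1 m2
  set N1 := (eLpNorm Du 2 (volume.restrict (R '' zone h d σ ∩ (Ω \ closure S)))).toReal
  set N2 := (eLpNorm D2u 2 (volume.restrict (R '' zone h d σ ∩ (Ω \ closure S)))).toReal
  have hN1 : 0 ≤ N1 := ENNReal.toReal_nonneg
  have hN2 : 0 ≤ N2 := ENNReal.toReal_nonneg
  have e1 : (h + 3 * d) ^ 2 / σ ^ 3 = (1 + 3 * K) ^ 2 * σ := by
    rw [hL]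
    field_simp
  have e2 : 1 + (h + 3 * d) / σ ≤ 2 + 3 * K := by
    have : (h + 3 * d) / σ = (1 + 3 * K) * σ := by
      rw [hL]
      field_simp
    rw [this]
    nlinarith
  rw [← hσ3]
  rw [e1] at key
  have q1 : 0 ≤ σ ^ 3 * N2 := by positivity
  have q2 : 0 ≤ σ ^ 2 * N1 := by positivity
  calc _ ≤ _ := key
    _ ≤ C₀ * ((1 + 3 * K) ^ 2 * σ * (N2 * (s * σ ^ 2)) +
        K * (2 + 3 * K) * (N1 * (s * σ ^ 2))) := by gcongr
    _ = C₀ * s * ((1 + 3 * K) ^ 2 * (σ ^ 3 * N2) + K * (2 + 3 * K) * (σ ^ 2 * N1)) := by ring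
    _ ≤ C₀ * s * (((1 + 3 * K) ^ 2 + K * (2 + 3 * K)) * (σ ^ 3 * N2) +
        ((1 + 3 * K) ^ 2 + K * (2 + 3 * K)) * (σ ^ 2 * N1)) := by
        refine mul_le_mul_of_nonneg_left (add_le_add ?_ ?_) (by positivity)
        · refine mul_le_mul_of_nonneg_right ?_ q1
          have : 0 ≤ K * (2 + 3 * K) := by positivity
          linarith
        · refine mul_le_mul_of_nonneg_right ?_ q2
          have : 0 ≤ (1 + 3 * K) ^ 2 := by positivity
          linarith
    _ = _ := by rw [hσ2]; ring

theorem speed_bound_C3 (Ω S₀ : Set E3) (hΩ : IsDomain3 Ω) (hS₀ : IsDomain3 S₀)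
    (hS₀b : Bornology.IsBounded S₀) (K σ₀ : ℝ) (hΩ3 : UniformlyC3 K σ₀ Ω)
    (hS3 : UniformlyC3 K σ₀ S₀) :
      ∃ H₀ Cs c₀ : ℝ, 0 < H₀ ∧ 0 < Cs ∧ 0 < c₀ ∧
        ∀ (T : ℝ) (us om xs : ℝ → E3) (X : ℝ → E3 → E3)
          (u : ℝ → E3 → E3) (Du : ℝ → E3 → E3 →L[ℝ] E3)
          (D2u : ℝ → E3 → E3 →L[ℝ] E3 →L[ℝ] E3) (S : ℝ → Set E3) (h : ℝ → ℝ),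
          0 < T →
          IsRigidMotion Ω S₀ T us om xs X →
          (∀ t, S t = X t '' S₀) →
          (∀ t, h t = setDist (S t) (frontier Ω)) →
          InBodySpace Ω S T 2 us om xs u Du →
          (∀ᵐ t ∂(volume.restrict (Ioo 0 T)),
            HasWeakDeriv (Ω \ closure (S t)) (Du t) (D2u t) ∧
            MemLp (D2u t) 2 (volume.restrict (Ω \ closure (S t)))) →
          (∃ L : ℝ≥0, LipschitzOnWith L h {t ∈ Ico 0 T | h t < H₀}) ∧
          ∀ᵐ t ∂(volume.restrict (Ioo 0 T)), h t < H₀ →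
            DifferentiableAt ℝ h t ∧
            ∀ R : E3 ≃ᵃⁱ[ℝ] E3, IsGapFrame Ω (S t) (h t) R →
              |deriv h t| ≤
                Cs * (h t ^ (3 / 2 : ℝ) *
                    (eLpNorm (D2u t) 2 (volume.restrict
                      (R '' cyl K 1 (h t) (c₀ * h t ^ (1 / 2 : ℝ)) ∩
                        (Ω \ closure (S t))))).toReal +
                  h t *
                    (eLpNorm (Du t) 2 (volume.restrict
                      (R '' cyl K 1 (h t) (c₀ * h t ^ (1 / 2 : ℝ)) ∩
                        (Ω \ closure (S t))))).toReal) := by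
  have hK : 0 < K := hΩ3.1
  have hσ₀ : 0 < σ₀ := hΩ3.2.1
  obtain ⟨C, hC, hbound⟩ := exists_speed_bound_C3 (σ₀ := σ₀) hK
  -- The three bounds give `h < 1`, `√h < σ₀` and `h + 2 d < K σ₀²`; the last two keep the cylinder
  -- inside the local coordinates of both boundaries.
  refine ⟨min 1 (min (σ₀ ^ 2) (K * σ₀ ^ 2 / (1 + 2 * K))), C, 1, by positivity, hC, one_pos, ?_⟩
  intro T us om xs X u Du D2u S h hT hX hS hh hu hD2
  obtain ⟨⟨L, hL⟩, A, hA, hder⟩ := hX.gap hS₀ hS₀b hS hh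
  refine ⟨⟨L, hL.mono fun t ht => ht.1⟩, ?_⟩
  filter_upwards [hder, hu.mem_W10, hu.rigid, hu.div_free, hD2, ae_restrict_mem measurableSet_Ioo]
    with t ⟨h1, h2, h3⟩ h4 h5 h6 ⟨h7, h8⟩ ht hlt
  refine ⟨h1, fun R hR => ?_⟩
  have hnn : 0 ≤ h t := by rw [hh]; exact setDist_nonneg _ _
  rcases hnn.eq_or_lt with h0 | hpos
  · rw [h2 h0.symm, abs_zero]
    positivity
  · rw [h3 R hR hpos, one_mul]
    have ht' := Ioo_subset_Ico_self ht
    obtain ⟨l1, l2⟩ := lt_min_iff.1 hlt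
    obtain ⟨l2, l3⟩ := lt_min_iff.1 l2
    rw [lt_div_iff₀ (by positivity), mul_comm] at l3
    refine hbound Ω (S t) (u t) (Du t) (D2u t) _ _ _ _ R hΩ.1 ?_ ?_ hΩ3 ?_ h4 h5 h6 h7 h8 hpos
      l1 l2 l3 (hh t) hR
    · rw [hA t ht']
      exact (A t).toHomeomorph.isOpenMap _ hS₀.1
    · rw [hS]; exact hX.inside t ht'
    · rw [hA t ht']; exact hS3.image (A t)

end

theorem theorem1p3 (Ω S₀ : Set E3) (hΩ : IsDomain3 Ω) (hS₀ : IsDomain3 S₀)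
    (hS₀b : Bornology.IsBounded S₀) :
    -- Part (i)
    (∀ α p k σ₀ : ℝ, 0 < α → α ≤ 1 → 1 ≤ p →
      UniformlyC1 α k σ₀ Ω → UniformlyC1 α k σ₀ S₀ → InnerSphere Ω →
      ∃ H₀ Cw c₀ : ℝ, 0 < H₀ ∧ 0 < Cw ∧ 0 < c₀ ∧
        ∀ (T : ℝ) (us om xs : ℝ → E3) (X : ℝ → E3 → E3)
          (u : ℝ → E3 → E3) (Du : ℝ → E3 → E3 →L[ℝ] E3) (S : ℝ → Set E3) (h : ℝ → ℝ),
          0 < T →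
          IsRigidMotion Ω S₀ T us om xs X →
          (∀ t, S t = X t '' S₀) →
          (∀ t, h t = setDist (S t) (frontier Ω)) →
          InBodySpace Ω S T (ENNReal.ofReal p) us om xs u Du →
          (∃ L : ℝ≥0, LipschitzOnWith L h {t ∈ Ico 0 T | h t < H₀}) ∧
          ∀ᵐ t ∂(volume.restrict (Ioo 0 T)), h t < H₀ →
            DifferentiableAt ℝ h t ∧
            ∀ R : E3 ≃ᵃⁱ[ℝ] E3, IsGapFrame Ω (S t) (h t) R →
              |deriv h t| ≤
                Cw * h t ^ ((1 + 2 * α) / (p * (1 + α)) * (p - (3 + α) / (1 + 2 * α))) *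
                  (eLpNorm (Du t) (ENNReal.ofReal p) (volume.restrict
                    (R '' cyl k α (h t) (c₀ * h t ^ (1 / (1 + α))) ∩
                      (Ω \ closure (S t))))).toReal) ∧
    -- Part (ii)
    (∀ K σ₀ : ℝ, UniformlyC3 K σ₀ Ω → UniformlyC3 K σ₀ S₀ →
      ∃ H₀ Cs c₀ : ℝ, 0 < H₀ ∧ 0 < Cs ∧ 0 < c₀ ∧
        ∀ (T : ℝ) (us om xs : ℝ → E3) (X : ℝ → E3 → E3)
          (u : ℝ → E3 → E3) (Du : ℝ → E3 → E3 →L[ℝ] E3)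
          (D2u : ℝ → E3 → E3 →L[ℝ] E3 →L[ℝ] E3) (S : ℝ → Set E3) (h : ℝ → ℝ),
          0 < T →
          IsRigidMotion Ω S₀ T us om xs X →
          (∀ t, S t = X t '' S₀) →
          (∀ t, h t = setDist (S t) (frontier Ω)) →
          InBodySpace Ω S T 2 us om xs u Du →
          (∀ᵐ t ∂(volume.restrict (Ioo 0 T)),
            HasWeakDeriv (Ω \ closure (S t)) (Du t) (D2u t) ∧
            MemLp (D2u t) 2 (volume.restrict (Ω \ closure (S t)))) →
          (∃ L : ℝ≥0, LipschitzOnWith L h {t ∈ Ico 0 T | h t < H₀}) ∧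
          ∀ᵐ t ∂(volume.restrict (Ioo 0 T)), h t < H₀ →
            DifferentiableAt ℝ h t ∧
            ∀ R : E3 ≃ᵃⁱ[ℝ] E3, IsGapFrame Ω (S t) (h t) R →
              |deriv h t| ≤
                Cs * (h t ^ (3 / 2 : ℝ) *
                    (eLpNorm (D2u t) 2 (volume.restrict
                      (R '' cyl K 1 (h t) (c₀ * h t ^ (1 / 2 : ℝ)) ∩
                        (Ω \ closure (S t))))).toReal +
                  h t *
                    (eLpNorm (Du t) 2 (volume.restrict
                      (R '' cyl K 1 (h t) (c₀ * h t ^ (1 / 2 : ℝ)) ∩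
                        (Ω \ closure (S t))))).toReal)) := by
  refine ⟨fun α p k σ₀ hα _ hp hΩ1 hS1 _ => ?_, fun K σ₀ hΩ3 hS3 => ?_⟩
  · exact speed_bound_C1 Ω S₀ hΩ hS₀ hS₀b α p k σ₀ hα hp hΩ1 hS1
  · exact speed_bound_C3 Ω S₀ hΩ hS₀ hS₀b K σ₀ hΩ3 hS3
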